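/- **Setting.** Let $\Sigma$ be a finite alphabet, $\mathcal C=\{c_k : k\in\mathbb N\}$ an extended alphabet indexed by the natural numbers, $\$$ a start symbol, and $\Omega=\Sigma\sqcup\mathcal C\sqcup\{\$\}$. *C\*-RASP.* Let $\Psi$ be a set of local relations $\psi(i,j)$, $1\le j\le i$: each is translation-invariant, $\psi(i+t,j+t)=\psi(i,j)$, and there is $r$ with $\psi(i,j)=0$ whenever $j<i-r$. A C\*-RASP program is a finite sequence of operations, each Boolean- or count-valued (integer-valued), built from earlier ones. Boolean: $Q_\sigma(i)$ for $\sigma\in\Sigma$, $\lnot P_1(i)$, $P_1(i)\wedge P_2(i)$, $\top$, $C_1(i)\le C_2(i)$. Count: $\#[j\le i]\,P(j)$; $\#[j\le i,\psi(i,j)]\,P(j)$ for $\psi\in\Psi$; $\#[j\le i,\chi(i,j)]$ for a match predicate $\chi(i,j)=\bigwedge_{k=1}^K (c_{j-\delta_k}=c_{i-\gamma_k}+\tau_k)$ with constants $\delta_k,\gamma_k\in\mathbb N$, $\tau_k\in\mathbb Z$ (a conjunct holds iff the positions $j-\delta_k,i-\gamma_k\ge 1$ both carry symbols of $\mathcal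 C$, whose indices differ by $\tau_k$ as stated); "if $P(i)$ then $C_1(i)$ else $C_2(i)$"; $C_1(i)\pm C_2(i)$; the constant $1$. The last operation is Boolean, and the program accepts a nonempty word $w$ iff that operation is true at position $|w|$. *Transformers.* A transformer with residual space a real Hilbert space $\mathcal H$ has positional encodings $p_t\in\mathcal H$, embeddings $E_\omega\in\mathcal H$ ($\omega\in\Omega$), $L$ layers with $H$ heads, operators $K_{l,h},Q_{l,h},V_{l,h}$ on $\mathcal H$, MLPs $A_l:\mathcal H\to\mathbb R^{d_{\rm ff}}$, $b_l\in\mathbb R^{d_{\rm ff}}$, $B_l:\mathbb R^{d_{\rm ff}}\to\mathcal H$, and unembedding rows $U_\omega\in\mathcal H$. For context width $N\in\mathbb N\cup\{\infty\}$ only the first $N$ positional encodings and the first $N$ extended symbols exist. On an input $x=\$w$ with offsets $o_p,o_c$ the token at position $i$ starts as $E_{x_i}+p_{i+o_p}$, where $c_k$ is replaced by $c_{k+o_c}$. Layer $l$ is causal softmax attention with residual connection, logits $\langle K_{l,h}y_j,Q_{l,h}y_i\rangle$, weights $\exp(\log|x|\cdot\text{logit})$, logits and weights being rounded to a fixed number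 of fractional bits (a head whose weights all round to $0$ contributes $0$), followed by $Y\mapsto Y+B_l\,\phi_l(A_lY+b_l)$, where each coordinate of $\phi_l$ is ReLU, Heaviside or $x\mapsto 1/(x+\varepsilon)$, for a fixed constant $\varepsilon>0$. The output is $T(x,o_p,o_c)_{i,\omega}=\langle U_\omega,y^{(L)}_i\rangle$. $T$ accepts $\$w$ iff $T(\$w,0,0)_{|\$w|,\$}>0$ ($\$$ being the distinguished, "last", output coordinate). *Product functions.* For products $S,S_1,S_2$ of value operators with at most one head per layer (higher layers to the left), these are $\langle K_{l,h}S_1v,Q_{l,h}S_2v'\rangle$, $\langle U_\omega,Sv\rangle$ and $\langle (A_l)_s,Sv\rangle$, with $v,v'$ ranging over the $p_t$, the $E_\omega$ and the columns of the $B_l$. They are *translation-invariant* if a product involving two positions, or two extended symbols (including $U_{c_k}$ with $E_{c_m}$), is unchanged when both indices are shifted equally, while a product involving a position and an extended symbol, or only one position or one extended symbol, does not depend on the indices. They are *local* if for some $\Delta$ the products of two positions, or of two extended symbols, vanish when the indices differ by more than $\Delta$. *Symbolic Limit Transformer:* $N=\infty$, $p_t$ and $E_{c_k}$ uniformly bounded,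 all operators (including $U:\mathcal H\to\ell^2(\Omega)$) bounded, MLPs of finite width, all product functions multiples of $2^{-p}$ for one fixed $p$, translation-invariant and local. *Learning model.* $\Theta_n$ is the class of transformers with $N=n$, $\mathcal H=\mathbb R^d$ for some $d$, all parameters multiples of $2^{-p}$ for some $p$, and translation-invariant product functions. The regularizer $\mathcal R(T)$ is the sum of $L+H$; the two precisions (of the parameters and of the rounding); $\max_{l,h}\|K_{l,h}^TQ_{l,h}\|$; $\max_{l,h}\|V_{l,h}\|$; $\max_l\|A_l\|_F$; $\max_l\|B_l\|_F$; $\|U\|$; $\max_t\|p_t\|$; $\max_{\omega}\|E_\omega\|$; $\max_l\|b_l\|$; and the sum $\zeta(T)$ of the squares of all attention products of two positions, all attention products of two extended symbols, and all unembedding products of two extended symbols (over all $l,h,S_1,S_2$, resp. $S$), taken over the index pairs in which one of the two indices is the first one. For $f$ assigning to each input $x$ an element of $\mathbb R^{|x|\times\Omega}$, $T\in\Theta_n$ *matches* $f$ on $x$ if for all offsets that fit the context window its output, with extended symbols in input and output relabelled by $o_c$, equals $f(x)$. The *Inference Procedure* for $f$ picks for every $n\ge1$ some $T_n\in U_n$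 with $\mathcal R(T_n)\le \frac1n+\inf_{T\in U_n}\mathcal R(T)$, where $U_n$ is the set of $T\in\Theta_n$ matching $f$ on all inputs of length $\le n/2$ whose extended symbols span an index range $\le n/2$. *Length generalization is guaranteed* for $f$ if such sequences exist and every such sequence satisfies $\sup_n\mathcal R(T_n)<\infty$ and, for some $N_0$ and all $m>N_0$, $T_m$ matches $f$ on all inputs of length $\le m$. *For NoPE transformers* means the same with $\Theta_n$ restricted throughout to transformers with all $p_t=0$; *for APE transformers* means no such restriction. **Theorem.** For every C\*-RASP program $P$ with local relations $\Psi$ there is a Symbolic Limit Transformer $T_\infty$ such that for every nonempty word $w$ over $\Sigma\cup\mathcal C$, $P$ accepts $w$ iff $T_\infty$ accepts $\$w$. Furthermore, with $f(x)=T_\infty(x,0,0)$: 1. If $P$ uses no relation $\psi\in\Psi$ and all its match predicates have $\delta_k=\gamma_k=0$ (arbitrary $\tau_k$), then $T_\infty$ has no positional encodings (all $p_t=0$), and length generalization for $f$ is guaranteed for NoPE transformers. 2. Otherwise $T_\infty$ uses absolute positional encodings (not all $p_t$ are $0$), and length generalization for $f$ is guaranteed for APE transformers. -/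

import Mathlib

open scoped InnerProductSpace

/-! ## Words, symbols, inputs -/

/-- The vocabulary: a start symbol, the fixed alphabet `A`, and the extended alphabet
`c_0, c_1, c_2, ...` (indices start at `0`). -/
inductive Symb (A : Type*) where
  | start : Symb A
  | fin : A → Symb A
  | ext : ℕ → Symb A

/-- Words over the union of the fixed alphabet and the extended alphabet. -/
abbrev Word (A : Type*) := List (A ⊕ ℕ)

/-- The transformer input `$w`. Index `0` carries `$`; the `i`-th letter of `w`, counted from `1`,
sits at index `i`. -/
def inputOf {A : Type*} (w : Word A) : List (Symb A) :=
  Symb.start :: w.map (Sum.elim Symb.fin Symb.ext)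

/-- Shifting the extended symbols by a character offset. -/
def Symb.shift {A : Type*} (b : ℕ) : Symb A → Symb A
  | .start => .start
  | .fin σ => .fin σ
  | .ext k => .ext (k + b)

/-- The symbols available to a transformer of context width `N`. -/
def Symb.Valid {A : Type*} (N : ℕ∞) : Symb A → Prop
  | .start => True
  | .fin _ => True
  | .ext k => (k : ℕ∞) < N

/-! ## C*-RASP -/

/-- One conjunct `c_{j-δ} = c_{i-γ} + τ` of a match predicate. -/
structure MatchClause where
  δ : ℕ
  γ : ℕ
  τ : ℤ

/-- The conjunct holds if both positions exist, both carry extended symbols, and the values agree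
up to the shift. -/
def MatchClause.Holds {A : Type*} (m : MatchClause) (w : Word A) (i j : ℕ) : Prop :=
  m.δ ≤ j ∧ m.γ ≤ i ∧ ∃ a b : ℕ, (inputOf w)[j - m.δ]? = some (Symb.ext a) ∧
    (inputOf w)[i - m.γ]? = some (Symb.ext b) ∧ (a : ℤ) = (b : ℤ) + m.τ

/-- A Boolean-valued operation that may refer to `nb` earlier Boolean-valued and `nc` earlier
count-valued operations. -/
inductive BoolOp (A : Type*) (nb nc : ℕ) where
  | query : A → BoolOp A nb nc
  | neg : Fin nb → BoolOp A nb nc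
  | and : Fin nb → Fin nb → BoolOp A nb nc
  | top : BoolOp A nb nc
  | le : Fin nc → Fin nc → BoolOp A nb nc

/-- A count-valued operation that may refer to `nb` earlier Boolean-valued and `nc` earlier
count-valued operations. -/
inductive CountOp (Ψ : Set (ℕ → ℕ → Prop)) (nb nc : ℕ) where
  | count : Fin nb → CountOp Ψ nb nc
  | countRel (ψ : ℕ → ℕ → Prop) : ψ ∈ Ψ → Fin nb → CountOp Ψ nb nc
  | countMatch : List MatchClause → CountOp Ψ nb nc
  | cond : Fin nb → Fin nc → Fin nc → CountOp Ψ nb nc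
  | add : Fin nc → Fin nc → CountOp Ψ nb nc
  | sub : Fin nc → Fin nc → CountOp Ψ nb nc
  | one : CountOp Ψ nb nc

/-- Finite sequences of operations, with `nb` Boolean-valued and `nc` count-valued members. -/
inductive Ops (A : Type*) (Ψ : Set (ℕ → ℕ → Prop)) : ℕ → ℕ → Type _ where
  | nil : Ops A Ψ 0 0
  | snocBool {nb nc : ℕ} : Ops A Ψ nb nc → BoolOp A nb nc → Ops A Ψ (nb + 1) nc
  | snocCount {nb nc : ℕ} : Ops A Ψ nb nc → CountOp Ψ nb nc → Ops A Ψ nb (nc + 1)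

/-- A C*-RASP program over the fixed alphabet `A` and the binary relations `Ψ`: a sequence of
operations whose final operation is Boolean-valued. -/
structure Program (A : Type*) (Ψ : Set (ℕ → ℕ → Prop)) where
  nb : ℕ
  nc : ℕ
  ops : Ops A Ψ nb nc
  final : BoolOp A nb nc

/-- The truth value at position `i` of a Boolean-valued operation. Positions are counted
from `1`. -/
def BoolOp.eval {A : Type*} {nb nc : ℕ} (w : Word A) (β : Fin nb → ℕ → Prop)
    (κ : Fin nc → ℕ → ℤ) : BoolOp A nb nc → ℕ → Prop
  | .query σ, i => (inputOf w)[i]? = some (Symb.fin σ)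
  | .neg p, i => ¬ β p i
  | .and p q, i => β p i ∧ β q i
  | .top, _ => True
  | .le c d, i => κ c i ≤ κ d i

open Classical in
/-- The value at position `i` of a count-valued operation. -/
noncomputable def CountOp.eval {A : Type*} {Ψ : Set (ℕ → ℕ → Prop)} {nb nc : ℕ} (w : Word A)
    (β : Fin nb → ℕ → Prop) (κ : Fin nc → ℕ → ℤ) : CountOp Ψ nb nc → ℕ → ℤ
  | .count p, i => (((Finset.Icc 1 i).filter fun j => β p j).card : ℤ)
  | .countRel ψ _ p, i => (((Finset.Icc 1 i).filter fun j => ψ i j ∧ β p j).card : ℤ)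
  | .countMatch χ, i => (((Finset.Icc 1 i).filter fun j => ∀ m ∈ χ, m.Holds w i j).card : ℤ)
  | .cond p c d, i => if β p i then κ c i else κ d i
  | .add c d, i => κ c i + κ d i
  | .sub c d, i => κ c i - κ d i
  | .one, _ => 1

/-- The values of all operations of a sequence on the word `w`. -/
noncomputable def Ops.eval {A : Type*} {Ψ : Set (ℕ → ℕ → Prop)} (w : Word A) :
    {nb nc : ℕ} → Ops A Ψ nb nc → (Fin nb → ℕ → Prop) × (Fin nc → ℕ → ℤ)
  | _, _, .nil => (Fin.elim0, Fin.elim0)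
  | _, _, .snocBool s o =>
      (Fin.snoc (α := fun _ => ℕ → Prop) (s.eval w).1 (o.eval w (s.eval w).1 (s.eval w).2),
        (s.eval w).2)
  | _, _, .snocCount s o =>
      ((s.eval w).1,
        Fin.snoc (α := fun _ => ℕ → ℤ) (s.eval w).2 (o.eval w (s.eval w).1 (s.eval w).2))

/-- A program accepts `w` if its final operation is true at the last position of `w`. -/
def Program.Accepts {A : Type*} {Ψ : Set (ℕ → ℕ → Prop)} (P : Program A Ψ) (w : Word A) : Prop :=
  P.final.eval w (P.ops.eval w).1 (P.ops.eval w).2 w.length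

/-- The operation uses no positional relation, and no spatial offset in a match predicate. -/
def CountOp.PositionFree {Ψ : Set (ℕ → ℕ → Prop)} {nb nc : ℕ} : CountOp Ψ nb nc → Prop
  | .countRel _ _ _ => False
  | .countMatch χ => ∀ m ∈ χ, m.δ = 0 ∧ m.γ = 0
  | _ => True

def Ops.PositionFree {A : Type*} {Ψ : Set (ℕ → ℕ → Prop)} :
    {nb nc : ℕ} → Ops A Ψ nb nc → Prop
  | _, _, .nil => True
  | _, _, .snocBool s _ => s.PositionFree
  | _, _, .snocCount s o => s.PositionFree ∧ o.PositionFree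

/-- The program uses no positional relation and no spatial offset in its match predicates. -/
def Program.PositionFree {A : Type*} {Ψ : Set (ℕ → ℕ → Prop)} (P : Program A Ψ) : Prop :=
  P.ops.PositionFree

/-- A local positional relation `ψ(i,j)`, `1 ≤ j ≤ i`: it is translation-invariant and vanishes
when `j` is too far before `i`. -/
def IsLocalRel (ψ : ℕ → ℕ → Prop) : Prop :=
  (∀ i j t : ℕ, 1 ≤ j → j ≤ i → (ψ (i + t) (j + t) ↔ ψ i j)) ∧
    ∃ r : ℕ, ∀ i j : ℕ, 1 ≤ j → j + r < i → ¬ ψ i j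

/-! ## Transformers -/

/-- The activation functions allowed, coordinate by coordinate, in the MLPs. -/
inductive Activation where
  | relu : Activation
  | heaviside : Activation
  | recip : Activation

/-- `ε` is the small constant that keeps the reciprocal away from division by zero. -/
noncomputable def Activation.eval (ε : ℝ) : Activation → ℝ → ℝ
  | .relu, x => max x 0
  | .heaviside, x => if 0 ≤ x then 1 else 0
  | .recip, x => 1 / (x + ε)

/-- Rounding to `q` fractional bits. -/
noncomputable def roundBits (q : ℕ) (x : ℝ) : ℝ := (round (x * 2 ^ q) : ℝ) / 2 ^ q

/-- `x` is representable with `p` fractional bits. -/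
def IsDyadic (p : ℕ) (x : ℝ) : Prop := ∃ z : ℤ, x = (z : ℝ) / 2 ^ p

/-- The parameters of a transformer with residual space `H`. Positional encodings `pos t` and
extended embeddings `E (ext k)` are indexed from `0`; for a transformer with finite context width
`N`, only the indices below `N` play a role. The rows of the MLP input matrices are `Ain l s`, the
columns of the MLP output matrices are `Bout l s`, and the rows of the unembedding matrix are `U ω`. -/
structure Transformer (A : Type*) (H : Type*) [NormedAddCommGroup H] [InnerProductSpace ℝ H] where
  /-- number of layers -/
  depth : ℕ
  /-- number of heads per layer -/
  heads : ℕ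
  /-- number of hidden units of each MLP -/
  dff : ℕ
  /-- fractional bits kept when rounding attention logits and outputs of `exp` -/
  roundPrec : ℕ
  pos : ℕ → H
  E : Symb A → H
  K : Fin depth → Fin heads → H →L[ℝ] H
  Q : Fin depth → Fin heads → H →L[ℝ] H
  V : Fin depth → Fin heads → H →L[ℝ] H
  Ain : Fin depth → Fin dff → H
  b : Fin depth → Fin dff → ℝ
  Bout : Fin depth → Fin dff → H
  act : Fin depth → Fin dff → Activation
  U : Symb A → H

namespace Transformer

variable {A : Type*} {H : Type*} [NormedAddCommGroup H] [InnerProductSpace ℝ H]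

/-! ### Computation -/

/-- Initial state at index `i` with positional offset `op` and character offset `oc`. -/
def initState (T : Transformer A H) (x : List (Symb A)) (op oc : ℕ) (i : ℕ) : H :=
  T.E ((x.getD i Symb.start).shift oc) + T.pos (i + op)

/-- Unnormalised attention weight of key index `j` for query index `i`, on an input of length `len`
with activations `y`. -/
noncomputable def attnWeight (T : Transformer A H) (len : ℕ) (l : Fin T.depth) (h : Fin T.heads)
    (y : ℕ → H) (i j : ℕ) : ℝ :=
  roundBits T.roundPrec
    (Real.exp (Real.log len * roundBits T.roundPrec ⟪T.K l h (y j), T.Q l h (y i)⟫_ℝ))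

/-- Attention block with residual connection. A head all of whose weights round to zero contributes
nothing. -/
noncomputable def attnBlock (T : Transformer A H) (len : ℕ) (l : Fin T.depth) (y : ℕ → H) (i : ℕ) :
    H :=
  y i + ∑ h : Fin T.heads,
    (∑ j ∈ Finset.range (i + 1), T.attnWeight len l h y i j)⁻¹ •
      ∑ j ∈ Finset.range (i + 1), T.attnWeight len l h y i j • T.V l h (y j)

/-- One-layer MLP with residual connection. -/
noncomputable def mlpBlock (T : Transformer A H) (ε : ℝ) (l : Fin T.depth) (v : H) : H :=
  v + ∑ s : Fin T.dff, (T.act l s).eval ε (⟪T.Ain l s, v⟫_ℝ + T.b l s) • T.Bout l s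

/-- The activations after the first `l` layers. -/
noncomputable def state (T : Transformer A H) (ε : ℝ) (x : List (Symb A)) (op oc : ℕ) :
    ℕ → ℕ → H
  | 0 => T.initState x op oc
  | l + 1 =>
      if hl : l < T.depth then
        fun i => T.mlpBlock ε ⟨l, hl⟩
          (T.attnBlock x.length ⟨l, hl⟩ (T.state ε x op oc l) i)
      else T.state ε x op oc l

/-- The output `T(x, op, oc)`: the logit of the symbol `ω` at index `i`. -/
noncomputable def output (T : Transformer A H) (ε : ℝ) (x : List (Symb A)) (op oc : ℕ) (i : ℕ)
    (ω : Symb A) : ℝ :=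
  ⟪T.U ω, T.state ε x op oc T.depth i⟫_ℝ

/-- The function computed by `T` on the inputs `$w` at zero offsets. -/
noncomputable def fn (T : Transformer A H) (ε : ℝ) (w : Word A) (i : ℕ) (ω : Symb A) : ℝ :=
  T.output ε (inputOf w) 0 0 i ω

/-- `T` accepts `$w` if the output entry of the distinguished coordinate `$` of the vocabulary is
positive at the last position. -/
def Accepts (T : Transformer A H) (ε : ℝ) (w : Word A) : Prop :=
  0 < T.fn ε w w.length Symb.start

/-! ### Product functions -/

/-- Names of the vectors that are written into the residual stream. -/
inductive Source (A : Type*) (L F : ℕ) where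
  | pos : ℕ → Source A L F
  | sym : Symb A → Source A L F
  | mlp : Fin L → Fin F → Source A L F

/-- Simultaneous shift of all positions by `a` and of all extended symbols by `b`. -/
def Source.shift {A : Type*} {L F : ℕ} (a b : ℕ) : Source A L F → Source A L F
  | .pos t => .pos (t + a)
  | .sym ω => .sym (ω.shift b)
  | .mlp l s => .mlp l s

/-- The vectors available at context width `N`. -/
def Source.Valid {A : Type*} {L F : ℕ} (N : ℕ∞) : Source A L F → Prop
  | .pos t => (t : ℕ∞) < N
  | .sym ω => ω.Valid N
  | .mlp _ _ => True

def source (T : Transformer A H) : Source A T.depth T.dff → H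
  | .pos t => T.pos t
  | .sym ω => T.E ω
  | .mlp l s => T.Bout l s

/-- A choice of at most one value matrix per layer. -/
abbrev Path (T : Transformer A H) := Fin T.depth → Option (Fin T.heads)

/-- Product of the chosen value matrices among the first `l` layers, lowest layer rightmost. -/
noncomputable def pathProdTo (T : Transformer A H) (S : T.Path) : ℕ → H →L[ℝ] H
  | 0 => ContinuousLinearMap.id ℝ H
  | l + 1 =>
      if hl : l < T.depth then
        match S ⟨l, hl⟩ with
        | none => T.pathProdTo S l
        | some h => (T.V ⟨l, hl⟩ h).comp (T.pathProdTo S l)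
      else T.pathProdTo S l

noncomputable def pathProd (T : Transformer A H) (S : T.Path) : H →L[ℝ] H :=
  T.pathProdTo S T.depth

/-- `vᵀ (∏ S₁)ᵀ Kᵀ Q (∏ S₂) w`. -/
noncomputable def prodAttn (T : Transformer A H) (l : Fin T.depth) (h : Fin T.heads)
    (S₁ S₂ : T.Path) (v w : Source A T.depth T.dff) : ℝ :=
  ⟪T.K l h (T.pathProd S₁ (T.source v)), T.Q l h (T.pathProd S₂ (T.source w))⟫_ℝ

/-- `U_ωᵀ (∏ S) w`, for `w` an embedding, a positional encoding or a column of an MLP output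
matrix. -/
noncomputable def prodUnembed (T : Transformer A H) (S : T.Path) (ω : Symb A)
    (w : Source A T.depth T.dff) : ℝ :=
  ⟪T.U ω, T.pathProd S (T.source w)⟫_ℝ

/-- `(A_l)_sᵀ (∏ S) w`. -/
noncomputable def prodMlp (T : Transformer A H) (S : T.Path) (l : Fin T.depth) (s : Fin T.dff)
    (w : Source A T.depth T.dff) : ℝ :=
  ⟪T.Ain l s, T.pathProd S (T.source w)⟫_ℝ

/-- Translation invariance of the product functions. Positions and extended symbols are shifted
independently of each other: so a product of two vectors of the same type depends only on the
difference of the indices, while a product of vectors of different types, or with just one position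
or one extended symbol, is constant. -/
def TranslationInvariant (T : Transformer A H) (N : ℕ∞) : Prop :=
  (∀ l h S₁ S₂ a b v w, v.Valid N → w.Valid N → (v.shift a b).Valid N → (w.shift a b).Valid N →
    T.prodAttn l h S₁ S₂ (v.shift a b) (w.shift a b) = T.prodAttn l h S₁ S₂ v w) ∧
  (∀ S a b ω w, ω.Valid N → w.Valid N → (ω.shift b).Valid N → (w.shift a b).Valid N →
    T.prodUnembed S (ω.shift b) (w.shift a b) = T.prodUnembed S ω w) ∧
  (∀ S l s a b w, w.Valid N → (w.shift a b).Valid N →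
    T.prodMlp S l s (w.shift a b) = T.prodMlp S l s w)

/-- Products of two positions, or of two extended symbols, vanish at index distance more
than `Δ`. -/
def IsLocal (T : Transformer A H) (Δ : ℕ) : Prop :=
  ∀ k m : ℕ, (k + Δ < m ∨ m + Δ < k) →
    (∀ l h S₁ S₂, T.prodAttn l h S₁ S₂ (.pos k) (.pos m) = 0 ∧
      T.prodAttn l h S₁ S₂ (.sym (.ext k)) (.sym (.ext m)) = 0) ∧
    ∀ S, T.prodUnembed S (.ext k) (.sym (.ext m)) = 0

/-- `C` bounds the spectral norm of the unembedding matrix restricted to the symbols available at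
context width `N`. -/
def UnembedBound (T : Transformer A H) (N : ℕ∞) (C : ℝ) : Prop :=
  0 ≤ C ∧ ∀ (v : H) (s : Finset (Symb A)), (∀ ω ∈ s, ω.Valid N) →
    ∑ ω ∈ s, ⟪T.U ω, v⟫_ℝ ^ 2 ≤ (C * ‖v‖) ^ 2

/-- Symbolic limit transformers: infinite context width, bounded embeddings, bounded operators
(for `K`, `Q`, `V` and the finite-rank MLP maps this is part of their type), product functions in
`p`-bit precision for a fixed `p`, translation invariant and local. -/
structure IsSymbolicLimit (T : Transformer A H) : Prop where
  bounded : ∃ C : ℝ, (∀ t, ‖T.pos t‖ ≤ C) ∧ ∀ k, ‖T.E (.ext k)‖ ≤ C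
  unembed_bounded : ∃ C : ℝ, T.UnembedBound ⊤ C
  precision : ∃ p : ℕ, (∀ l h S₁ S₂ v w, IsDyadic p (T.prodAttn l h S₁ S₂ v w)) ∧
    (∀ S ω w, IsDyadic p (T.prodUnembed S ω w)) ∧ ∀ S l s w, IsDyadic p (T.prodMlp S l s w)
  invariant : T.TranslationInvariant ⊤
  isLocal : ∃ Δ : ℕ, T.IsLocal Δ

end Transformer

/-! ## Learning model -/

/-- The hypothesis class at context width `n`: transformers of some finite width `d`, with
parameters of `p` fractional bits and translation-invariant product functions. -/
structure Hypothesis (A : Type*) (n : ℕ) where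
  d : ℕ
  p : ℕ
  T : Transformer A (EuclideanSpace ℝ (Fin d))
  pos_prec : ∀ t < n, ∀ c, IsDyadic p (T.pos t c)
  E_prec : ∀ ω : Symb A, ω.Valid n → ∀ c, IsDyadic p (T.E ω c)
  K_prec : ∀ l h c c', IsDyadic p (T.K l h (EuclideanSpace.single c 1) c')
  Q_prec : ∀ l h c c', IsDyadic p (T.Q l h (EuclideanSpace.single c 1) c')
  V_prec : ∀ l h c c', IsDyadic p (T.V l h (EuclideanSpace.single c 1) c')
  A_prec : ∀ l s c, IsDyadic p (T.Ain l s c)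
  b_prec : ∀ l s, IsDyadic p (T.b l s)
  B_prec : ∀ l s c, IsDyadic p (T.Bout l s c)
  U_prec : ∀ ω : Symb A, ω.Valid n → ∀ c, IsDyadic p (T.U ω c)
  invariant : T.TranslationInvariant n

namespace Hypothesis

variable {A : Type*} {n : ℕ}

/-- The penalty on pairwise products of positions and of extended symbols, one of the two indices
being the first one. -/
noncomputable def zeta (M : Hypothesis A n) : ℝ :=
  (∑ l : Fin M.T.depth, ∑ h : Fin M.T.heads, ∑ S₁ : M.T.Path, ∑ S₂ : M.T.Path,
    ((∑ k ∈ Finset.range n, M.T.prodAttn l h S₁ S₂ (.pos 0) (.pos k) ^ 2) +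
      (∑ k ∈ Finset.Ico 1 n, M.T.prodAttn l h S₁ S₂ (.pos k) (.pos 0) ^ 2) +
      (∑ k ∈ Finset.range n,
        M.T.prodAttn l h S₁ S₂ (.sym (.ext 0)) (.sym (.ext k)) ^ 2) +
      ∑ k ∈ Finset.Ico 1 n,
        M.T.prodAttn l h S₁ S₂ (.sym (.ext k)) (.sym (.ext 0)) ^ 2)) +
  ∑ S : M.T.Path,
    ((∑ k ∈ Finset.range n, M.T.prodUnembed S (.ext 0) (.sym (.ext k)) ^ 2) +
      ∑ k ∈ Finset.Ico 1 n, M.T.prodUnembed S (.ext k) (.sym (.ext 0)) ^ 2)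

/-- The regularizer. All suprema are maxima over finite sets when `A` is finite (and `0` over the
empty set). -/
noncomputable def reg (M : Hypothesis A n) : ℝ :=
  (M.T.depth + M.T.heads) + (M.p + M.T.roundPrec) +
  (⨆ lh : Fin M.T.depth × Fin M.T.heads,
    ‖(ContinuousLinearMap.adjoint (M.T.K lh.1 lh.2)).comp (M.T.Q lh.1 lh.2)‖) +
  (⨆ lh : Fin M.T.depth × Fin M.T.heads, ‖M.T.V lh.1 lh.2‖) +
  (⨆ l : Fin M.T.depth, √(∑ s, ‖M.T.Ain l s‖ ^ 2)) +
  (⨆ l : Fin M.T.depth, √(∑ s, ‖M.T.Bout l s‖ ^ 2)) +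
  sInf {C : ℝ | M.T.UnembedBound n C} +
  (⨆ t : Fin n, ‖M.T.pos t‖) +
  (⨆ ω : {ω : Symb A // ω.Valid n}, ‖M.T.E ω.1‖) +
  (⨆ l : Fin M.T.depth, √(∑ s, M.T.b l s ^ 2)) +
  M.zeta

/-- The hypothesis agrees with `f` on the input `$w`, for all offsets under which the input fits
into the context window. Under a character offset `oc`, the extended symbol `c_k` is represented by
`c_{k+oc}`, in the input and in the output. -/
def MatchesAt (M : Hypothesis A n) (ε : ℝ) (f : Word A → ℕ → Symb A → ℝ) (w : Word A) : Prop :=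
  ∀ op oc : ℕ, w.length + 1 + op ≤ n → (∀ k, Sum.inr k ∈ w → k + oc < n) →
    ∀ i ≤ w.length, ∀ ω : Symb A, (ω.shift oc).Valid n →
      M.T.output ε (inputOf w) op oc i (ω.shift oc) = f w i ω

/-- The hypothesis agrees with `f` on all inputs of length at most `n / 2` whose extended symbols
lie in a range of size at most `n / 2`. -/
def Fits (M : Hypothesis A n) (ε : ℝ) (f : Word A → ℕ → Symb A → ℝ) : Prop :=
  ∀ w : Word A, 2 * (w.length + 1) ≤ n →
    (∀ k m, Sum.inr k ∈ w → Sum.inr m ∈ w → 2 * k ≤ 2 * m + n) → M.MatchesAt ε f w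

/-- All positional encodings vanish. -/
def NoPE (M : Hypothesis A n) : Prop := ∀ t < n, M.T.pos t = 0

end Hypothesis

/-- `M 1, M 2, ...` is produced by the inference procedure for `f`, among the hypotheses that
satisfy `C` (such as having no positional encodings). -/
def IsInferred {A : Type*} (ε : ℝ) (C : ∀ n, Hypothesis A n → Prop)
    (f : Word A → ℕ → Symb A → ℝ) (M : ∀ n, Hypothesis A n) : Prop :=
  ∀ n : ℕ, 1 ≤ n → C n (M n) ∧ (M n).Fits ε f ∧
    (M n).reg ≤ 1 / (n : ℝ) + sInf {r | ∃ M' : Hypothesis A n, C n M' ∧ M'.Fits ε f ∧ r = M'.reg}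

/-- Guaranteed length generalization: the inference procedure can be carried out, and every sequence
that it produces has bounded regularizer and, from some context width on, agrees with `f` on all
inputs that fit into the context window. -/
def LengthGeneralizes {A : Type*} (ε : ℝ) (C : ∀ n, Hypothesis A n → Prop)
    (f : Word A → ℕ → Symb A → ℝ) : Prop :=
  (∃ M, IsInferred ε C f M) ∧
  ∀ M : ∀ n, Hypothesis A n, IsInferred ε C f M →
    (∃ R : ℝ, ∀ n : ℕ, 1 ≤ n → (M n).reg ≤ R) ∧
    ∃ N₀ : ℕ, ∀ m > N₀, ∀ w : Word A, w.length + 1 ≤ m → (M m).MatchesAt ε f w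

/-! The proof joins a compactness argument about the learning model with a compiler from programs to
limit transformers.

Length generalization (`lengthGeneralizes_of_bounded`) needs only one input: fitting hypotheses
whose regularizer is bounded independently of the context width n. Let I(n) be the infimum of the
regularizer. Restricting a hypothesis to a smaller width keeps it fitting and removes the tail of
the penalty (`reg_restrict_add_le`), so I is monotone and bounded, hence nearly constant from some Δ
on. A near-optimal hypothesis of width n ≥ Δ can therefore spend very little penalty on index
differences of at least Δ. Product functions have bounded precision, so a nonzero one has a square
bounded away from zero; a small penalty forces it to vanish (`RegBound.isLocalBelow`), and the
inferred transformers are local with a common Δ.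

The outputs of a transformer depend on its vectors and operators only through the product functions
(`output_eq_output_refill`). By translation invariance and locality these reduce to boundedly many
numbers from a finite set, once hidden units that write nothing are dropped (`exists_reindexUnits`).
So there are finitely many profiles, and beyond some width every profile that occurs recurs at
arbitrarily large widths (`exists_recurrent`). There a given input is short enough to be fitted, and
equality of profiles carries the correct value back.

The bounded hypotheses come from the limit transformer itself (`exists_hypothesis`). Its parameters
are integral in an orthonormal family, so it can be compressed to the finitely many coordinates
reached from sources of index below n. This changes no product function and increases no norm, and
locality bounds the penalty uniformly in n.

The compiler (`exists_compile`) uses an ℓ² space with coordinates for scalar slots, positions, and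
registers holding extended symbols. Value operators only relabel coordinates and logit forms depend
only on index differences, which gives translation invariance. With L the input length, a count κ is
stored as κ / L ^ k up to an error of order L ^ 2 / L ^ (2k): a head gives the start symbol weight L
^ k, each counted position weight 1, and all others weight 0. The zeros are exact because weights
with logit at most -2 are rounded away. As counts are integers, comparisons survive the errors once
k is large; error constants do not depend on k, so k is chosen last. -/

namespace Transformer

/-! ### Outputs are determined by the product functions -/

variable {A : Type*} {H : Type*} [NormedAddCommGroup H] [InnerProductSpace ℝ H]
variable {H' : Type*} [NormedAddCommGroup H'] [InnerProductSpace ℝ H']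

/-- The transformer with the same architecture, biases and activations as `T`, and with other
vectors and operators, possibly in another residual space. -/
abbrev refill (T : Transformer A H) (pos' : ℕ → H') (E' : Symb A → H')
    (K' Q' V' : Fin T.depth → Fin T.heads → H' →L[ℝ] H') (Ain' Bout' : Fin T.depth → Fin T.dff → H')
    (U' : Symb A → H') : Transformer A H' where
  depth := T.depth
  heads := T.heads
  dff := T.dff
  roundPrec := T.roundPrec
  pos := pos'
  E := E'
  K := K'
  Q := Q'
  V := V'
  Ain := Ain'
  b := T.b
  Bout := Bout'
  act := T.act
  U := U'

theorem pathProdTo_congr (T : Transformer A H) {S S' : T.Path} {l : ℕ}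
    (h : ∀ k : Fin T.depth, (k : ℕ) < l → S k = S' k) : T.pathProdTo S l = T.pathProdTo S' l := by
  induction l with
  | zero => rfl
  | succ l ih =>
    have ih := ih fun k hk => h k (by omega)
    by_cases hl : l < T.depth
    · simp only [pathProdTo, hl, dif_pos, ih, h ⟨l, hl⟩ (Nat.lt_succ_self l)]
    · simp only [pathProdTo, hl, dif_neg, not_false_eq_true, ih]

theorem pathProdTo_succ_none (T : Transformer A H) (S : T.Path) (l : ℕ)
    (h : ∀ hl : l < T.depth, S ⟨l, hl⟩ = none) : T.pathProdTo S (l + 1) = T.pathProdTo S l := by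
  by_cases hl : l < T.depth
  · simp only [pathProdTo, hl, dif_pos, h hl]
  · simp only [pathProdTo, hl, dif_neg, not_false_eq_true]

theorem pathProdTo_succ_some (T : Transformer A H) (S : T.Path) {l : ℕ} (hl : l < T.depth)
    {h : Fin T.heads} (hS : S ⟨l, hl⟩ = some h) :
    T.pathProdTo S (l + 1) = (T.V ⟨l, hl⟩ h).comp (T.pathProdTo S l) := by
  simp only [pathProdTo, hl, dif_pos, hS]

theorem pathProdTo_of_le (T : Transformer A H) (S : T.Path) {l m : ℕ} (hlm : l ≤ m)
    (h : ∀ k : Fin T.depth, l ≤ (k : ℕ) → S k = none) :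
    T.pathProdTo S m = T.pathProdTo S l := by
  induction m, hlm using Nat.le_induction with
  | base => rfl
  | succ m hm ih => rw [pathProdTo_succ_none T S m fun hl => h _ hm, ih]

/-- The path that agrees with `S` below layer `l` and skips all later layers. -/
def cutPath {L h : ℕ} (S : Fin L → Option (Fin h)) (l : ℕ) : Fin L → Option (Fin h) :=
  fun k => if (k : ℕ) < l then S k else none

/-- Product functions are defined with full paths. Since a partial product is the full product of a
truncated path, they also control every intermediate layer. -/
theorem pathProd_cutPath (T : Transformer A H) (S : T.Path) {l : ℕ} (hl : l ≤ T.depth) :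
    T.pathProd (cutPath S l) = T.pathProdTo S l := by
  rw [pathProd, pathProdTo_of_le T (cutPath S l) hl fun k hk => if_neg (by omega)]
  exact pathProdTo_congr T fun k hk => if_pos hk

theorem pathProdTo_cutPath_succ (T : Transformer A H) (S : T.Path) (l : ℕ) :
    T.pathProdTo (cutPath S l) (l + 1) = T.pathProdTo S l := by
  rw [pathProdTo_succ_none T _ l fun hl => if_neg (by simp)]
  exact pathProdTo_congr T fun k hk => if_pos hk

theorem pathProdTo_update (T : Transformer A H) (S : T.Path) {l : ℕ} (hl : l < T.depth)
    (h : Fin T.heads) :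
    T.pathProdTo (Function.update S ⟨l, hl⟩ (some h)) (l + 1) =
      (T.V ⟨l, hl⟩ h).comp (T.pathProdTo S l) := by
  rw [pathProdTo_succ_some T _ hl (Function.update_self ..)]
  congr 1
  exact pathProdTo_congr T fun k hk => Function.update_of_ne (fun e => by simp [e] at hk) ..

section Compare

variable (T : Transformer A H) {pos' : ℕ → H'} {E' : Symb A → H'}
    {K' Q' V' : Fin T.depth → Fin T.heads → H' →L[ℝ] H'} {Ain' Bout' : Fin T.depth → Fin T.dff → H'}
    {U' : Symb A → H'}

/-- Pairs of vectors that are the same combination of path images of corresponding sources. -/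
def matchedPairs {T : Transformer A H} {T' : Transformer A H'}
    (p : T.Path → T'.Path) (src : Set (H × H')) (l : ℕ) : Submodule ℝ (H × H') :=
  Submodule.span ℝ {x | ∃ S, ∃ v ∈ src, x = (T.pathProdTo S l v.1, T'.pathProdTo (p S) l v.2)}

/-- Each pair of corresponding states lies in the span of pairs of path images of corresponding
sources. Logits, MLP preactivations and outputs are bilinear or linear in the states, so it suffices
that they agree on these generators. Attention weights and activations then agree, so the next pair
of states is again a combination with common coefficients. The set `I` holds the sources that the
input can involve; the offsets are applied on one side only. -/
theorem output_eq_output_refill (ε : ℝ) (x : List (Symb A)) (op oc : ℕ)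
    (I : Set (Source A T.depth T.dff))
    (hpos : ∀ i < x.length, Source.pos i ∈ I)
    (hsym : ∀ i < x.length, Source.sym (x.getD i Symb.start) ∈ I)
    (hmlp : ∀ l s, Source.mlp l s ∈ I)
    (hA : ∀ l h S₁ S₂, ∀ v ∈ I, ∀ w ∈ I, T.prodAttn l h S₁ S₂ (v.shift op oc) (w.shift op oc) =
      (T.refill pos' E' K' Q' V' Ain' Bout' U').prodAttn l h S₁ S₂ v w)
    (hM : ∀ S l s, ∀ w ∈ I, T.prodMlp S l s (w.shift op oc) =
      (T.refill pos' E' K' Q' V' Ain' Bout' U').prodMlp S l s w)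
    (ω : Symb A)
    (hU : ∀ S, ∀ w ∈ I, T.prodUnembed S (ω.shift oc) (w.shift op oc) =
      (T.refill pos' E' K' Q' V' Ain' Bout' U').prodUnembed S ω w)
    (i : ℕ) (hi : i < x.length) :
    T.output ε x op oc i (ω.shift oc) =
      (T.refill pos' E' K' Q' V' Ain' Bout' U').output ε x 0 0 i ω := by
  set T' := T.refill pos' E' K' Q' V' Ain' Bout' U' with hT'
  set src : Set (H × H') := {v | ∃ u ∈ I, v = (T.source (u.shift op oc), T'.source u)} with hsrc
  set R : ℕ → Submodule ℝ (H × H') := matchedPairs (T := T) (T' := T') id src with hR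
  have gen : ∀ S l, ∀ u ∈ I,
      (T.pathProdTo S l (T.source (u.shift op oc)), T'.pathProdTo S l (T'.source u)) ∈ R l :=
    fun S l u hu => Submodule.subset_span ⟨S, _, ⟨u, hu, rfl⟩, rfl⟩
  -- The residual connection: a path that skips layer l.
  have keep : ∀ l, R l ≤ R (l + 1) := by
    intro l
    refine Submodule.span_le.2 ?_
    rintro _ ⟨S, _, ⟨u, hu, rfl⟩, rfl⟩
    have := gen (cutPath S l) (l + 1) u hu
    rw [pathProdTo_cutPath_succ] at this
    have h2 := pathProdTo_cutPath_succ T' S l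
    rw [h2] at this
    exact this
  -- An attention head: a path that picks h at layer l. Truncation or alteration at higher layers
  -- does not matter for the partial product.
  have move : ∀ l (hl : l < T.depth) h, ∀ y ∈ R l,
      (T.V ⟨l, hl⟩ h y.1, T'.V ⟨l, hl⟩ h y.2) ∈ R (l + 1) := by
    intro l hl h y hy
    have : R l ≤ (R (l + 1)).comap
        (((T.V ⟨l, hl⟩ h).toLinearMap).prodMap (T'.V ⟨l, hl⟩ h).toLinearMap) := by
      refine Submodule.span_le.2 ?_
      rintro _ ⟨S, _, ⟨u, hu, rfl⟩, rfl⟩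
      have := gen (Function.update S ⟨l, hl⟩ (some h)) (l + 1) u hu
      rw [pathProdTo_update] at this
      have h2 := pathProdTo_update T' S hl h
      rw [h2] at this
      exact this
    exact this hy
  -- The path that skips every layer makes each MLP column available at every depth.
  have out : ∀ l ≤ T.depth, ∀ k s, (T.Bout k s, T'.Bout k s) ∈ R l := by
    intro l _ k s
    have := gen (fun _ => none) l _ (hmlp k s)
    have h1 := pathProdTo_of_le T (fun _ => none) (Nat.zero_le l) fun _ _ => rfl
    have h2 := pathProdTo_of_le T' (fun _ => none) (Nat.zero_le l) fun _ _ => rfl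
    rw [h1, h2] at this
    exact this
  have attn : ∀ l (hl : l < T.depth) h, ∀ y ∈ R l, ∀ z ∈ R l,
      ⟪T.K ⟨l, hl⟩ h y.1, T.Q ⟨l, hl⟩ h z.1⟫_ℝ = ⟪T'.K ⟨l, hl⟩ h y.2, T'.Q ⟨l, hl⟩ h z.2⟫_ℝ := by
    intro l hl h y hy z hz
    refine Submodule.span_induction₂ (p := fun y z _ _ =>
      ⟪T.K ⟨l, hl⟩ h y.1, T.Q ⟨l, hl⟩ h z.1⟫_ℝ = ⟪T'.K ⟨l, hl⟩ h y.2, T'.Q ⟨l, hl⟩ h z.2⟫_ℝ)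
      ?_ ?_ ?_ ?_ ?_ ?_ ?_ hy hz
    · rintro _ _ ⟨S₁, _, ⟨v, hv, rfl⟩, rfl⟩ ⟨S₂, _, ⟨w, hw, rfl⟩, rfl⟩
      have := hA ⟨l, hl⟩ h (cutPath S₁ l) (cutPath S₂ l) v hv w hw
      simp only [prodAttn] at this
      rw [pathProd_cutPath T _ hl.le, pathProd_cutPath T _ hl.le] at this
      have h1 := pathProd_cutPath T' S₁ (l := l) hl.le
      have h2 := pathProd_cutPath T' S₂ (l := l) hl.le
      rw [h1, h2] at this
      exact this
    all_goals simp +contextual [inner_add_left, inner_add_right, inner_smul_left, inner_smul_right]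
  have mlp : ∀ l (hl : l < T.depth) s, ∀ y ∈ R (l + 1),
      ⟪T.Ain ⟨l, hl⟩ s, y.1⟫_ℝ = ⟪T'.Ain ⟨l, hl⟩ s, y.2⟫_ℝ := by
    intro l hl s y hy
    refine Submodule.span_induction (p := fun y _ =>
      ⟪T.Ain ⟨l, hl⟩ s, y.1⟫_ℝ = ⟪T'.Ain ⟨l, hl⟩ s, y.2⟫_ℝ) ?_ ?_ ?_ ?_ hy
    · rintro _ ⟨S, _, ⟨w, hw, rfl⟩, rfl⟩
      have := hM (cutPath S (l + 1)) ⟨l, hl⟩ s w hw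
      simp only [prodMlp] at this
      rw [pathProd_cutPath T _ hl] at this
      have h1 := pathProd_cutPath T' S (l := l + 1) hl
      rw [h1] at this
      exact this
    all_goals simp +contextual [inner_add_right, inner_smul_right]
  have main : ∀ l ≤ T.depth, ∀ i < x.length,
      (T.state ε x op oc l i, T'.state ε x 0 0 l i) ∈ R l := by
    intro l
    induction l with
    | zero =>
      intro _ i hi
      have h1 := gen (fun _ => none) 0 _ (hpos i hi)
      have h2 := gen (fun _ => none) 0 _ (hsym i hi)
      have h3 := (R 0).add_mem h2 h1
      have h4 : (x.getD i Symb.start).shift 0 = x.getD i Symb.start := by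
        cases x.getD i Symb.start <;> rfl
      simp only [state, initState, h4]
      exact h3
    | succ l ih =>
      intro hl' i hi
      have hl : l < T.depth := hl'
      have ih := ih hl.le
      have wt : ∀ h, ∀ i < x.length, ∀ j < x.length,
          T.attnWeight x.length ⟨l, hl⟩ h (T.state ε x op oc l) i j =
          T'.attnWeight x.length ⟨l, hl⟩ h (T'.state ε x 0 0 l) i j := by
        intro h i hi j hj
        have := attn l hl h _ (ih j hj) _ (ih i hi)
        simp only at this
        simp only [attnWeight, this]
        rfl
      have blk : (T.attnBlock x.length ⟨l, hl⟩ (T.state ε x op oc l) i,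
          T'.attnBlock x.length ⟨l, hl⟩ (T'.state ε x 0 0 l) i) ∈ R (l + 1) := by
        have h1 := keep l (ih i hi)
        have h2 : ∑ h : Fin T.heads,
            (∑ j ∈ Finset.range (i + 1),
              T.attnWeight x.length ⟨l, hl⟩ h (T.state ε x op oc l) i j)⁻¹ •
            ∑ j ∈ Finset.range (i + 1),
              T.attnWeight x.length ⟨l, hl⟩ h (T.state ε x op oc l) i j •
              ((T.V ⟨l, hl⟩ h (T.state ε x op oc l j), T'.V ⟨l, hl⟩ h (T'.state ε x 0 0 l j)) :
                H × H') ∈ R (l + 1) := by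
          refine Submodule.sum_mem _ fun h _ => Submodule.smul_mem _ _ <|
            Submodule.sum_mem _ fun j hj => Submodule.smul_mem _ _ ?_
          exact move l hl h _ (ih j (by rw [Finset.mem_range] at hj; omega))
        have h3 := (R (l + 1)).add_mem h1 h2
        convert h3 using 1
        refine Prod.ext ?_ ?_
        · simp [attnBlock, Prod.fst_sum]
        · simp only [attnBlock, Prod.snd_add, Prod.snd_sum, Prod.smul_snd]
          congr 1
          refine Finset.sum_congr rfl fun h _ => ?_
          have hw : ∀ j ∈ Finset.range (i + 1),
              T'.attnWeight x.length ⟨l, hl⟩ h (T'.state ε x 0 0 l) i j =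
              T.attnWeight x.length ⟨l, hl⟩ h (T.state ε x op oc l) i j := fun j hj =>
            (wt h i hi j (by rw [Finset.mem_range] at hj; omega)).symm
          rw [Finset.sum_congr rfl hw]
          congr 1
          exact Finset.sum_congr rfl fun j hj => by rw [hw j hj]
      have h1 : ∑ s : Fin T.dff,
          ((T.act ⟨l, hl⟩ s).eval ε (⟪T.Ain ⟨l, hl⟩ s,
            T.attnBlock x.length ⟨l, hl⟩ (T.state ε x op oc l) i⟫_ℝ + T.b ⟨l, hl⟩ s)) •
          ((T.Bout ⟨l, hl⟩ s, T'.Bout ⟨l, hl⟩ s) : H × H') ∈ R (l + 1) :=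
        Submodule.sum_mem _ fun s _ => Submodule.smul_mem _ _ (out (l + 1) hl _ s)
      have h2 := (R (l + 1)).add_mem blk h1
      have hl2 : l < T'.depth := hl
      simp only [state, hl, hl2, dif_pos]
      convert h2 using 1
      refine Prod.ext ?_ ?_
      · simp [mlpBlock, Prod.fst_sum]
      · simp only [mlpBlock, Prod.snd_add, Prod.snd_sum, Prod.smul_snd]
        congr 1
        refine Finset.sum_congr rfl fun s _ => ?_
        have := mlp l hl s _ blk
        simp only at this
        rw [this]
  have fin := main T.depth le_rfl i hi
  refine Submodule.span_induction (p := fun y _ =>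
    ⟪T.U (ω.shift oc), y.1⟫_ℝ = ⟪T'.U ω, y.2⟫_ℝ) ?_ ?_ ?_ ?_ fin
  · rintro _ ⟨S, _, ⟨w, hw, rfl⟩, rfl⟩
    exact hU S w hw
  all_goals simp +contextual [inner_add_right, inner_smul_right]

end Compare

end Transformer

/-! ## Dyadic numbers -/

theorem IsDyadic.int (p : ℕ) (z : ℤ) : IsDyadic p z :=
  ⟨z * 2 ^ p, by push_cast; field_simp⟩

theorem IsDyadic.zero (p : ℕ) : IsDyadic p 0 := ⟨0, by simp⟩

theorem IsDyadic.one (p : ℕ) : IsDyadic p 1 := by simpa using IsDyadic.int p 1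

theorem IsDyadic.add {p : ℕ} {x y : ℝ} (hx : IsDyadic p x) (hy : IsDyadic p y) :
    IsDyadic p (x + y) := by
  obtain ⟨a, rfl⟩ := hx
  obtain ⟨b, rfl⟩ := hy
  exact ⟨a + b, by push_cast; ring⟩

theorem IsDyadic.sum {ι : Type*} {p : ℕ} (s : Finset ι) {f : ι → ℝ}
    (h : ∀ i ∈ s, IsDyadic p (f i)) : IsDyadic p (∑ i ∈ s, f i) :=
  Finset.sum_induction f (IsDyadic p) (fun _ _ => IsDyadic.add) (IsDyadic.zero p) h

theorem IsDyadic.mul {p q : ℕ} {x y : ℝ} (hx : IsDyadic p x) (hy : IsDyadic q y) :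
    IsDyadic (p + q) (x * y) := by
  obtain ⟨a, rfl⟩ := hx
  obtain ⟨b, rfl⟩ := hy
  exact ⟨a * b, by push_cast; rw [pow_add]; field_simp⟩

theorem IsDyadic.mono {p q : ℕ} (hpq : p ≤ q) {x : ℝ} (hx : IsDyadic p x) : IsDyadic q x := by
  have := hx.mul (IsDyadic.one (q - p))
  rwa [mul_one, Nat.add_sub_cancel' hpq] at this

/-- The gap that turns a small penalty into exact vanishing: the numerator is a nonzero integer. -/
theorem IsDyadic.sq_ge {p : ℕ} {x : ℝ} (hx : IsDyadic p x) (h0 : x ≠ 0) :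
    (1 / 2 ^ p : ℝ) ^ 2 ≤ x ^ 2 := by
  obtain ⟨a, rfl⟩ := hx
  have ha : a ≠ 0 := by rintro rfl; simp at h0
  rw [div_pow, div_pow]
  refine div_le_div_of_nonneg_right ?_ (by positivity)
  have : (1 : ℤ) ≤ a ^ 2 := by have := sq_pos_of_ne_zero ha; omega
  rw [one_pow]
  exact_mod_cast this

/-- Bounded size and bounded precision leave finitely many values; this is the source of all
finiteness of profiles. -/
theorem IsDyadic.finite_le (p : ℕ) (B : ℝ) : {x : ℝ | IsDyadic p x ∧ |x| ≤ B}.Finite := by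
  refine ((Set.finite_Icc (-⌈B * 2 ^ p⌉) ⌈B * 2 ^ p⌉).image fun z : ℤ => (z : ℝ) / 2 ^ p).subset ?_
  rintro x ⟨⟨z, rfl⟩, hz⟩
  refine ⟨z, ?_, rfl⟩
  rw [abs_div, abs_of_pos (by positivity : (0 : ℝ) < 2 ^ p), div_le_iff₀ (by positivity)] at hz
  have h1 : |(z : ℝ)| ≤ (⌈B * 2 ^ p⌉ : ℝ) := hz.trans (Int.le_ceil _)
  have h2 : |z| ≤ ⌈B * 2 ^ p⌉ := by exact_mod_cast h1
  exact abs_le.1 h2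

theorem IsDyadic.clm_apply {d p q : ℕ}
    {V : EuclideanSpace ℝ (Fin d) →L[ℝ] EuclideanSpace ℝ (Fin d)}
    (hV : ∀ c c', IsDyadic p (V (EuclideanSpace.single c 1) c'))
    {x : EuclideanSpace ℝ (Fin d)} (hx : ∀ c, IsDyadic q (x c)) (c' : Fin d) :
    IsDyadic (p + q) (V x c') := by
  have h1 : x = ∑ c, x c • EuclideanSpace.single c (1 : ℝ) := by
    ext c
    simp [Finset.sum_apply, Pi.single_apply]
  have h2 : V x c' = ∑ c, V (EuclideanSpace.single c 1) c' * x c := by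
    conv_lhs => rw [h1]
    simp only [map_sum, map_smul, WithLp.ofLp_sum, Finset.sum_apply, PiLp.smul_apply, smul_eq_mul]
    exact Finset.sum_congr rfl fun c _ => mul_comm _ _
  rw [h2]
  exact IsDyadic.sum _ fun c _ => (hV c c').mul (hx c)

theorem IsDyadic.inner {d p q : ℕ} {x y : EuclideanSpace ℝ (Fin d)}
    (hx : ∀ c, IsDyadic p (x c)) (hy : ∀ c, IsDyadic q (y c)) : IsDyadic (p + q) ⟪x, y⟫_ℝ := by
  rw [PiLp.inner_apply]
  refine IsDyadic.sum _ fun c _ => ?_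
  have := (hx c).mul (hy c)
  simpa [mul_comm] using this

/-! ## Validity of symbols and sources -/

theorem Symb.Valid.mono {A : Type*} {m n : ℕ∞} (h : m ≤ n) {ω : Symb A} (hω : ω.Valid m) :
    ω.Valid n := by
  cases ω with
  | ext k => exact lt_of_lt_of_le (show (k : ℕ∞) < m from hω) h
  | _ => trivial

theorem Symb.valid_of_shift {A : Type*} {n : ℕ∞} {b : ℕ} {ω : Symb A} (hω : (ω.shift b).Valid n) :
    ω.Valid n := by
  cases ω with
  | ext k => exact lt_of_le_of_lt (by simp) (show ((k + b : ℕ) : ℕ∞) < n from hω)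
  | _ => trivial

theorem Symb.shift_zero {A : Type*} (ω : Symb A) : ω.shift 0 = ω := by cases ω <;> rfl

theorem Symb.valid_top {A : Type*} (ω : Symb A) : ω.Valid ⊤ := by
  cases ω with
  | ext k => exact ENat.natCast_lt_top k
  | _ => trivial

theorem Transformer.Source.valid_top {A : Type*} {L F : ℕ} (v : Transformer.Source A L F) :
    v.Valid ⊤ := by
  cases v with
  | pos t => exact ENat.natCast_lt_top t
  | sym ω => exact ω.valid_top
  | mlp _ _ => trivial

theorem Transformer.Source.Valid.mono {A : Type*} {L F : ℕ} {m n : ℕ∞} (h : m ≤ n)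
    {v : Transformer.Source A L F} (hv : v.Valid m) : v.Valid n := by
  cases v with
  | pos t => exact lt_of_lt_of_le (show (t : ℕ∞) < m from hv) h
  | sym ω => exact Symb.Valid.mono h (show ω.Valid m from hv)
  | mlp _ _ => trivial

theorem Transformer.Source.valid_of_shift {A : Type*} {L F : ℕ} {n : ℕ∞} {a b : ℕ}
    {v : Transformer.Source A L F} (hv : (v.shift a b).Valid n) : v.Valid n := by
  cases v with
  | pos t => exact lt_of_le_of_lt (by simp) (show ((t + a : ℕ) : ℕ∞) < n from hv)
  | sym ω => exact Symb.valid_of_shift (show (ω.shift b).Valid n from hv)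
  | mlp _ _ => trivial

instance Symb.finite_valid {A : Type*} [Finite A] (n : ℕ) :
    Finite {ω : Symb A // ω.Valid (n : ℕ∞)} := by
  let g : Option A ⊕ Fin n → {ω : Symb A // ω.Valid (n : ℕ∞)} := fun x =>
    match x with
    | .inl none => ⟨.start, trivial⟩
    | .inl (some a) => ⟨.fin a, trivial⟩
    | .inr k => ⟨.ext k, by show ((k : ℕ) : ℕ∞) < n; exact_mod_cast k.2⟩
  refine Finite.of_surjective g ?_
  rintro ⟨ω, hω⟩
  cases ω with
  | start => exact ⟨.inl none, rfl⟩
  | fin a => exact ⟨.inl (some a), rfl⟩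
  | ext k =>
    have : k < n := by exact_mod_cast (show ((k : ℕ) : ℕ∞) < n from hω)
    exact ⟨.inr ⟨k, this⟩, rfl⟩

theorem Transformer.TranslationInvariant.mono {A : Type*} {H : Type*} [NormedAddCommGroup H]
    [InnerProductSpace ℝ H] {T : Transformer A H} {m n : ℕ∞} (hmn : m ≤ n)
    (hT : T.TranslationInvariant n) : T.TranslationInvariant m :=
  ⟨fun l h S₁ S₂ a b v w h1 h2 h3 h4 =>
      hT.1 l h S₁ S₂ a b v w (h1.mono hmn) (h2.mono hmn) (h3.mono hmn) (h4.mono hmn),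
    fun S a b ω w h1 h2 h3 h4 =>
      hT.2.1 S a b ω w (h1.mono hmn) (h2.mono hmn) (h3.mono hmn) (h4.mono hmn),
    fun S l s a b w h1 h2 => hT.2.2 S l s a b w (h1.mono hmn) (h2.mono hmn)⟩

theorem Transformer.UnembedBound.mono {A : Type*} {H : Type*} [NormedAddCommGroup H]
    [InnerProductSpace ℝ H] {T : Transformer A H} {m n : ℕ∞} (hmn : m ≤ n) {C : ℝ}
    (hT : T.UnembedBound n C) : T.UnembedBound m C :=
  ⟨hT.1, fun v s hs => hT.2 v s fun ω hω => (hs ω hω).mono hmn⟩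

/-- Cauchy–Schwarz over the finitely many available symbols. It makes the set nonempty whose infimum
enters the regularizer. -/
theorem Transformer.exists_unembedBound {A : Type*} [Finite A] {H : Type*} [NormedAddCommGroup H]
    [InnerProductSpace ℝ H] (T : Transformer A H) (n : ℕ) : ∃ C, T.UnembedBound n C := by
  classical
  have hfin : {ω : Symb A | ω.Valid (n : ℕ∞)}.Finite :=
    Symb.finite_valid n
  refine ⟨√(∑ ω ∈ hfin.toFinset, ‖T.U ω‖ ^ 2), Real.sqrt_nonneg _, fun v s hs => ?_⟩
  rw [mul_pow, Real.sq_sqrt (Finset.sum_nonneg fun _ _ => sq_nonneg _), Finset.sum_mul]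
  refine (Finset.sum_le_sum fun ω _ => ?_).trans <| Finset.sum_le_sum_of_subset_of_nonneg
    (fun ω hω => hfin.mem_toFinset.2 (hs ω hω)) fun _ _ _ => by positivity
  rw [← mul_pow]
  exact sq_le_sq' (neg_le_of_abs_le (abs_real_inner_le_norm _ _)) (real_inner_le_norm _ _)

/-! ### Restriction to smaller context widths and consequences of a bounded regularizer -/

namespace Hypothesis

variable {A : Type*} {m n : ℕ}

/-- A hypothesis for context width `n`, regarded at a smaller context width. -/
def restrict (M : Hypothesis A n) (hmn : m ≤ n) : Hypothesis A m where
  d := M.d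
  p := M.p
  T := M.T
  pos_prec t ht := M.pos_prec t (ht.trans_le hmn)
  E_prec ω hω := M.E_prec ω (hω.mono (by exact_mod_cast hmn))
  K_prec := M.K_prec
  Q_prec := M.Q_prec
  V_prec := M.V_prec
  A_prec := M.A_prec
  b_prec := M.b_prec
  B_prec := M.B_prec
  U_prec ω hω := M.U_prec ω (hω.mono (by exact_mod_cast hmn))
  invariant := M.invariant.mono (by exact_mod_cast hmn)

theorem Fits.restrict {M : Hypothesis A n} {ε : ℝ} {f : Word A → ℕ → Symb A → ℝ}
    (hM : M.Fits ε f) (hmn : m ≤ n) : (M.restrict hmn).Fits ε f := by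
  intro w hw hspan op oc hop hoc i hi ω hω
  exact hM w (by omega) (fun k m hk hm => by have := hspan k m hk hm; omega) op oc (by omega)
    (fun k hk => (hoc k hk).trans_le hmn) i hi ω (hω.mono (by exact_mod_cast hmn))

/-- The part of the penalty that belongs to index differences in a set `s`. -/
noncomputable def zetaOn (M : Hypothesis A n) (s : Finset ℕ) : ℝ :=
  (∑ l : Fin M.T.depth, ∑ h : Fin M.T.heads, ∑ S₁ : M.T.Path, ∑ S₂ : M.T.Path,
    ((∑ k ∈ s, M.T.prodAttn l h S₁ S₂ (.pos 0) (.pos k) ^ 2) +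
      (∑ k ∈ s, M.T.prodAttn l h S₁ S₂ (.pos k) (.pos 0) ^ 2) +
      (∑ k ∈ s, M.T.prodAttn l h S₁ S₂ (.sym (.ext 0)) (.sym (.ext k)) ^ 2) +
      ∑ k ∈ s, M.T.prodAttn l h S₁ S₂ (.sym (.ext k)) (.sym (.ext 0)) ^ 2)) +
  ∑ S : M.T.Path,
    ((∑ k ∈ s, M.T.prodUnembed S (.ext 0) (.sym (.ext k)) ^ 2) +
      ∑ k ∈ s, M.T.prodUnembed S (.ext k) (.sym (.ext 0)) ^ 2)

/-- One index is always the first one, so the sums run over index differences and split at m. The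
condition 1 ≤ m is needed because half of the sums start at 1, to avoid counting the diagonal twice.
-/
theorem zeta_eq_restrict_add (M : Hypothesis A n) (hm : 1 ≤ m) (hmn : m ≤ n) :
    M.zeta = (M.restrict hmn).zeta + M.zetaOn (Finset.Ico m n) := by
  have h1 : ∀ f : ℕ → ℝ, ∑ k ∈ Finset.range n, f k =
      ∑ k ∈ Finset.range m, f k + ∑ k ∈ Finset.Ico m n, f k := fun f =>
    (Finset.sum_range_add_sum_Ico f hmn).symm
  have h2 : ∀ f : ℕ → ℝ, ∑ k ∈ Finset.Ico 1 n, f k =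
      ∑ k ∈ Finset.Ico 1 m, f k + ∑ k ∈ Finset.Ico m n, f k := fun f =>
    (Finset.sum_Ico_consecutive f hm hmn).symm
  have e : (M.restrict hmn).zeta =
      (∑ l : Fin M.T.depth, ∑ h : Fin M.T.heads, ∑ S₁ : M.T.Path, ∑ S₂ : M.T.Path,
        ((∑ k ∈ Finset.range m, M.T.prodAttn l h S₁ S₂ (.pos 0) (.pos k) ^ 2) +
          (∑ k ∈ Finset.Ico 1 m, M.T.prodAttn l h S₁ S₂ (.pos k) (.pos 0) ^ 2) +
          (∑ k ∈ Finset.range m,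
            M.T.prodAttn l h S₁ S₂ (.sym (.ext 0)) (.sym (.ext k)) ^ 2) +
          ∑ k ∈ Finset.Ico 1 m,
            M.T.prodAttn l h S₁ S₂ (.sym (.ext k)) (.sym (.ext 0)) ^ 2)) +
      ∑ S : M.T.Path,
        ((∑ k ∈ Finset.range m, M.T.prodUnembed S (.ext 0) (.sym (.ext k)) ^ 2) +
          ∑ k ∈ Finset.Ico 1 m, M.T.prodUnembed S (.ext k) (.sym (.ext 0)) ^ 2) := rfl
  rw [e]
  simp only [zeta, zetaOn, h1, h2, Finset.sum_add_distrib]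
  ring

theorem zetaOn_nonneg (M : Hypothesis A n) (s : Finset ℕ) : 0 ≤ M.zetaOn s := by
  unfold zetaOn; positivity

theorem zeta_nonneg (M : Hypothesis A n) : 0 ≤ M.zeta := by
  unfold zeta; positivity

theorem attn_le_zetaOn (M : Hypothesis A n) (s : Finset ℕ) (l h S₁ S₂) {k : ℕ} (hk : k ∈ s) :
    M.T.prodAttn l h S₁ S₂ (.pos 0) (.pos k) ^ 2 ≤ M.zetaOn s ∧
    M.T.prodAttn l h S₁ S₂ (.pos k) (.pos 0) ^ 2 ≤ M.zetaOn s ∧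
    M.T.prodAttn l h S₁ S₂ (.sym (.ext 0)) (.sym (.ext k)) ^ 2 ≤ M.zetaOn s ∧
    M.T.prodAttn l h S₁ S₂ (.sym (.ext k)) (.sym (.ext 0)) ^ 2 ≤ M.zetaOn s := by
  have key : (∑ k ∈ s, M.T.prodAttn l h S₁ S₂ (.pos 0) (.pos k) ^ 2) +
      (∑ k ∈ s, M.T.prodAttn l h S₁ S₂ (.pos k) (.pos 0) ^ 2) +
      (∑ k ∈ s, M.T.prodAttn l h S₁ S₂ (.sym (.ext 0)) (.sym (.ext k)) ^ 2) +
      ∑ k ∈ s, M.T.prodAttn l h S₁ S₂ (.sym (.ext k)) (.sym (.ext 0)) ^ 2 ≤ M.zetaOn s := by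
    unfold zetaOn
    refine le_trans ?_ (le_add_of_nonneg_right (by positivity))
    refine le_trans ?_ (Finset.single_le_sum (fun _ _ => by positivity) (Finset.mem_univ l))
    refine le_trans ?_ (Finset.single_le_sum (fun _ _ => by positivity) (Finset.mem_univ h))
    refine le_trans ?_ (Finset.single_le_sum (fun _ _ => by positivity) (Finset.mem_univ S₁))
    exact Finset.single_le_sum (f := fun S₂ => (∑ k ∈ s, M.T.prodAttn l h S₁ S₂ (.pos 0) (.pos k) ^ 2) +
      (∑ k ∈ s, M.T.prodAttn l h S₁ S₂ (.pos k) (.pos 0) ^ 2) +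
      (∑ k ∈ s, M.T.prodAttn l h S₁ S₂ (.sym (.ext 0)) (.sym (.ext k)) ^ 2) +
      ∑ k ∈ s, M.T.prodAttn l h S₁ S₂ (.sym (.ext k)) (.sym (.ext 0)) ^ 2)
      (fun _ _ => by positivity) (Finset.mem_univ S₂)
  have one : ∀ f : ℕ → ℝ, f k ^ 2 ≤ ∑ k ∈ s, f k ^ 2 := fun f =>
    Finset.single_le_sum (f := fun k => f k ^ 2) (fun _ _ => sq_nonneg _) hk
  have pos : ∀ f : ℕ → ℝ, 0 ≤ ∑ k ∈ s, f k ^ 2 := fun f => Finset.sum_nonneg fun _ _ => sq_nonneg _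
  have o1 := one fun k => M.T.prodAttn l h S₁ S₂ (.pos 0) (.pos k)
  have o2 := one fun k => M.T.prodAttn l h S₁ S₂ (.pos k) (.pos 0)
  have o3 := one fun k => M.T.prodAttn l h S₁ S₂ (.sym (.ext 0)) (.sym (.ext k))
  have o4 := one fun k => M.T.prodAttn l h S₁ S₂ (.sym (.ext k)) (.sym (.ext 0))
  have p1 := pos fun k => M.T.prodAttn l h S₁ S₂ (.pos 0) (.pos k)
  have p2 := pos fun k => M.T.prodAttn l h S₁ S₂ (.pos k) (.pos 0)
  have p3 := pos fun k => M.T.prodAttn l h S₁ S₂ (.sym (.ext 0)) (.sym (.ext k))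
  have p4 := pos fun k => M.T.prodAttn l h S₁ S₂ (.sym (.ext k)) (.sym (.ext 0))
  refine ⟨?_, ?_, ?_, ?_⟩ <;> linarith

theorem unembed_le_zetaOn (M : Hypothesis A n) (s : Finset ℕ) (S) {k : ℕ} (hk : k ∈ s) :
    M.T.prodUnembed S (.ext 0) (.sym (.ext k)) ^ 2 ≤ M.zetaOn s ∧
    M.T.prodUnembed S (.ext k) (.sym (.ext 0)) ^ 2 ≤ M.zetaOn s := by
  have key : (∑ k ∈ s, M.T.prodUnembed S (.ext 0) (.sym (.ext k)) ^ 2) +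
      ∑ k ∈ s, M.T.prodUnembed S (.ext k) (.sym (.ext 0)) ^ 2 ≤ M.zetaOn s := by
    unfold zetaOn
    refine le_trans ?_ (le_add_of_nonneg_left (by positivity))
    exact Finset.single_le_sum (f := fun S => (∑ k ∈ s, M.T.prodUnembed S (.ext 0) (.sym (.ext k)) ^ 2) +
      ∑ k ∈ s, M.T.prodUnembed S (.ext k) (.sym (.ext 0)) ^ 2)
      (fun _ _ => by positivity) (Finset.mem_univ S)
  have one : ∀ f : ℕ → ℝ, f k ^ 2 ≤ ∑ k ∈ s, f k ^ 2 := fun f =>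
    Finset.single_le_sum (f := fun k => f k ^ 2) (fun _ _ => sq_nonneg _) hk
  have pos : ∀ f : ℕ → ℝ, 0 ≤ ∑ k ∈ s, f k ^ 2 := fun f => Finset.sum_nonneg fun _ _ => sq_nonneg _
  have o1 := one fun k => M.T.prodUnembed S (.ext 0) (.sym (.ext k))
  have o2 := one fun k => M.T.prodUnembed S (.ext k) (.sym (.ext 0))
  have p1 := pos fun k => M.T.prodUnembed S (.ext 0) (.sym (.ext k))
  have p2 := pos fun k => M.T.prodUnembed S (.ext k) (.sym (.ext 0))
  constructor <;> linarith

theorem sInf_unembed_nonneg (M : Hypothesis A n) : 0 ≤ sInf {C : ℝ | M.T.UnembedBound n C} :=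
  Real.sInf_nonneg fun _ hC => hC.1

/-- All other terms are either unchanged or suprema and norms over fewer indices, so they cannot
grow, while the penalty loses exactly its tail. This inequality yields both the monotonicity of the
infimum and the smallness of the tail. -/
theorem reg_restrict_add_le [Finite A] (M : Hypothesis A n) (hm : 1 ≤ m) (hmn : m ≤ n) :
    (M.restrict hmn).reg + M.zetaOn (Finset.Ico m n) ≤ M.reg := by
  have hmn' : (m : ℕ∞) ≤ n := by exact_mod_cast hmn
  have h1 : sInf {C : ℝ | M.T.UnembedBound m C} ≤ sInf {C : ℝ | M.T.UnembedBound n C} :=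
    csInf_le_csInf ⟨0, fun _ hC => hC.1⟩ (M.T.exists_unembedBound n) fun C hC => hC.mono hmn'
  have h2 : (⨆ t : Fin m, ‖M.T.pos t‖) ≤ ⨆ t : Fin n, ‖M.T.pos t‖ :=
    Real.iSup_le (fun t => le_ciSup (f := fun t : Fin n => ‖M.T.pos t‖)
      (Set.finite_range _).bddAbove (Fin.castLE hmn t)) (Real.iSup_nonneg fun _ => norm_nonneg _)
  have h3 : (⨆ ω : {ω : Symb A // ω.Valid m}, ‖M.T.E ω.1‖) ≤
      ⨆ ω : {ω : Symb A // ω.Valid n}, ‖M.T.E ω.1‖ :=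
    Real.iSup_le (fun ω => le_ciSup (f := fun ω : {ω : Symb A // ω.Valid n} => ‖M.T.E ω.1‖)
      (Set.finite_range _).bddAbove ⟨ω.1, ω.2.mono hmn'⟩) (Real.iSup_nonneg fun _ => norm_nonneg _)
  have h4 := M.zeta_eq_restrict_add hm hmn
  unfold reg
  rw [h4]
  generalize (M.restrict hmn).zeta = z
  dsimp only [Hypothesis.restrict]
  rw [add_assoc _ z]
  exact add_le_add (add_le_add (add_le_add (add_le_add (add_le_add le_rfl h1) h2) h3) le_rfl) le_rfl

theorem le_iSup_of_finite {ι : Type*} [Finite ι] (f : ι → ℝ) (i : ι) : f i ≤ ⨆ i, f i :=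
  le_ciSup (Set.finite_range f).bddAbove i

/-- Consequences of a bound on the regularizer. -/
structure RegBound (M : Hypothesis A n) (R : ℝ) : Prop where
  depth : (M.T.depth : ℝ) ≤ R
  heads : (M.T.heads : ℝ) ≤ R
  p : (M.p : ℝ) ≤ R
  roundPrec : (M.T.roundPrec : ℝ) ≤ R
  KQ : ∀ l h, ‖(ContinuousLinearMap.adjoint (M.T.K l h)).comp (M.T.Q l h)‖ ≤ R
  V : ∀ l h, ‖M.T.V l h‖ ≤ R
  Ain : ∀ l s, ‖M.T.Ain l s‖ ≤ R
  Bout : ∀ l, ∑ s, ‖M.T.Bout l s‖ ^ 2 ≤ R ^ 2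
  U : ∀ ω : Symb A, ω.Valid n → ‖M.T.U ω‖ ≤ R + 1
  pos : ∀ t < n, ‖M.T.pos t‖ ≤ R
  E : ∀ ω : Symb A, ω.Valid n → ‖M.T.E ω‖ ≤ R
  b : ∀ l s, |M.T.b l s| ≤ R

theorem reg_nonneg (M : Hypothesis A n) : 0 ≤ M.reg := by
  have := M.sInf_unembed_nonneg
  have := M.zeta_nonneg
  have h1 := Real.iSup_nonneg (f := fun lh : Fin M.T.depth × Fin M.T.heads =>
    ‖(ContinuousLinearMap.adjoint (M.T.K lh.1 lh.2)).comp (M.T.Q lh.1 lh.2)‖) fun _ => norm_nonneg _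
  have h2 := Real.iSup_nonneg (f := fun lh : Fin M.T.depth × Fin M.T.heads =>
    ‖M.T.V lh.1 lh.2‖) fun _ => norm_nonneg _
  have h3 := Real.iSup_nonneg (f := fun l : Fin M.T.depth => √(∑ s, ‖M.T.Ain l s‖ ^ 2))
    fun _ => Real.sqrt_nonneg _
  have h4 := Real.iSup_nonneg (f := fun l : Fin M.T.depth => √(∑ s, ‖M.T.Bout l s‖ ^ 2))
    fun _ => Real.sqrt_nonneg _
  have h5 := Real.iSup_nonneg (f := fun t : Fin n => ‖M.T.pos t‖) fun _ => norm_nonneg _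
  have h6 := Real.iSup_nonneg (f := fun ω : {ω : Symb A // ω.Valid n} => ‖M.T.E ω.1‖)
    fun _ => norm_nonneg _
  have h7 := Real.iSup_nonneg (f := fun l : Fin M.T.depth => √(∑ s, M.T.b l s ^ 2))
    fun _ => Real.sqrt_nonneg _
  unfold reg
  positivity

/-- Every summand of the regularizer is nonnegative, so a bound on the sum bounds each of them. -/
theorem regBound [Finite A] {M : Hypothesis A n} {R : ℝ} (hR : M.reg ≤ R) : M.RegBound R := by
  have h8 := M.sInf_unembed_nonneg
  have h9 := M.zeta_nonneg
  have h1 := Real.iSup_nonneg (f := fun lh : Fin M.T.depth × Fin M.T.heads =>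
    ‖(ContinuousLinearMap.adjoint (M.T.K lh.1 lh.2)).comp (M.T.Q lh.1 lh.2)‖) fun _ => norm_nonneg _
  have h2 := Real.iSup_nonneg (f := fun lh : Fin M.T.depth × Fin M.T.heads =>
    ‖M.T.V lh.1 lh.2‖) fun _ => norm_nonneg _
  have h3 := Real.iSup_nonneg (f := fun l : Fin M.T.depth => √(∑ s, ‖M.T.Ain l s‖ ^ 2))
    fun _ => Real.sqrt_nonneg _
  have h4 := Real.iSup_nonneg (f := fun l : Fin M.T.depth => √(∑ s, ‖M.T.Bout l s‖ ^ 2))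
    fun _ => Real.sqrt_nonneg _
  have h5 := Real.iSup_nonneg (f := fun t : Fin n => ‖M.T.pos t‖) fun _ => norm_nonneg _
  have h6 := Real.iSup_nonneg (f := fun ω : {ω : Symb A // ω.Valid n} => ‖M.T.E ω.1‖)
    fun _ => norm_nonneg _
  have h7 := Real.iSup_nonneg (f := fun l : Fin M.T.depth => √(∑ s, M.T.b l s ^ 2))
    fun _ => Real.sqrt_nonneg _
  have g1 : (0 : ℝ) ≤ M.T.depth := by positivity
  have g2 : (0 : ℝ) ≤ M.T.heads := by positivity
  have g3 : (0 : ℝ) ≤ M.p := by positivity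
  have g4 : (0 : ℝ) ≤ M.T.roundPrec := by positivity
  
  unfold reg at hR
  constructor
  · linarith
  · linarith
  · linarith
  · linarith
  · intro l h
    have := le_iSup_of_finite (fun lh : Fin M.T.depth × Fin M.T.heads =>
      ‖(ContinuousLinearMap.adjoint (M.T.K lh.1 lh.2)).comp (M.T.Q lh.1 lh.2)‖) (l, h)
    dsimp only at this
    linarith
  · intro l h
    have := le_iSup_of_finite (fun lh : Fin M.T.depth × Fin M.T.heads => ‖M.T.V lh.1 lh.2‖) (l, h)
    dsimp only at this
    linarith
  · intro l s
    have := le_iSup_of_finite (fun l : Fin M.T.depth => √(∑ s, ‖M.T.Ain l s‖ ^ 2)) l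
    have h10 : ‖M.T.Ain l s‖ ≤ √(∑ s, ‖M.T.Ain l s‖ ^ 2) := Real.le_sqrt_of_sq_le
      (Finset.single_le_sum (f := fun s => ‖M.T.Ain l s‖ ^ 2) (fun _ _ => sq_nonneg _)
        (Finset.mem_univ s))
    linarith
  · intro l
    have := le_iSup_of_finite (fun l : Fin M.T.depth => √(∑ s, ‖M.T.Bout l s‖ ^ 2)) l
    exact (Real.sqrt_le_left (by linarith)).1 (by linarith)
  · intro ω hω
    -- The infimum is approached within 1, whence the bound `R + 1`. Testing the bound on the row `U
    -- ω` itself gives the norm of that row.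
    obtain ⟨C, hC, hlt⟩ := exists_lt_of_csInf_lt (M.T.exists_unembedBound n)
      (lt_add_one (sInf {C : ℝ | M.T.UnembedBound n C}))
    have h10 := hC.2 (M.T.U ω) {ω} (by simpa using hω)
    rw [Finset.sum_singleton, real_inner_self_eq_norm_sq] at h10
    have h11 := abs_le_of_sq_le_sq' (a := ‖M.T.U ω‖ ^ 2) h10 (mul_nonneg hC.1 (norm_nonneg _))
    have h12 : ‖M.T.U ω‖ ≤ C := by
      by_contra hcon
      push Not at hcon
      have : 0 < ‖M.T.U ω‖ := hC.1.trans_lt hcon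
      have := h11.2
      nlinarith
    linarith
  · intro t ht
    have := le_iSup_of_finite (fun t : Fin n => ‖M.T.pos t‖) ⟨t, ht⟩
    dsimp only at this
    linarith
  · intro ω hω
    have := le_iSup_of_finite (fun ω : {ω : Symb A // ω.Valid n} => ‖M.T.E ω.1‖) ⟨ω, hω⟩
    dsimp only at this
    linarith
  · intro l s
    have := le_iSup_of_finite (fun l : Fin M.T.depth => √(∑ s, M.T.b l s ^ 2)) l
    have h10 : |M.T.b l s| ≤ √(∑ s, M.T.b l s ^ 2) := by
      refine Real.le_sqrt_of_sq_le ?_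
      rw [sq_abs]
      exact Finset.single_le_sum (f := fun s => M.T.b l s ^ 2) (fun _ _ => sq_nonneg _)
        (Finset.mem_univ s)
    linarith

end Hypothesis

namespace Hypothesis

open Transformer

variable {A : Type*} {m n : ℕ}

/-! ## Precision and size of product functions -/

theorem RegBound.Bout_le {M : Hypothesis A n} {R : ℝ} (hR : 0 ≤ R) (h : M.RegBound R) (l s) :
    ‖M.T.Bout l s‖ ≤ R := by
  have h1 := Finset.single_le_sum (f := fun s => ‖M.T.Bout l s‖ ^ 2) (fun _ _ => sq_nonneg _)
    (Finset.mem_univ s)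
  exact abs_le_of_sq_le_sq' (h1.trans (h.Bout l)) hR |>.2

theorem source_prec (M : Hypothesis A n) {v : Source A M.T.depth M.T.dff} (hv : v.Valid n) (c) :
    IsDyadic M.p (M.T.source v c) := by
  cases v with
  | pos t => exact M.pos_prec t (by exact_mod_cast (show (t : ℕ∞) < n from hv)) c
  | sym ω => exact M.E_prec ω hv c
  | mlp l s => exact M.B_prec l s c

theorem RegBound.source {M : Hypothesis A n} {R : ℝ} (hR : 0 ≤ R) (h : M.RegBound R)
    {v : Source A M.T.depth M.T.dff} (hv : v.Valid n) : ‖M.T.source v‖ ≤ R := by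
  cases v with
  | pos t => exact h.pos t (by exact_mod_cast (show (t : ℕ∞) < n from hv))
  | sym ω => exact h.E ω hv
  | mlp l s => exact h.Bout_le hR l s

/-- Each value matrix has entries with p fractional bits, so each layer adds at most p bits to those
of the source. -/
theorem pathProdTo_prec (M : Hypothesis A n) (S : M.T.Path) {v : Source A M.T.depth M.T.dff}
    (hv : v.Valid n) (l : ℕ) (c) :
    IsDyadic ((l + 1) * M.p) (M.T.pathProdTo S l (M.T.source v) c) := by
  induction l generalizing c with
  | zero => simpa [pathProdTo] using M.source_prec hv c
  | succ l ih =>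
    by_cases hl : l < M.T.depth
    · cases hS : S ⟨l, hl⟩ with
      | none =>
        rw [pathProdTo_succ_none _ _ _ fun _ => hS]
        exact (ih c).mono (Nat.mul_le_mul_right _ (by omega))
      | some h =>
        rw [pathProdTo_succ_some _ _ hl hS, ContinuousLinearMap.comp_apply]
        exact (IsDyadic.clm_apply (M.V_prec _ h) ih c).mono (by ring_nf; rfl)
    · rw [pathProdTo_succ_none _ _ _ fun h => absurd h hl]
      exact (ih c).mono (Nat.mul_le_mul_right _ (by omega))

theorem RegBound.pathProdTo {M : Hypothesis A n} {R : ℝ} (hR : 1 ≤ R) (h : M.RegBound R)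
    (S : M.T.Path) (x) (l : ℕ) : ‖M.T.pathProdTo S l x‖ ≤ R ^ l * ‖x‖ := by
  induction l with
  | zero => simp [Transformer.pathProdTo]
  | succ l ih =>
    have h1 : R ^ l * ‖x‖ ≤ R ^ (l + 1) * ‖x‖ := by
      gcongr
      · omega
    by_cases hl : l < M.T.depth
    · cases hS : S ⟨l, hl⟩ with
      | none =>
        rw [pathProdTo_succ_none _ _ _ fun _ => hS]
        exact ih.trans h1
      | some k =>
        rw [pathProdTo_succ_some _ _ hl hS, ContinuousLinearMap.comp_apply]
        calc _ ≤ ‖M.T.V ⟨l, hl⟩ k‖ * ‖M.T.pathProdTo S l x‖ := ContinuousLinearMap.le_opNorm _ _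
          _ ≤ R * (R ^ l * ‖x‖) := mul_le_mul (h.V _ _) ih (norm_nonneg _) (by linarith)
          _ = _ := by ring
    · rw [pathProdTo_succ_none _ _ _ fun h => absurd h hl]
      exact ih.trans h1

/-- A number of fractional bits that suffices for all product functions. -/
def prodPrec (R : ℕ) : ℕ := 2 * (R + 2) * R

/-- A bound on all product functions. -/
def prodBound (R : ℕ) : ℝ := ((R : ℝ) + 1) ^ (2 * R + 3)

variable {R : ℕ} {M : Hypothesis A n}

theorem RegBound.path_prec (h : M.RegBound R) (S : M.T.Path)
    {v : Source A M.T.depth M.T.dff} (hv : v.Valid n) (c) :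
    IsDyadic ((R + 1) * R) (M.T.pathProd S (M.T.source v) c) := by
  have h1 : M.T.depth ≤ R := by exact_mod_cast h.depth
  have h2 : M.p ≤ R := by exact_mod_cast h.p
  exact (M.pathProdTo_prec S hv M.T.depth c).mono (Nat.mul_le_mul (by omega) h2)

theorem RegBound.path_norm (hR : 1 ≤ R) (h : M.RegBound R) (S : M.T.Path)
    {v : Source A M.T.depth M.T.dff} (hv : v.Valid n) :
    ‖M.T.pathProd S (M.T.source v)‖ ≤ ((R : ℝ) + 1) ^ (R + 1) := by
  have h1 : M.T.depth ≤ R := by exact_mod_cast h.depth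
  have hR' : (1 : ℝ) ≤ R := by exact_mod_cast hR
  calc _ ≤ (R : ℝ) ^ M.T.depth * ‖M.T.source v‖ := h.pathProdTo hR' S _ _
    _ ≤ ((R : ℝ) + 1) ^ R * (R + 1) := by
        refine mul_le_mul ?_ ((h.source (by positivity) hv).trans (by linarith)) (norm_nonneg _)
          (by positivity)
        exact (pow_le_pow_right₀ hR' h1).trans (pow_le_pow_left₀ (by positivity) (by linarith) _)
    _ = _ := by rw [pow_succ]

/-- A path image needs at most `(R + 1) * R` bits, `K` and `Q` add at most `R` bits each, and the
inner product adds up the bits of both sides: this is `prodPrec R`. -/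
theorem RegBound.prodAttn_prec (h : M.RegBound R) (l k S₁ S₂) {v w : Source A M.T.depth M.T.dff}
    (hv : v.Valid n) (hw : w.Valid n) :
    IsDyadic (prodPrec R) (M.T.prodAttn l k S₁ S₂ v w) := by
  have h2 : M.p ≤ R := by exact_mod_cast h.p
  have h3 := IsDyadic.inner (IsDyadic.clm_apply (M.K_prec l k) (h.path_prec S₁ hv))
    (IsDyadic.clm_apply (M.Q_prec l k) (h.path_prec S₂ hw))
  refine h3.mono ?_
  unfold prodPrec
  nlinarith

theorem RegBound.prodUnembed_prec (h : M.RegBound R) (S) {ω : Symb A} (hω : ω.Valid n)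
    {w : Source A M.T.depth M.T.dff} (hw : w.Valid n) :
    IsDyadic (prodPrec R) (M.T.prodUnembed S ω w) := by
  have h2 : M.p ≤ R := by exact_mod_cast h.p
  refine (IsDyadic.inner (M.U_prec ω hω) (h.path_prec S hw)).mono ?_
  unfold prodPrec
  nlinarith

theorem RegBound.prodMlp_prec (h : M.RegBound R) (S l s)
    {w : Source A M.T.depth M.T.dff} (hw : w.Valid n) :
    IsDyadic (prodPrec R) (M.T.prodMlp S l s w) := by
  have h2 : M.p ≤ R := by exact_mod_cast h.p
  refine (IsDyadic.inner (M.A_prec l s) (h.path_prec S hw)).mono ?_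
  unfold prodPrec
  nlinarith

theorem RegBound.prodAttn_le (hR : 1 ≤ R) (h : M.RegBound R) (l k S₁ S₂)
    {v w : Source A M.T.depth M.T.dff} (hv : v.Valid n) (hw : w.Valid n) :
    |M.T.prodAttn l k S₁ S₂ v w| ≤ prodBound R := by
  -- The regularizer bounds only the norm of KᵀQ, not those of K and Q, so K is moved to the other
  -- side first.
  have h1 : M.T.prodAttn l k S₁ S₂ v w = ⟪M.T.pathProd S₁ (M.T.source v),
      (ContinuousLinearMap.adjoint (M.T.K l k)).comp (M.T.Q l k)
        (M.T.pathProd S₂ (M.T.source w))⟫_ℝ := by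
    rw [ContinuousLinearMap.comp_apply, ContinuousLinearMap.adjoint_inner_right]
    rfl
  have h2 := h.path_norm hR S₁ hv
  have h3 := h.path_norm hR S₂ hw
  rw [h1]
  calc _ ≤ ‖M.T.pathProd S₁ (M.T.source v)‖ *
        (‖(ContinuousLinearMap.adjoint (M.T.K l k)).comp (M.T.Q l k)‖ *
          ‖M.T.pathProd S₂ (M.T.source w)‖) := (abs_real_inner_le_norm _ _).trans <|
        mul_le_mul_of_nonneg_left (ContinuousLinearMap.le_opNorm _ _) (norm_nonneg _)
    _ ≤ ((R : ℝ) + 1) ^ (R + 1) * ((R + 1) * ((R : ℝ) + 1) ^ (R + 1)) := by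
        gcongr
        exact (h.KQ l k).trans (by linarith)
    _ = _ := by unfold prodBound; ring

theorem RegBound.prodUnembed_le (hR : 1 ≤ R) (h : M.RegBound R) (S) {ω : Symb A} (hω : ω.Valid n)
    {w : Source A M.T.depth M.T.dff} (hw : w.Valid n) :
    |M.T.prodUnembed S ω w| ≤ prodBound R := by
  have h3 := h.path_norm hR S hw
  have h4 := h.U ω hω
  calc _ ≤ ‖M.T.U ω‖ * ‖M.T.pathProd S (M.T.source w)‖ := abs_real_inner_le_norm _ _
    _ ≤ ((R : ℝ) + 1) * ((R : ℝ) + 1) ^ (R + 1) := by gcongr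
    _ = ((R : ℝ) + 1) ^ (R + 2) := by ring
    _ ≤ _ := pow_le_pow_right₀ (by linarith [(Nat.cast_nonneg R : (0 : ℝ) ≤ R)]) (by omega)

theorem RegBound.prodMlp_le (hR : 1 ≤ R) (h : M.RegBound R) (S l s)
    {w : Source A M.T.depth M.T.dff} (hw : w.Valid n) :
    |M.T.prodMlp S l s w| ≤ prodBound R := by
  have h3 := h.path_norm hR S hw
  have h4 : ‖M.T.Ain l s‖ ≤ R + 1 := (h.Ain l s).trans (by linarith)
  calc _ ≤ ‖M.T.Ain l s‖ * ‖M.T.pathProd S (M.T.source w)‖ := abs_real_inner_le_norm _ _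
    _ ≤ ((R : ℝ) + 1) * ((R : ℝ) + 1) ^ (R + 1) := by gcongr
    _ = ((R : ℝ) + 1) ^ (R + 2) := by ring
    _ ≤ _ := pow_le_pow_right₀ (by linarith [(Nat.cast_nonneg R : (0 : ℝ) ≤ R)]) (by omega)

end Hypothesis

/-! ## Locality from a small penalty -/

/-- Attention and unembedding products of two positions, or of two extended symbols, with indices
below `n` vanish when the indices differ by at least `Δ`. -/
def Transformer.IsLocalBelow {A H : Type*} [NormedAddCommGroup H] [InnerProductSpace ℝ H]
    (T : Transformer A H) (n Δ : ℕ) : Prop :=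
  ∀ k < n, ∀ m < n, (k + Δ ≤ m ∨ m + Δ ≤ k) →
    (∀ l h S₁ S₂, T.prodAttn l h S₁ S₂ (.pos k) (.pos m) = 0 ∧
      T.prodAttn l h S₁ S₂ (.sym (.ext k)) (.sym (.ext m)) = 0) ∧
    ∀ S, T.prodUnembed S (.ext k) (.sym (.ext m)) = 0

/-- Translation invariance moves a pair at distance d to one whose smaller index is 0. The square of
its product is then a summand of the tail penalty, which is below the smallest square of a nonzero
number of this precision. -/
theorem Hypothesis.RegBound.isLocalBelow {A : Type*} {n R Δ : ℕ} {M : Hypothesis A n}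
    (h : M.RegBound R)
    (hz : M.zetaOn (Finset.Ico Δ n) < (1 / 2 ^ Hypothesis.prodPrec R : ℝ) ^ 2) :
    M.T.IsLocalBelow n Δ := by
  have zero : ∀ x : ℝ, IsDyadic (Hypothesis.prodPrec R) x → x ^ 2 ≤ M.zetaOn (Finset.Ico Δ n) →
      x = 0 := fun x hx hle => by
    by_contra hne
    exact absurd (hx.sq_ge hne) (not_le.2 (hle.trans_lt hz))
  have vp : ∀ {k}, k < n → (Transformer.Source.pos k : Transformer.Source A M.T.depth
      M.T.dff).Valid n := fun {k} hk => by show ((k : ℕ) : ℕ∞) < n; exact_mod_cast hk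
  have vs : ∀ {k}, k < n → (Symb.ext k : Symb A).Valid n := fun {k} hk => by
    show ((k : ℕ) : ℕ∞) < n; exact_mod_cast hk
  have vs' : ∀ {k}, k < n → (Transformer.Source.sym (.ext k) : Transformer.Source A M.T.depth
      M.T.dff).Valid n := fun {k} hk => vs hk
  intro k hk m hm hkm
  rcases hkm with hkm | hkm
  · obtain ⟨d, rfl⟩ := Nat.exists_eq_add_of_le (show k ≤ m by omega)
    have hd : d ∈ Finset.Ico Δ n := Finset.mem_Ico.2 ⟨by omega, by omega⟩
    have hdn : d < n := by omega
    have h0n : 0 < n := by omega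
    have e1 : Transformer.Source.pos k =
      (Transformer.Source.pos 0 : Transformer.Source A M.T.depth M.T.dff).shift k k := by
        simp [Transformer.Source.shift]
    have e2 : Transformer.Source.pos (k + d) =
      (Transformer.Source.pos d : Transformer.Source A M.T.depth M.T.dff).shift k k := by
        simp [Transformer.Source.shift, add_comm]
    have e3 : (Symb.ext k : Symb A) = (Symb.ext 0).shift k := by simp [Symb.shift]
    have e4 : Transformer.Source.sym (.ext (k + d)) =
      (Transformer.Source.sym (.ext d) : Transformer.Source A M.T.depth M.T.dff).shift k k := by
        simp [Transformer.Source.shift, Symb.shift, add_comm]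
    have e5 : Transformer.Source.sym (.ext k) =
      (Transformer.Source.sym (.ext 0) : Transformer.Source A M.T.depth M.T.dff).shift k k := by
        simp [Transformer.Source.shift, Symb.shift]
    refine ⟨fun l j S₁ S₂ => ?_, fun S => ?_⟩
    · obtain ⟨b1, b2, b3, b4⟩ := M.attn_le_zetaOn _ l j S₁ S₂ hd
      constructor
      · have := M.invariant.1 l j S₁ S₂ k k (.pos 0) (.pos d) (vp h0n) (vp hdn)
          (e1 ▸ vp hk) (e2 ▸ vp hm)
        rw [e1, e2, this]
        exact zero _ (h.prodAttn_prec l j S₁ S₂ (vp h0n) (vp hdn)) b1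
      · have := M.invariant.1 l j S₁ S₂ k k (.sym (.ext 0)) (.sym (.ext d)) (vs' h0n) (vs' hdn)
          (e5 ▸ vs' hk) (e4 ▸ vs' hm)
        rw [e4, e5, this]
        exact zero _ (h.prodAttn_prec l j S₁ S₂ (vs' h0n) (vs' hdn)) b3
    · obtain ⟨b1, b2⟩ := M.unembed_le_zetaOn _ S hd
      have := M.invariant.2.1 S k k (.ext 0) (.sym (.ext d)) (vs h0n) (vs' hdn)
          (e3 ▸ vs hk) (e4 ▸ vs' hm)
      rw [e3, e4, this]
      exact zero _ (h.prodUnembed_prec S (vs h0n) (vs' hdn)) b1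
  · obtain ⟨d, rfl⟩ := Nat.exists_eq_add_of_le (show m ≤ k by omega)
    have hd : d ∈ Finset.Ico Δ n := Finset.mem_Ico.2 ⟨by omega, by omega⟩
    have hdn : d < n := by omega
    have h0n : 0 < n := by omega
    have e1 : Transformer.Source.pos m =
      (Transformer.Source.pos 0 : Transformer.Source A M.T.depth M.T.dff).shift m m := by
        simp [Transformer.Source.shift]
    have e2 : Transformer.Source.pos (m + d) =
      (Transformer.Source.pos d : Transformer.Source A M.T.depth M.T.dff).shift m m := by
        simp [Transformer.Source.shift, add_comm]
    have e3 : (Symb.ext (m + d) : Symb A) = (Symb.ext d).shift m := by simp [Symb.shift, add_comm]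
    have e4 : Transformer.Source.sym (.ext (m + d)) =
      (Transformer.Source.sym (.ext d) : Transformer.Source A M.T.depth M.T.dff).shift m m := by
        simp [Transformer.Source.shift, Symb.shift, add_comm]
    have e5 : Transformer.Source.sym (.ext m) =
      (Transformer.Source.sym (.ext 0) : Transformer.Source A M.T.depth M.T.dff).shift m m := by
        simp [Transformer.Source.shift, Symb.shift]
    refine ⟨fun l j S₁ S₂ => ?_, fun S => ?_⟩
    · obtain ⟨b1, b2, b3, b4⟩ := M.attn_le_zetaOn _ l j S₁ S₂ hd
      constructor
      · have := M.invariant.1 l j S₁ S₂ m m (.pos d) (.pos 0) (vp hdn) (vp h0n)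
          (e2 ▸ vp hk) (e1 ▸ vp hm)
        rw [e1, e2, this]
        exact zero _ (h.prodAttn_prec l j S₁ S₂ (vp hdn) (vp h0n)) b2
      · have := M.invariant.1 l j S₁ S₂ m m (.sym (.ext d)) (.sym (.ext 0)) (vs' hdn) (vs' h0n)
          (e4 ▸ vs' hk) (e5 ▸ vs' hm)
        rw [e4, e5, this]
        exact zero _ (h.prodAttn_prec l j S₁ S₂ (vs' hdn) (vs' h0n)) b4
    · obtain ⟨b1, b2⟩ := M.unembed_le_zetaOn _ S hd
      have := M.invariant.2.1 S m m (.ext d) (.sym (.ext 0)) (vs hdn) (vs' h0n)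
          (e3 ▸ vs hk) (e5 ▸ vs' hm)
      rw [e3, e5, this]
      exact zero _ (h.prodUnembed_prec S (vs hdn) (vs' h0n)) b2

/-! ## Bounding the number of hidden units -/

/-- The indices with `P` are enumerated first and the remaining places stay empty. The target monoid
is arbitrary because the same enumeration serves sums of vectors and sums of squared norms. -/
theorem exists_reindex {N F : ℕ} (P : Fin N → Prop) [DecidablePred P]
    (hF : (Finset.univ.filter P).card ≤ F) :
    ∃ en : Fin F → Option (Fin N), ∀ {X : Type*} [AddCommMonoid X] (φ : Fin N → X),
      (∀ s, ¬ P s → φ s = 0) → ∑ r, (en r).elim 0 φ = ∑ s, φ s := by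
  set e := (Finset.univ.filter P).equivFin
  refine ⟨fun r => if h : (r : ℕ) < (Finset.univ.filter P).card then some (e.symm ⟨r, h⟩).1
    else none, fun {X} _ φ hφ => ?_⟩
  have h1 : ∑ s, φ s = ∑ s ∈ Finset.univ.filter P, φ s :=
    (Finset.sum_filter_of_ne fun s _ hs => by_contra fun h => hs (hφ s h)).symm
  rw [h1, ← Finset.sum_coe_sort (Finset.univ.filter P) φ, ← e.symm.sum_comp (fun i => φ i.1)]
  symm
  refine Fintype.sum_of_injective (Fin.castLE hF) (Fin.castLE_injective hF) _ _ ?_ ?_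
  · intro r hr
    have : ¬ (r : ℕ) < (Finset.univ.filter P).card := fun h => hr ⟨⟨r, h⟩, rfl⟩
    simp [this]
  · intro r
    simp

namespace Transformer

variable {A : Type*} {H : Type*} [NormedAddCommGroup H] [InnerProductSpace ℝ H]

/-- Replaces the hidden units of `T` by a re-indexed family; missing units are zero. -/
noncomputable abbrev reindexUnits (T : Transformer A H) {F : ℕ}
    (en : Fin T.depth → Fin F → Option (Fin T.dff)) : Transformer A H where
  depth := T.depth
  heads := T.heads
  dff := F
  roundPrec := T.roundPrec
  pos := T.pos
  E := T.E
  K := T.K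
  Q := T.Q
  V := T.V
  Ain l r := (en l r).elim 0 (T.Ain l)
  b l r := (en l r).elim 0 (T.b l)
  Bout l r := (en l r).elim 0 (T.Bout l)
  act l r := (en l r).elim .relu (T.act l)
  U := T.U

variable (T : Transformer A H) {F : ℕ} (en : Fin T.depth → Fin F → Option (Fin T.dff))

theorem pathProdTo_reindexUnits (S : T.Path) (l : ℕ) :
    (T.reindexUnits en).pathProdTo S l = T.pathProdTo S l := by
  induction l with
  | zero => rfl
  | succ l ih =>
    by_cases hl : l < T.depth
    · cases hS : S ⟨l, hl⟩ with
      | none =>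
        rw [pathProdTo_succ_none (T.reindexUnits en) S l fun _ => hS,
          pathProdTo_succ_none T S l fun _ => hS, ih]
      | some h =>
        rw [pathProdTo_succ_some (T.reindexUnits en) S hl hS, pathProdTo_succ_some T S hl hS, ih]
    · simp only [pathProdTo, hl, dif_neg, not_false_eq_true, ih]

/-- The source of `T` that a source of the re-indexed transformer stands for, if any. -/
def unindex {L h F : ℕ} (en : Fin L → Fin F → Option (Fin h)) :
    Source A L F → Option (Source A L h)
  | .pos t => some (.pos t)
  | .sym ω => some (.sym ω)
  | .mlp l r => (en l r).map (.mlp l)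

theorem source_reindexUnits (v : Source A T.depth F) :
    (T.reindexUnits en).source v = (unindex en v).elim 0 T.source := by
  cases v with
  | mlp l r => cases h : en l r <;> simp [source, unindex, h]
  | _ => rfl

theorem unindex_shift {L h F : ℕ} (en : Fin L → Fin F → Option (Fin h)) (a b : ℕ)
    (v : Source A L F) : unindex en (v.shift a b) = (unindex en v).map (Source.shift a b) := by
  cases v with
  | mlp l r => cases h : en l r <;> simp [Source.shift, unindex, h]
  | _ => rfl

theorem Source.Valid.unindex {L h F : ℕ} {en : Fin L → Fin F → Option (Fin h)} {N : ℕ∞}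
    {v : Source A L F} (hv : v.Valid N) {u : Source A L h} (hu : unindex en v = some u) :
    u.Valid N := by
  cases v with
  | mlp l r =>
    obtain ⟨s, -, rfl⟩ := Option.map_eq_some_iff.1 hu
    trivial
  | _ => cases hu; exact hv

/-- A padded unit contributes products equal to zero, which are trivially invariant; all other
products are those of `T`. -/
theorem translationInvariant_reindexUnits {N : ℕ∞} (hT : T.TranslationInvariant N) :
    (T.reindexUnits en).TranslationInvariant N := by
  have path : ∀ (S : T.Path) (v : Source A T.depth F),
      (T.reindexUnits en).pathProd S ((T.reindexUnits en).source v) =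
      T.pathProd S ((unindex en v).elim 0 T.source) := fun S v => by
    rw [source_reindexUnits, pathProd, pathProd, pathProdTo_reindexUnits]
  refine ⟨fun l h S₁ S₂ a b v w hv hw hv' hw' => ?_, fun S a b ω w hω hw hω' hw' => ?_,
    fun S l s a b w hw hw' => ?_⟩
  · have e1 := unindex_shift en a b v
    have e2 := unindex_shift en a b w
    unfold prodAttn
    rw [path, path, path, path, e1, e2]
    cases h1 : unindex en v with
    | none => simp
    | some v₁ =>
      cases h2 : unindex en w with
      | none => simp
      | some w₁ =>
        rw [h1] at e1
        rw [h2] at e2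
        exact hT.1 l h S₁ S₂ a b v₁ w₁ (hv.unindex h1) (hw.unindex h2) (hv'.unindex e1)
          (hw'.unindex e2)
  · have e2 := unindex_shift en a b w
    unfold prodUnembed
    rw [path, path, e2]
    cases h2 : unindex en w with
    | none => simp
    | some w₁ =>
      rw [h2] at e2
      exact hT.2.1 S a b ω w₁ hω (hw.unindex h2) hω' (hw'.unindex e2)
  · have e2 := unindex_shift en a b w
    have e3 : (T.reindexUnits en).Ain l s = (en l s).elim 0 (T.Ain l) := rfl
    unfold prodMlp
    rw [path, path, e2, e3]
    cases h1 : en l s with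
    | none => simp
    | some s₁ =>
      cases h2 : unindex en w with
      | none => simp
      | some w₁ =>
        rw [h2] at e2
        exact hT.2.2 S l s₁ a b w₁ (hw.unindex h2) (hw'.unindex e2)

theorem output_reindexUnits
    (hen : ∀ l, ∀ φ : Fin T.dff → H, (∀ s, T.Bout l s = 0 → φ s = 0) →
      ∑ r, (en l r).elim 0 φ = ∑ s, φ s) (ε : ℝ) (x : List (Symb A)) (op oc : ℕ) :
    (T.reindexUnits en).output ε x op oc = T.output ε x op oc := by
  have key : ∀ l, (T.reindexUnits en).state ε x op oc l = T.state ε x op oc l := by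
    intro l
    induction l with
    | zero => rfl
    | succ l ih =>
      by_cases hl : l < T.depth
      · have hl' : l < (T.reindexUnits en).depth := hl
        simp only [state, hl, dif_pos, ih]
        funext i
        have h1 : (T.reindexUnits en).attnBlock x.length ⟨l, hl'⟩ (T.state ε x op oc l) i =
          T.attnBlock x.length ⟨l, hl⟩ (T.state ε x op oc l) i := rfl
        rw [h1]
        generalize T.attnBlock x.length ⟨l, hl⟩ (T.state ε x op oc l) i = v
        unfold mlpBlock
        congr 1
        rw [← hen ⟨l, hl⟩ _ fun s hs => by rw [hs, smul_zero]]
        refine Finset.sum_congr rfl fun r _ => ?_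
        simp only
        cases en ⟨l, hl⟩ r <;> simp
      · simp only [state, hl, dif_neg, not_false_eq_true, ih]
  funext i ω
  have := key T.depth
  unfold output
  rw [← this]

end Transformer

namespace Hypothesis

open Transformer

variable {A : Type*} {n R : ℕ}

/-- The re-indexed hypothesis. -/
noncomputable def reindexUnits (M : Hypothesis A n) {F : ℕ}
    (en : Fin M.T.depth → Fin F → Option (Fin M.T.dff)) : Hypothesis A n where
  d := M.d
  p := M.p
  T := M.T.reindexUnits en
  pos_prec := M.pos_prec
  E_prec := M.E_prec
  K_prec := M.K_prec
  Q_prec := M.Q_prec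
  V_prec := M.V_prec
  A_prec l s c := by
    cases h : en l s
    · simpa [Transformer.reindexUnits, h] using IsDyadic.zero _
    · simpa [Transformer.reindexUnits, h] using M.A_prec l _ c
  b_prec l s := by
    cases h : en l s
    · simpa [Transformer.reindexUnits, h] using IsDyadic.zero _
    · simpa [Transformer.reindexUnits, h] using M.b_prec l _
  B_prec l s c := by
    cases h : en l s
    · simpa [Transformer.reindexUnits, h] using IsDyadic.zero _
    · simpa [Transformer.reindexUnits, h] using M.B_prec l _ c
  U_prec := M.U_prec
  invariant := M.T.translationInvariant_reindexUnits en M.invariant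

/-- A bound on the number of hidden units that write something. -/
def unitBound (R : ℕ) : ℕ := R ^ 2 * 4 ^ R

/-- The regularizer does not mention the hidden width. But a nonzero column has an entry of size at
least 2⁻ᴿ, and the squared Frobenius norm is at most R², so at most R² · 4ᴿ columns are nonzero. -/
theorem RegBound.card_units {M : Hypothesis A n} (h : M.RegBound R) (l : Fin M.T.depth)
    [DecidablePred fun s => M.T.Bout l s ≠ 0] :
    (Finset.univ.filter fun s => M.T.Bout l s ≠ 0).card ≤ unitBound R := by
  have hp : M.p ≤ R := by exact_mod_cast h.p
  have low : ∀ s, M.T.Bout l s ≠ 0 → (1 / 2 ^ R : ℝ) ^ 2 ≤ ‖M.T.Bout l s‖ ^ 2 := by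
    intro s hs
    obtain ⟨c, hc⟩ : ∃ c, M.T.Bout l s c ≠ 0 := by
      by_contra hcon
      push Not at hcon
      exact hs (by ext c; simpa using hcon c)
    refine (((M.B_prec l s c).mono hp).sq_ge hc).trans ?_
    rw [EuclideanSpace.norm_sq_eq]
    refine le_trans (by simp) (Finset.single_le_sum (f := fun i => ‖M.T.Bout l s i‖ ^ 2)
      (fun _ _ => sq_nonneg _) (Finset.mem_univ c))
  have h1 : ((Finset.univ.filter fun s => M.T.Bout l s ≠ 0).card : ℝ) * (1 / 2 ^ R : ℝ) ^ 2 ≤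
      (R : ℝ) ^ 2 := by
    refine le_trans ?_ (h.Bout l)
    rw [← nsmul_eq_mul]
    refine (Finset.card_nsmul_le_sum _ (fun s => ‖M.T.Bout l s‖ ^ 2) _ fun s hs =>
      low s (Finset.mem_filter.1 hs).2).trans ?_
    exact Finset.sum_le_sum_of_subset_of_nonneg (Finset.filter_subset _ _) fun _ _ _ => sq_nonneg _
  rw [div_pow, one_pow, ← pow_mul, mul_one_div, div_le_iff₀ (by positivity)] at h1
  have h2 : ((2 : ℝ) ^ (R * 2)) = 4 ^ R := by rw [mul_comm, pow_mul]; norm_num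
  rw [h2] at h1
  unfold unitBound
  exact_mod_cast h1

/-- A normal form with a hidden width that depends on `R` only, so that profiles of transformers of
different context widths live in one finite type. -/
theorem exists_reindexUnits [Finite A] {M : Hypothesis A n} (h : M.RegBound R) :
    ∃ M' : Hypothesis A n, M'.RegBound R ∧ M'.T.dff = unitBound R ∧
      (∀ ε x op oc, M'.T.output ε x op oc = M.T.output ε x op oc) ∧
      ∀ Δ, M.T.IsLocalBelow n Δ → M'.T.IsLocalBelow n Δ := by
  classical
  have H := fun l => exists_reindex (fun s => M.T.Bout l s ≠ 0) (h.card_units l)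
  choose en hen using H
  have hR : (0 : ℝ) ≤ R := Nat.cast_nonneg R
  refine ⟨M.reindexUnits en, ?_, rfl, fun ε x op oc => M.T.output_reindexUnits en
    (fun l φ hφ => hen l φ fun s hs => hφ s (not_not.1 hs)) ε x op oc, fun Δ hloc => ?_⟩
  · refine ⟨h.depth, h.heads, h.p, h.roundPrec, h.KQ, h.V, fun l s => ?_, fun l => ?_, h.U, h.pos,
      h.E, fun l s => ?_⟩
    · change ‖(en l s).elim 0 (M.T.Ain l)‖ ≤ R
      cases en l s
      · simp
      · exact h.Ain l _
    · refine le_trans (le_of_eq ?_) (h.Bout l)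
      rw [← hen l (fun s => ‖M.T.Bout l s‖ ^ 2) fun s hs => by simp [not_not.1 hs]]
      refine Finset.sum_congr rfl fun r _ => ?_
      change ‖(en l r).elim 0 (M.T.Bout l)‖ ^ 2 = _
      cases en l r <;> simp
    · change |(en l s).elim 0 (M.T.b l)| ≤ R
      cases en l s
      · simp
      · exact h.b l _
  · intro k hk m hm hkm
    obtain ⟨h1, h2⟩ := hloc k hk m hm hkm
    have e := fun S => M.T.pathProdTo_reindexUnits en S M.T.depth
    refine ⟨fun l j S₁ S₂ => ?_, fun S => ?_⟩
    · have h3 := h1 l j S₁ S₂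
      simp only [prodAttn, pathProd] at h3 ⊢
      have e1 := e S₁
      have e2 := e S₂
      rw [← e1, ← e2] at h3
      exact h3
    · have h3 := h2 S
      simp only [prodUnembed, pathProd] at h3 ⊢
      have e1 := e S
      rw [← e1] at h3
      exact h3

end Hypothesis

namespace Transformer

variable {A : Type*}

/-! ## Finitely many types of transformers -/

/-- Sources with index below `N`. -/
abbrev SmallSource (A : Type*) (L F N : ℕ) := {v : Source A L F // v.Valid (N : ℕ∞)}

/-- Symbols with index below `N`. -/
abbrev SmallSymb (A : Type*) (N : ℕ) := {ω : Symb A // ω.Valid (N : ℕ∞)}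

instance finite_smallSource [Finite A] (L F N : ℕ) : Finite (SmallSource A L F N) := by
  let g : Fin N ⊕ SmallSymb A N ⊕ (Fin L × Fin F) → SmallSource A L F N := fun x =>
    match x with
    | .inl t => ⟨.pos t, by show ((t : ℕ) : ℕ∞) < N; exact_mod_cast t.2⟩
    | .inr (.inl ω) => ⟨.sym ω.1, ω.2⟩
    | .inr (.inr (l, s)) => ⟨.mlp l s, trivial⟩
  refine Finite.of_surjective g ?_
  rintro ⟨v, hv⟩
  cases v with
  | pos t =>
    have : t < N := by exact_mod_cast (show ((t : ℕ) : ℕ∞) < N from hv)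
    exact ⟨.inl ⟨t, this⟩, rfl⟩
  | sym ω => exact ⟨.inr (.inl ⟨ω, hv⟩), rfl⟩
  | mlp l s => exact ⟨.inr (.inr (l, s)), rfl⟩

instance finite_activation : Finite Activation := by
  refine Finite.of_surjective (fun i : Fin 3 => match i with
    | 0 => Activation.relu
    | 1 => Activation.heaviside
    | 2 => Activation.recip) ?_
  rintro (_ | _ | _)
  exacts [⟨0, rfl⟩, ⟨1, rfl⟩, ⟨2, rfl⟩]

/-- Everything about a transformer with `L` layers, `h` heads and `F` hidden units that determines
its outputs, up to translation invariance and locality: rounding precision, biases, activations,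
and the product functions at indices below `N`, all numbers being taken from `D`. -/
structure Profile (A : Type*) (R F N : ℕ) (D : Set ℝ) (L h : ℕ) where
  q : Fin (R + 1)
  b : Fin L → Fin F → D
  act : Fin L → Fin F → Activation
  attn : Fin L → Fin h → (Fin L → Option (Fin h)) → (Fin L → Option (Fin h)) →
    SmallSource A L F N → SmallSource A L F N → D
  unembed : (Fin L → Option (Fin h)) → SmallSymb A N → SmallSource A L F N → D
  mlp : (Fin L → Option (Fin h)) → Fin L → Fin F → SmallSource A L F N → D

set_option synthInstance.maxSize 2000 in
set_option synthInstance.maxHeartbeats 200000 in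
instance finite_profile [Finite A] (R F N : ℕ) (D : Set ℝ) [Finite D] (L h : ℕ) :
    Finite (Profile A R F N D L h) := by
  refine Finite.of_injective (β := Fin (R + 1) × (Fin L → Fin F → D) ×
    (Fin L → Fin F → Activation) ×
    (Fin L → Fin h → (Fin L → Option (Fin h)) → (Fin L → Option (Fin h)) →
      SmallSource A L F N → SmallSource A L F N → D) ×
    ((Fin L → Option (Fin h)) → SmallSymb A N → SmallSource A L F N → D) ×
    ((Fin L → Option (Fin h)) → Fin L → Fin F → SmallSource A L F N → D))
    (fun c => (c.q, c.b, c.act, c.attn, c.unembed, c.mlp)) ?_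
  rintro ⟨⟩ ⟨⟩ h
  simp only [Prod.mk.injEq] at h
  obtain ⟨rfl, rfl, rfl, rfl, rfl, rfl⟩ := h
  rfl

/-- Profiles of transformers with at most `R` layers and heads. -/
abbrev FullProfile (A : Type*) (R F N : ℕ) (D : Set ℝ) :=
  Σ Lh : Fin (R + 1) × Fin (R + 1), Profile A R F N D Lh.1 Lh.2

section

variable {H : Type*} [NormedAddCommGroup H] [InnerProductSpace ℝ H]
variable {H' : Type*} [NormedAddCommGroup H'] [InnerProductSpace ℝ H']

/-- `T` has the profile `c`. -/
def HasProfile {R F N : ℕ} {D : Set ℝ} (T : Transformer A H) (c : FullProfile A R F N D) : Prop :=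
  ∃ (pos : ℕ → H) (E : Symb A → H) (K Q V : Fin c.1.1 → Fin c.1.2 → H →L[ℝ] H)
    (Ain Bout : Fin c.1.1 → Fin F → H) (U : Symb A → H),
    let T' : Transformer A H := ⟨c.1.1, c.1.2, F, c.2.q, pos, E, K, Q, V, Ain,
      fun l s => c.2.b l s, Bout, c.2.act, U⟩
    T = T' ∧
    (∀ l h S₁ S₂ (v w : SmallSource A c.1.1 F N),
      T'.prodAttn l h S₁ S₂ v.1 w.1 = c.2.attn l h S₁ S₂ v w) ∧
    (∀ S (ω : SmallSymb A N) (w : SmallSource A c.1.1 F N),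
      T'.prodUnembed S ω.1 w.1 = c.2.unembed S ω w) ∧
    ∀ S l s (w : SmallSource A c.1.1 F N), T'.prodMlp S l s w.1 = c.2.mlp S l s w

theorem exists_hasProfile {R F N : ℕ} {D : Set ℝ} (T : Transformer A H) (hL : T.depth ≤ R)
    (hh : T.heads ≤ R) (hq : T.roundPrec ≤ R) (hF : T.dff = F) (hb : ∀ l s, T.b l s ∈ D)
    (hattn : ∀ l h S₁ S₂ v w, v.Valid (N : ℕ∞) → w.Valid (N : ℕ∞) → T.prodAttn l h S₁ S₂ v w ∈ D)
    (hun : ∀ S ω w, ω.Valid (N : ℕ∞) → w.Valid (N : ℕ∞) → T.prodUnembed S ω w ∈ D)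
    (hmlp : ∀ S l s w, w.Valid (N : ℕ∞) → T.prodMlp S l s w ∈ D) :
    ∃ c : FullProfile A R F N D, T.HasProfile c := by
  subst hF
  refine ⟨⟨(⟨T.depth, by omega⟩, ⟨T.heads, by omega⟩), ⟨⟨T.roundPrec, by omega⟩,
    fun l s => ⟨T.b l s, hb l s⟩, T.act,
    fun l h S₁ S₂ v w => ⟨T.prodAttn l h S₁ S₂ v.1 w.1, hattn l h S₁ S₂ _ _ v.2 w.2⟩,
    fun S ω w => ⟨T.prodUnembed S ω.1 w.1, hun S _ _ ω.2 w.2⟩,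
    fun S l s w => ⟨T.prodMlp S l s w.1, hmlp S l s _ w.2⟩⟩⟩,
    T.pos, T.E, T.K, T.Q, T.V, T.Ain, T.Bout, T.U, rfl, ?_, ?_, ?_⟩
  · intros; rfl
  · intros; rfl
  · intros; rfl

/-- A source that is moved by no shift. -/
def Source.Inert {L F : ℕ} (v : Source A L F) : Prop :=
  (∀ a b, v.shift a b = v) ∧ ∀ N, v.Valid N

theorem Source.cases_inert {L F : ℕ} (v : Source A L F) :
    v.Inert ∨ (∃ t, v = .pos t) ∨ ∃ k, v = .sym (.ext k) := by
  rcases v with t | (_ | σ | k) | ⟨l, s⟩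
  · exact .inr (.inl ⟨t, rfl⟩)
  · exact .inl ⟨fun _ _ => rfl, fun _ => trivial⟩
  · exact .inl ⟨fun _ _ => rfl, fun _ => trivial⟩
  · exact .inr (.inr ⟨k, rfl⟩)
  · exact .inl ⟨fun _ _ => rfl, fun _ => trivial⟩

/-- A position or an extended symbol is a shift of the one with index 0, and everything else is
fixed by shifts. -/
theorem Source.exists_small {L F : ℕ} (w : Source A L F) {Δ : ℕ} (hΔ : 0 < Δ) :
    ∃ (a b : ℕ) (w' : Source A L F), w'.Valid (Δ : ℕ∞) ∧ w = w'.shift a b := by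
  rcases w.cases_inert with hw | ⟨t, rfl⟩ | ⟨k, rfl⟩
  · exact ⟨0, 0, w, hw.2 _, (hw.1 _ _).symm⟩
  · exact ⟨t, 0, .pos 0, by show ((0 : ℕ) : ℕ∞) < Δ; exact_mod_cast hΔ, by simp [Source.shift]⟩
  · exact ⟨0, k, .sym (.ext 0), by show ((0 : ℕ) : ℕ∞) < Δ; exact_mod_cast hΔ,
      by simp [Source.shift, Symb.shift]⟩

/-- Positions and extended symbols shift independently, so a mixed pair can be brought to index 0 in
both components. Two indices of the same type can only be lowered by their minimum, which leaves
their distance: either it is below Δ, or locality applies. -/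
theorem Source.exists_small_pair {L F : ℕ} (v w : Source A L F) {Δ : ℕ} (hΔ : 0 < Δ) :
    (∃ (a b : ℕ) (v' w' : Source A L F), v'.Valid (Δ : ℕ∞) ∧ w'.Valid (Δ : ℕ∞) ∧ v = v'.shift a b ∧ w = w'.shift a b) ∨
    (∃ k m, (k + Δ ≤ m ∨ m + Δ ≤ k) ∧ v = .pos k ∧ w = .pos m) ∨
    ∃ k m, (k + Δ ≤ m ∨ m + Δ ≤ k) ∧ v = .sym (.ext k) ∧ w = .sym (.ext m) := by
  have vp : ∀ {k}, k < Δ → (Source.pos k : Source A L F).Valid (Δ : ℕ∞) := fun {k} hk => by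
    show ((k : ℕ) : ℕ∞) < Δ; exact_mod_cast hk
  have vs : ∀ {k}, k < Δ → (Source.sym (.ext k) : Source A L F).Valid (Δ : ℕ∞) := fun {k} hk => by
    show ((k : ℕ) : ℕ∞) < Δ; exact_mod_cast hk
  rcases v.cases_inert with hv | ⟨t, rfl⟩ | ⟨k, rfl⟩
  · obtain ⟨a, b, w', h1, h2⟩ := w.exists_small hΔ
    exact .inl ⟨a, b, v, w', hv.2 _, h1, (hv.1 _ _).symm, h2⟩
  · rcases w.cases_inert with hw | ⟨t', rfl⟩ | ⟨k, rfl⟩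
    · exact .inl ⟨t, 0, .pos 0, w, vp hΔ, hw.2 _, by simp [Source.shift], (hw.1 _ _).symm⟩
    · by_cases h : t + Δ ≤ t' ∨ t' + Δ ≤ t
      · exact .inr (.inl ⟨t, t', h, rfl, rfl⟩)
      · refine .inl ⟨min t t', 0, .pos (t - min t t'), .pos (t' - min t t'), vp (by omega),
          vp (by omega), ?_, ?_⟩ <;> simp only [Source.shift, Source.pos.injEq] <;> omega
    · exact .inl ⟨t, k, .pos 0, .sym (.ext 0), vp hΔ, vs hΔ, by simp [Source.shift],
        by simp [Source.shift, Symb.shift]⟩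
  · rcases w.cases_inert with hw | ⟨t, rfl⟩ | ⟨k', rfl⟩
    · exact .inl ⟨0, k, .sym (.ext 0), w, vs hΔ, hw.2 _, by simp [Source.shift, Symb.shift],
        (hw.1 _ _).symm⟩
    · exact .inl ⟨t, k, .sym (.ext 0), .pos 0, vs hΔ, vp hΔ, by simp [Source.shift, Symb.shift],
        by simp [Source.shift]⟩
    · by_cases h : k + Δ ≤ k' ∨ k' + Δ ≤ k
      · exact .inr (.inr ⟨k, k', h, rfl, rfl⟩)
      · refine .inl ⟨0, min k k', .sym (.ext (k - min k k')), .sym (.ext (k' - min k k')),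
          vs (by omega), vs (by omega), ?_, ?_⟩ <;>
          simp only [Source.shift, Symb.shift, Source.sym.injEq, Symb.ext.injEq] <;> omega

theorem Source.exists_small_symb {L F : ℕ} (ω : Symb A) (w : Source A L F) {Δ : ℕ} (hΔ : 0 < Δ) :
    (∃ (a b : ℕ) (ω' : Symb A) (w' : Source A L F), ω'.Valid (Δ : ℕ∞) ∧ w'.Valid (Δ : ℕ∞) ∧ ω = ω'.shift b ∧ w = w'.shift a b) ∨
    ∃ k m, (k + Δ ≤ m ∨ m + Δ ≤ k) ∧ ω = .ext k ∧ w = .sym (.ext m) := by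
  rcases Source.exists_small_pair (L := L) (F := F) (.sym ω) w hΔ with
    ⟨a, b, v', w', h1, h2, h3, h4⟩ | ⟨k, m, _, h, _⟩ | ⟨k, m, h1, h2, h3⟩
  · cases v' with
    | sym ω' => exact .inl ⟨a, b, ω', w', h1, h2, by simpa [Source.shift] using h3, h4⟩
    | _ => simp [Source.shift] at h3
  · simp at h
  · exact .inr ⟨k, m, h1, by simpa using h2, h3⟩

/-- Two translation-invariant, local transformers with the same profile compute the same outputs,
up to offsets. -/
theorem output_eq_of_hasProfile {R F Δ n n' : ℕ} {D : Set ℝ} {T : Transformer A H}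
    {T' : Transformer A H'} {c : FullProfile A R F Δ D} (hc : T.HasProfile c)
    (hc' : T'.HasProfile c) (hT : T.TranslationInvariant n) (hT' : T'.TranslationInvariant n')
    (hl : T.IsLocalBelow n Δ) (hl' : T'.IsLocalBelow n' Δ) (hΔ : 0 < Δ) (hn : Δ ≤ n)
    (hn' : Δ ≤ n') (ε : ℝ) (x : List (Symb A)) (op oc : ℕ) (ω : Symb A)
    (hpos : x.length + op ≤ n) (hpos' : x.length ≤ n')
    (hsym : ∀ i < x.length, ((x.getD i Symb.start).shift oc).Valid n)
    (hsym' : ∀ i < x.length, (x.getD i Symb.start).Valid n')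
    (hω : (ω.shift oc).Valid n) (hω' : ω.Valid n') (i : ℕ) (hi : i < x.length) :
    T.output ε x op oc i (ω.shift oc) = T'.output ε x 0 0 i ω := by
  -- After both substitutions the transformers share depth, heads, hidden width, rounding, biases
  -- and activations definitionally, so one is a `refill` of the other.
  obtain ⟨pos, E, K, Q, V, Ain, Bout, U, rfl, hA, hU, hM⟩ := hc
  obtain ⟨pos', E', K', Q', V', Ain', Bout', U', rfl, hA', hU', hM'⟩ := hc'
  have hnE : (Δ : ℕ∞) ≤ n := by exact_mod_cast hn
  have hnE' : (Δ : ℕ∞) ≤ n' := by exact_mod_cast hn'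
  have lt : ∀ {a b : ℕ}, (a : ℕ∞) < b → a < b := fun h => by exact_mod_cast h
  refine output_eq_output_refill _ ε x op oc
    -- The sources that exist at width n after the offsets and at width n' without them.
    {v | (v.shift op oc).Valid n ∧ v.Valid n'} ?_ ?_ ?_ ?_ ?_ ω ?_ i hi
  · intro i hi
    constructor
    · show ((i + op : ℕ) : ℕ∞) < n
      exact_mod_cast (by omega : i + op < n)
    · show ((i : ℕ) : ℕ∞) < n'
      exact_mod_cast (by omega : i < n')
  · exact fun i hi => ⟨hsym i hi, hsym' i hi⟩
  · exact fun l s => ⟨trivial, trivial⟩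
  · intro l h S₁ S₂ v hv w hw
    rw [hT.1 l h S₁ S₂ op oc v w (Source.valid_of_shift hv.1) (Source.valid_of_shift hw.1) hv.1
      hw.1]
    have hv1 := Source.valid_of_shift hv.1
    have hw1 := Source.valid_of_shift hw.1
    rcases Source.exists_small_pair v w hΔ with
      ⟨a, b, v', w', h1, h2, rfl, rfl⟩ | ⟨k, m, hkm, rfl, rfl⟩ | ⟨k, m, hkm, rfl, rfl⟩
    · rw [hT.1 l h S₁ S₂ a b v' w' (h1.mono hnE) (h2.mono hnE) hv1 hw1]
      have e := hT'.1 l h S₁ S₂ a b v' w' (h1.mono hnE') (h2.mono hnE') hv.2 hw.2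
      exact ((hA l h S₁ S₂ ⟨v', h1⟩ ⟨w', h2⟩).trans (hA' l h S₁ S₂ ⟨v', h1⟩ ⟨w', h2⟩).symm).trans
        e.symm
    · exact (((hl k (lt hv1) m (lt hw1) hkm).1 l h S₁ S₂).1).trans
        (((hl' k (lt hv.2) m (lt hw.2) hkm).1 l h S₁ S₂).1).symm
    · exact (((hl k (lt hv1) m (lt hw1) hkm).1 l h S₁ S₂).2).trans
        (((hl' k (lt hv.2) m (lt hw.2) hkm).1 l h S₁ S₂).2).symm
  · intro S l s w hw
    have hw1 := Source.valid_of_shift hw.1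
    rw [hT.2.2 S l s op oc w hw1 hw.1]
    obtain ⟨a, b, w', h2, rfl⟩ := w.exists_small hΔ
    rw [hT.2.2 S l s a b w' (h2.mono hnE) hw1]
    have e := hT'.2.2 S l s a b w' (h2.mono hnE') hw.2
    exact ((hM S l s ⟨w', h2⟩).trans (hM' S l s ⟨w', h2⟩).symm).trans e.symm
  · intro S w hw
    have hw1 := Source.valid_of_shift hw.1
    have hω1 := Symb.valid_of_shift hω
    rw [hT.2.1 S op oc ω w hω1 hw1 hω hw.1]
    rcases Source.exists_small_symb ω w hΔ with
      ⟨a, b, ω', w', h1, h2, rfl, rfl⟩ | ⟨k, m, hkm, rfl, rfl⟩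
    · rw [hT.2.1 S a b ω' w' (h1.mono hnE) (h2.mono hnE) hω1 hw1]
      have e := hT'.2.1 S a b ω' w' (h1.mono hnE') (h2.mono hnE') hω' hw.2
      exact ((hU S ⟨ω', h1⟩ ⟨w', h2⟩).trans (hU' S ⟨ω', h1⟩ ⟨w', h2⟩).symm).trans e.symm
    · exact ((hl k (lt hω1) m (lt hw1) hkm).2 S).trans
        ((hl' k (lt hω') m (lt hw.2) hkm).2 S).symm

end

end Transformer

/-! ## Length generalization from bounded regularizers -/

/-- Finitely many values have finite fibres, so only finitely many indices carry a value that is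
attained finitely often. -/
theorem exists_recurrent {α : Type*} [Finite α] (c : ℕ → α) :
    ∃ N₀, ∀ m > N₀, ∀ N, ∃ n ≥ N, c n = c m := by
  have h1 : {n | (c ⁻¹' {c n}).Finite}.Finite := by
    refine (Set.Finite.biUnion (Set.toFinite {v | (c ⁻¹' {v}).Finite}) fun v hv => hv).subset ?_
    intro n hn
    exact Set.mem_biUnion (show c n ∈ {v | (c ⁻¹' {v}).Finite} from hn) rfl
  obtain ⟨N₀, hN₀⟩ := h1.bddAbove
  refine ⟨N₀, fun m hm N => ?_⟩
  by_contra hcon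
  push Not at hcon
  have : m ∈ {n | (c ⁻¹' {c n}).Finite} :=
    (Set.finite_lt_nat N).subset fun n hn => by
      by_contra h
      exact hcon n (not_lt.1 h) hn
  exact absurd (hN₀ this) (not_le.2 hm)

theorem inputOf_length {A : Type*} (w : Word A) : (inputOf w).length = w.length + 1 := by
  simp [inputOf]

theorem valid_shift_getD_inputOf {A : Type*} {n oc : ℕ} (w : Word A)
    (h : ∀ k, Sum.inr k ∈ w → k + oc < n) (i : ℕ) :
    (((inputOf w).getD i Symb.start).shift oc).Valid (n : ℕ∞) := by
  cases i with
  | zero => trivial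
  | succ i =>
    simp only [inputOf, List.getD_eq_getElem?_getD, List.getElem?_cons_succ, List.getElem?_map]
    cases hw : w[i]? with
    | none => trivial
    | some a =>
      have hmem := List.mem_of_getElem? hw
      cases a with
      | inl σ => trivial
      | inr k =>
        show ((k + oc : ℕ) : ℕ∞) < n
        exact_mod_cast h k hmem

namespace Hypothesis

open Transformer

variable {A : Type*}

theorem RegBound.exists_hasProfile {n R F Δ : ℕ} {M : Hypothesis A n} (hR : 1 ≤ R)
    (h : M.RegBound R) (hF : M.T.dff = F) (hn : Δ ≤ n) :
    ∃ c : FullProfile A R F Δ {x : ℝ | IsDyadic (prodPrec R) x ∧ |x| ≤ prodBound R},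
      M.T.HasProfile c := by
  have hnE : (Δ : ℕ∞) ≤ n := by exact_mod_cast hn
  have hp : M.p ≤ R := by exact_mod_cast h.p
  have hR' : (1 : ℝ) ≤ R := by exact_mod_cast hR
  refine Transformer.exists_hasProfile M.T (by exact_mod_cast h.depth)
    (by exact_mod_cast h.heads) (by exact_mod_cast h.roundPrec) hF (fun l s => ⟨?_, ?_⟩)
    (fun l k S₁ S₂ v w hv hw => ⟨h.prodAttn_prec l k S₁ S₂ (hv.mono hnE) (hw.mono hnE),
      h.prodAttn_le hR l k S₁ S₂ (hv.mono hnE) (hw.mono hnE)⟩)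
    (fun S ω w hω hw => ⟨h.prodUnembed_prec S (hω.mono hnE) (hw.mono hnE),
      h.prodUnembed_le hR S (hω.mono hnE) (hw.mono hnE)⟩)
    (fun S l s w hw => ⟨h.prodMlp_prec S l s (hw.mono hnE), h.prodMlp_le hR S l s (hw.mono hnE)⟩)
  · refine (M.b_prec l s).mono ?_
    unfold prodPrec
    nlinarith
  · refine (h.b l s).trans ?_
    unfold prodBound
    calc (R : ℝ) ≤ ((R : ℝ) + 1) ^ 1 := by linarith
      _ ≤ _ := pow_le_pow_right₀ (by linarith) (by omega)

/-- The compactness argument: bounded and monotone infima force common locality, locality leaves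
finitely many profiles, and a recurrent profile transfers correctness from a large width at which
the input is fitted. -/
theorem lengthGeneralizes_of_bounded [Finite A] {ε : ℝ} {C : ∀ n, Hypothesis A n → Prop}
    {f : Word A → ℕ → Symb A → ℝ}
    (hC : ∀ {m n} (hmn : m ≤ n) (M : Hypothesis A n), C n M → C m (M.restrict hmn)) {R₀ : ℝ}
    (hex : ∀ n ≥ 1, ∃ M : Hypothesis A n, C n M ∧ M.Fits ε f ∧ M.reg ≤ R₀) :
    LengthGeneralizes ε C f := by
  set I : ℕ → ℝ := fun n =>
    sInf {r | ∃ M' : Hypothesis A n, C n M' ∧ M'.Fits ε f ∧ r = M'.reg} with hI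
  have bdd : ∀ n, BddBelow {r | ∃ M' : Hypothesis A n, C n M' ∧ M'.Fits ε f ∧ r = M'.reg} :=
    fun n => ⟨0, by rintro _ ⟨M', -, -, rfl⟩; exact M'.reg_nonneg⟩
  have I_le : ∀ n (M : Hypothesis A n), C n M → M.Fits ε f → I n ≤ M.reg := fun n M h1 h2 =>
    csInf_le (bdd n) ⟨M, h1, h2, rfl⟩
  have ne : ∀ n ≥ 1, {r | ∃ M' : Hypothesis A n, C n M' ∧ M'.Fits ε f ∧ r = M'.reg}.Nonempty :=
    fun n hn => by
      obtain ⟨M, h1, h2, -⟩ := hex n hn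
      exact ⟨_, M, h1, h2, rfl⟩
  have I_bd : ∀ n ≥ 1, I n ≤ R₀ := fun n hn => by
    obtain ⟨M, h1, h2, h3⟩ := hex n hn
    exact (I_le n M h1 h2).trans h3
  -- Restriction turns every competitor at width n into one at width m that is no more expensive.
  have I_mono : ∀ m n, 1 ≤ m → m ≤ n → I m ≤ I n := fun m n hm hmn =>
    le_csInf (ne n (hm.trans hmn)) <| by
      rintro _ ⟨M', h1, h2, rfl⟩
      refine (I_le m (M'.restrict hmn) (hC hmn M' h1) (h2.restrict hmn)).trans ?_
      have := M'.reg_restrict_add_le hm hmn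
      have := M'.zetaOn_nonneg (Finset.Ico m n)
      linarith
  refine ⟨?_, fun M hM => ?_⟩
  · have : ∀ n, ∃ M : Hypothesis A n, 1 ≤ n → C n M ∧ M.Fits ε f ∧ M.reg ≤ 1 / (n : ℝ) + I n := by
      intro n
      rcases Nat.eq_zero_or_pos n with rfl | hn
      -- Nothing is demanded at width 0, so any value will do there.
      · obtain ⟨M, -⟩ := hex 1 le_rfl
        exact ⟨M.restrict (by omega), fun h => by omega⟩
      · have hpos : (0 : ℝ) < 1 / n := by positivity
        obtain ⟨_, ⟨M, h1, h2, rfl⟩, hlt⟩ := Real.lt_sInf_add_pos (ne n hn) hpos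
        exact ⟨M, fun _ => ⟨h1, h2, by rw [add_comm]; exact hlt.le⟩⟩
    choose M hM using this
    exact ⟨M, fun n hn => hM n hn⟩
  · have regle : ∀ n ≥ 1, (M n).reg ≤ 1 + R₀ := fun n hn => by
      have h1 := (hM n hn).2.2
      have h2 := I_bd n hn
      have h3 : 1 / (n : ℝ) ≤ 1 := by
        rw [div_le_one (by positivity)]
        exact_mod_cast hn
      linarith
    refine ⟨⟨1 + R₀, regle⟩, ?_⟩
    obtain ⟨R, hR⟩ := exists_nat_ge (max 1 (1 + R₀))
    have hR1 : 1 ≤ R := by exact_mod_cast (le_max_left _ _).trans hR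
    have rb : ∀ n ≥ 1, (M n).RegBound R := fun n hn =>
      regBound ((regle n hn).trans ((le_max_right _ _).trans hR))
    -- The least possible square of a nonzero product function.
    set g : ℝ := (1 / 2 ^ prodPrec R : ℝ) ^ 2 with hg
    have hgpos : 0 < g := by positivity
    have bddI : BddAbove (I '' Set.Ici 1) := ⟨R₀, by rintro _ ⟨n, hn, rfl⟩; exact I_bd n hn⟩
    -- From m₁ on the infimum is within g / 2 of its supremum; from m₂ on the tolerance 1 / n of the
    -- inference procedure is below g / 2.
    obtain ⟨_, ⟨m₁, hm₁, rfl⟩, hlt⟩ := exists_lt_of_lt_csSup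
      (show (I '' Set.Ici 1).Nonempty from ⟨_, 1, Set.mem_Ici.2 le_rfl, rfl⟩)
      (show sSup (I '' Set.Ici 1) - g / 2 < sSup (I '' Set.Ici 1) by linarith)
    obtain ⟨m₂, hm₂⟩ := exists_nat_gt (2 / g)
    set Δ := max m₁ m₂ with hΔ
    have hm₁' : 1 ≤ m₁ := hm₁
    have hΔ1 : 1 ≤ Δ := hm₁'.trans (le_max_left _ _)
    have loc : ∀ n ≥ Δ, (M n).T.IsLocalBelow n Δ := by
      intro n hn
      have hn1 : 1 ≤ n := hΔ1.trans hn
      -- The tail penalty is at most 1 / n + I n - I Δ, since the restriction to width Δ costs at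
      -- least I Δ; this is less than g / 2 + g / 2.
      refine (rb n hn1).isLocalBelow ?_
      have h1 := (M n).reg_restrict_add_le hΔ1 hn
      have h2 := I_le Δ _ (hC hn _ (hM n hn1).1) ((hM n hn1).2.1.restrict hn)
      have h3 := (hM n hn1).2.2
      have h4 := I_mono m₁ Δ hm₁ (le_max_left _ _)
      have h5 : I n ≤ sSup (I '' Set.Ici 1) := le_csSup bddI ⟨n, hn1, rfl⟩
      have h6 : 1 / (n : ℝ) < g / 2 := by
        rw [div_lt_iff₀ hgpos] at hm₂
        rw [div_lt_iff₀ (by positivity)]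
        have : (m₂ : ℝ) ≤ n := by exact_mod_cast (le_max_right m₁ m₂).trans hn
        nlinarith
      change (M n).reg ≤ 1 / (n : ℝ) + I n at h3
      linarith
    -- Only widths of the form Δ + k matter; there each hypothesis is replaced by one in normal form
    -- with the same outputs.
    have norm : ∀ k : ℕ, ∃ M' : Hypothesis A (Δ + k), M'.RegBound R ∧ M'.T.dff = unitBound R ∧
        (∀ ε x op oc, M'.T.output ε x op oc = (M (Δ + k)).T.output ε x op oc) ∧
        M'.T.IsLocalBelow (Δ + k) Δ := fun k => by
      obtain ⟨M', h1, h2, h3, h4⟩ := exists_reindexUnits (rb (Δ + k) (by omega))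
      exact ⟨M', h1, h2, h3, h4 Δ (loc _ (by omega))⟩
    choose M' hM' hunit hout hloc using norm
    have prof := fun k => (hM' k).exists_hasProfile hR1 (hunit k) (Nat.le_add_right Δ k)
    choose c hc using prof
    have : Finite {x : ℝ | IsDyadic (prodPrec R) x ∧ |x| ≤ prodBound R} := IsDyadic.finite_le _ _
    obtain ⟨N₀, hN₀⟩ := exists_recurrent c
    refine ⟨Δ + N₀, fun m hm w hw op oc hop hoc i hi ω hω => ?_⟩
    obtain ⟨k, rfl⟩ := Nat.exists_eq_add_of_le (show Δ ≤ m by omega)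
    obtain ⟨B, hB⟩ : ∃ B, ∀ k, Sum.inr k ∈ w → k < B := by
      have hfin : {k | (Sum.inr k : A ⊕ ℕ) ∈ w}.Finite :=
        ((w.finite_toSet).preimage Sum.inr_injective.injOn)
      obtain ⟨B, hB⟩ := hfin.bddAbove
      exact ⟨B + 1, fun k hk => Nat.lt_succ_of_le (hB hk)⟩
    obtain ⟨W, hW⟩ : ∃ W : ℕ, ∀ n : ℕ, W ≤ n → ω.Valid (n : ℕ∞) := by
      cases ω with
      | ext k =>
        refine ⟨k + 1, fun n hn => ?_⟩
        show (k : ℕ∞) < n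
        exact_mod_cast hn
      | _ => exact ⟨0, fun _ _ => trivial⟩
    -- A larger width with the same profile: large enough that `w` and the span of its symbols fit
    -- into half of the context, and that `ω` exists there.
    obtain ⟨k', hk', hcc⟩ := hN₀ k (by omega) (2 * (w.length + 1) + 2 * B + W)
    have e1 : (M' k').T.output ε (inputOf w) 0 0 i ω = f w i ω := by
      have h1 := (hM (Δ + k') (by omega)).2.1 w (by omega)
        (fun a b ha hb => by have := hB a ha; omega) 0 0 (by omega)
        (fun a ha => by have := hB a ha; omega) i hi ω
      rw [Symb.shift_zero] at h1
      rw [hout]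
      exact h1 (hW _ (by omega))
    rw [← e1, ← hout]
    have hlen := inputOf_length w
    refine output_eq_of_hasProfile (hc k) (hcc ▸ hc k') (M' k).invariant (M' k').invariant (hloc k)
      (hloc k') (by omega) (by omega) (by omega) ε _ op oc ω (by omega) (by omega)
      (fun i _ => valid_shift_getD_inputOf w hoc i) (fun i _ => ?_) hω (hW _ (by omega)) i
      (by omega)
    have := valid_shift_getD_inputOf (oc := 0) (n := Δ + k') w
      (fun a ha => by have := hB a ha; omega) i
    rwa [Symb.shift_zero] at this

end Hypothesis

/-! ## Finite-dimensional compressions of a limit transformer -/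

section Basis

variable {H : Type*} [NormedAddCommGroup H] [InnerProductSpace ℝ H]

/-- Finite integer combinations of a family of vectors. -/
abbrev intSpan {ι : Type*} (e : ι → H) : AddSubgroup H := AddSubgroup.closure (Set.range e)

theorem inner_intSpan {ι : Type*} {e : ι → H} (he : Orthonormal ℝ e) (i : ι) {x : H}
    (hx : x ∈ intSpan e) : ∃ z : ℤ, ⟪e i, x⟫_ℝ = z := by
  classical
  induction hx using AddSubgroup.closure_induction with
  | mem x hx =>
    obtain ⟨j, rfl⟩ := hx
    rw [orthonormal_iff_ite.1 he i j]
    split_ifs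
    · exact ⟨1, by simp⟩
    · exact ⟨0, by simp⟩
  | zero => exact ⟨0, by simp⟩
  | add x y _ _ hx hy =>
    obtain ⟨a, ha⟩ := hx
    obtain ⟨b, hb⟩ := hy
    exact ⟨a + b, by rw [inner_add_right, ha, hb]; push_cast; rfl⟩
  | neg x _ hx =>
    obtain ⟨a, ha⟩ := hx
    exact ⟨-a, by rw [inner_neg_right, ha]; push_cast; rfl⟩

theorem intSpan_map {ι : Type*} {e : ι → H} {V : H →L[ℝ] H} (hV : ∀ i, V (e i) ∈ intSpan e)
    {x : H} (hx : x ∈ intSpan e) : V x ∈ intSpan e := by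
  induction hx using AddSubgroup.closure_induction with
  | mem x hx => obtain ⟨j, rfl⟩ := hx; exact hV j
  | zero => simp
  | add x y _ _ hx hy => rw [map_add]; exact add_mem hx hy
  | neg x _ hx => rw [map_neg]; exact neg_mem hx

theorem intSpan_le_span {ι : Type*} {e : ι → H} {x : H} (hx : x ∈ intSpan e) :
    x ∈ Submodule.span ℝ (Set.range e) :=
  (AddSubgroup.closure_le (Submodule.span ℝ (Set.range e)).toAddSubgroup).2
    Submodule.subset_span hx

/-- Finitely many combinations involve only finitely many members of the family. The isometry embeds
the space spanned by those, and `g` records which member each new coordinate stands for, so that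
integrality of coordinates is inherited. -/
theorem exists_isometry_of_finite {ι : Type*} {e : ι → H} (he : Orthonormal ℝ e) {X : Set H}
    (hX : X.Finite) (hXe : ∀ x ∈ X, x ∈ intSpan e) :
    ∃ (d : ℕ) (J : EuclideanSpace ℝ (Fin d) →ₗᵢ[ℝ] H) (g : Fin d → ι),
      (∀ c, J (EuclideanSpace.single c 1) = e (g c)) ∧ ∀ x ∈ X, ∃ y, J y = x := by
  classical
  have h1 : ∀ x ∈ X, ∃ c : ι →₀ ℝ, (c.sum fun i a => a • e i) = x := fun x hx =>
    Finsupp.mem_span_range_iff_exists_finsupp.1 (intSpan_le_span (hXe x hx))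
  choose! c hc using h1
  set s : Finset ι := hX.toFinset.biUnion fun x => (c x).support with hs
  set g : Fin s.card → ι := fun k => (s.equivFin.symm k).1 with hg
  have gi : Function.Injective g := Subtype.val_injective.comp s.equivFin.symm.injective
  set v := (EuclideanSpace.basisFun (Fin s.card) ℝ).toBasis with hv
  set f := v.constr ℝ (e ∘ g) with hf
  have hfv : f ∘ v = e ∘ g := funext fun k => v.constr_basis ℝ (e ∘ g) k
  set J := f.isometryOfOrthonormal (v := v)
    (by rw [hv, OrthonormalBasis.coe_toBasis]; exact OrthonormalBasis.orthonormal _)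
    (by rw [hfv]; exact he.comp g gi) with hJ
  have hJg : ∀ k, J (EuclideanSpace.single k 1) = e (g k) := fun k => by
    have := congrFun hfv k
    change f (EuclideanSpace.single k 1) = e (g k)
    simpa [hv] using this
  refine ⟨s.card, J, g, hJg, fun x hx => ?_⟩
  have mem : x ∈ LinearMap.range J.toLinearMap := by
    rw [← hc x hx]
    refine Submodule.sum_mem _ fun i hi => Submodule.smul_mem _ _ ?_
    have his : i ∈ s := Finset.mem_biUnion.2 ⟨x, hX.mem_toFinset.2 hx, hi⟩
    refine ⟨EuclideanSpace.single (s.equivFin ⟨i, his⟩) 1, ?_⟩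
    have := hJg (s.equivFin ⟨i, his⟩)
    rw [hg] at this
    simpa using this
  exact mem

end Basis

/-- Compares the penalty at width n with a sum that does not depend on n, as the products of the
limit vanish beyond Δ. -/
theorem sum_sq_le_of_eq_zero {s : Finset ℕ} {f g : ℕ → ℝ} {Δ : ℕ} (hfg : ∀ k ∈ s, f k = g k)
    (hg : ∀ k, Δ < k → g k = 0) :
    ∑ k ∈ s, f k ^ 2 ≤ ∑ k ∈ Finset.range (Δ + 1), g k ^ 2 := by
  rw [Finset.sum_congr rfl fun k hk => by rw [hfg k hk]]
  have h1 : ∑ k ∈ s, g k ^ 2 = ∑ k ∈ s.filter (· ≤ Δ), g k ^ 2 := by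
    refine (Finset.sum_filter_of_ne fun k _ hk => ?_).symm
    by_contra h
    exact hk (by rw [hg k (not_le.1 h)]; simp)
  rw [h1]
  refine Finset.sum_le_sum_of_subset_of_nonneg (fun k hk => ?_) fun _ _ _ => sq_nonneg _
  exact Finset.mem_range.2 (Nat.lt_succ_of_le (Finset.mem_filter.1 hk).2)

namespace Transformer

variable {A : Type*} {H : Type*} [NormedAddCommGroup H] [InnerProductSpace ℝ H]

/-- The parameters of `T` are integer combinations of an orthonormal family, or have integer
matrix entries with respect to it, and the key operators are trivial. -/
structure IsIntegral {ι : Type*} (T : Transformer A H) (e : ι → H) : Prop where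
  orthonormal : Orthonormal ℝ e
  K : ∀ l h, T.K l h = ContinuousLinearMap.id ℝ H
  Q : ∀ l h i j, ∃ z : ℤ, ⟪e i, T.Q l h (e j)⟫_ℝ = z
  V : ∀ l h i, T.V l h (e i) ∈ intSpan e
  source : ∀ v, T.source v ∈ intSpan e
  Ain : ∀ l s, T.Ain l s ∈ intSpan e
  b : ∀ l s, ∃ z : ℤ, T.b l s = z
  U : ∀ ω, T.U ω ∈ intSpan e

theorem IsIntegral.path {ι : Type*} {T : Transformer A H} {e : ι → H} (hT : T.IsIntegral e)
    (S : T.Path) (l : ℕ) (v) : T.pathProdTo S l (T.source v) ∈ intSpan e := by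
  induction l with
  | zero => exact hT.source v
  | succ l ih =>
    by_cases hl : l < T.depth
    · cases hS : S ⟨l, hl⟩ with
      | none => rwa [pathProdTo_succ_none _ _ _ fun _ => hS]
      | some h =>
        rw [pathProdTo_succ_some _ _ hl hS]
        exact intSpan_map (hT.V _ h) ih
    · rwa [pathProdTo_succ_none _ _ _ fun h => absurd h hl]

variable [CompleteSpace H]

open ContinuousLinearMap (adjoint) in
/-- Compression of `T` along an isometric embedding. -/
noncomputable abbrev compress (T : Transformer A H) {d : ℕ} (J : EuclideanSpace ℝ (Fin d) →ₗᵢ[ℝ] H) :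
    Transformer A (EuclideanSpace ℝ (Fin d)) :=
  T.refill (fun t => adjoint J.toContinuousLinearMap (T.pos t))
    (fun ω => adjoint J.toContinuousLinearMap (T.E ω))
    (fun _ _ => ContinuousLinearMap.id ℝ _)
    (fun l h => (adjoint J.toContinuousLinearMap).comp ((T.Q l h).comp J.toContinuousLinearMap))
    (fun l h => (adjoint J.toContinuousLinearMap).comp ((T.V l h).comp J.toContinuousLinearMap))
    (fun l s => adjoint J.toContinuousLinearMap (T.Ain l s))
    (fun l s => adjoint J.toContinuousLinearMap (T.Bout l s))
    (fun ω => adjoint J.toContinuousLinearMap (T.U ω))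

section

variable {T : Transformer A H} {d : ℕ} {J : EuclideanSpace ℝ (Fin d) →ₗᵢ[ℝ] H}

open ContinuousLinearMap (adjoint)

theorem adjoint_isometry_apply (y : EuclideanSpace ℝ (Fin d)) :
    adjoint J.toContinuousLinearMap (J y) = y := by
  refine ext_inner_left ℝ fun z => ?_
  rw [ContinuousLinearMap.adjoint_inner_right]
  exact J.inner_map_map z y

theorem norm_adjoint_isometry_le (x : H) : ‖adjoint J.toContinuousLinearMap x‖ ≤ ‖x‖ := by
  refine (ContinuousLinearMap.le_opNorm _ _).trans ?_
  rw [LinearIsometryEquiv.norm_map]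
  exact mul_le_of_le_one_left (norm_nonneg _) J.norm_toContinuousLinearMap_le

theorem norm_compress_le (W : H →L[ℝ] H) :
    ‖(adjoint J.toContinuousLinearMap).comp (W.comp J.toContinuousLinearMap)‖ ≤ ‖W‖ := by
  refine ContinuousLinearMap.opNorm_le_bound _ (norm_nonneg _) fun y => ?_
  calc ‖adjoint J.toContinuousLinearMap (W (J y))‖ ≤ ‖W (J y)‖ := norm_adjoint_isometry_le _
    _ ≤ ‖W‖ * ‖J y‖ := W.le_opNorm _
    _ = ‖W‖ * ‖y‖ := by rw [J.norm_map]

theorem compress_source (v : Source A T.depth T.dff) :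
    (T.compress J).source v = adjoint J.toContinuousLinearMap (T.source v) := by
  cases v <;> rfl

variable {n : ℕ} (hJ : ∀ S, ∀ l ≤ T.depth, ∀ v : Source A T.depth T.dff, v.Valid n →
  ∃ y, J y = T.pathProdTo S l (T.source v))

-- J composed with its adjoint fixes the range of J. All partial path images lie in that range, so
-- compression between the steps loses nothing.
include hJ in
theorem compress_pathProdTo (S : T.Path) {l : ℕ} (hl : l ≤ T.depth)
    {v : Source A T.depth T.dff} (hv : v.Valid n) :
    J ((T.compress J).pathProdTo S l ((T.compress J).source v)) =
      T.pathProdTo S l (T.source v) := by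
  induction l with
  | zero =>
    obtain ⟨y, hy⟩ := hJ S 0 hl v hv
    change J ((T.compress J).source v) = T.source v
    change J y = T.source v at hy
    rw [compress_source, ← hy, adjoint_isometry_apply]
  | succ l ih =>
    have ih := ih (by omega)
    have hl' : l < T.depth := hl
    cases hS : S ⟨l, hl'⟩ with
    | none =>
      rw [pathProdTo_succ_none (T.compress J) S l fun _ => hS,
        pathProdTo_succ_none T S l fun _ => hS, ih]
    | some h =>
      obtain ⟨y, hy⟩ := hJ S (l + 1) hl v hv
      rw [pathProdTo_succ_some (T.compress J) S hl' hS]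
      rw [pathProdTo_succ_some T S hl' hS] at hy ⊢
      simp only [ContinuousLinearMap.comp_apply] at hy ⊢
      rw [LinearIsometry.coe_toContinuousLinearMap, ih, ← hy, adjoint_isometry_apply]

-- Here the trivial key operator matters: the compressed logit is a matrix entry of `Q` between two
-- vectors in the range of J, and images under `K` or `Q` need not lie in that range.
include hJ in
theorem compress_prodAttn (hK : ∀ l h, T.K l h = ContinuousLinearMap.id ℝ H) (l h S₁ S₂)
    {v w : Source A T.depth T.dff} (hv : v.Valid n) (hw : w.Valid n) :
    (T.compress J).prodAttn l h S₁ S₂ v w = T.prodAttn l h S₁ S₂ v w := by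
  have h1 := compress_pathProdTo hJ S₁ le_rfl hv
  have h2 := compress_pathProdTo hJ S₂ le_rfl hw
  simp only [prodAttn, pathProd, hK, ContinuousLinearMap.comp_apply, ContinuousLinearMap.id_apply]
  rw [ContinuousLinearMap.adjoint_inner_right, LinearIsometry.coe_toContinuousLinearMap, ← h1, ← h2]

include hJ in
theorem compress_prodUnembed (S ω) {w : Source A T.depth T.dff} (hw : w.Valid n) :
    (T.compress J).prodUnembed S ω w = T.prodUnembed S ω w := by
  have h2 := compress_pathProdTo hJ S le_rfl hw
  simp only [prodUnembed, pathProd]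
  rw [ContinuousLinearMap.adjoint_inner_left, LinearIsometry.coe_toContinuousLinearMap, ← h2]

include hJ in
theorem compress_prodMlp (S l s) {w : Source A T.depth T.dff} (hw : w.Valid n) :
    (T.compress J).prodMlp S l s w = T.prodMlp S l s w := by
  have h2 := compress_pathProdTo hJ S le_rfl hw
  simp only [prodMlp, pathProd]
  rw [ContinuousLinearMap.adjoint_inner_left, LinearIsometry.coe_toContinuousLinearMap, ← h2]

end

-- The dimension of the compression grows with n, but the regularizer does not see it: parameters
-- are integers, so precision 0 suffices; compression does not increase norms; and the penalty only
-- involves index differences up to the locality radius of `T`.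
open ContinuousLinearMap (adjoint) in
theorem exists_hypothesis [Finite A] {ι : Type*} {T : Transformer A H} {e : ι → H}
    (hT : T.IsSymbolicLimit) (hint : T.IsIntegral e) (ε : ℝ) :
    ∃ R₀ : ℝ, ∀ n, ∃ M : Hypothesis A n, ((∀ t, T.pos t = 0) → M.NoPE) ∧ M.Fits ε (T.fn ε) ∧
      M.reg ≤ R₀ := by
  obtain ⟨C, hCp, hCe⟩ := hT.bounded
  obtain ⟨CU, hCU⟩ := hT.unembed_bounded
  obtain ⟨Δ, hΔ⟩ := hT.isLocal
  -- The limit conditions bound only the extended embeddings; the remaining ones are finite in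
  -- number.
  have : ∃ CE, 0 ≤ CE ∧ ∀ ω, ‖T.E ω‖ ≤ CE := by
    obtain ⟨B, hB⟩ := (Set.finite_range fun σ => ‖T.E (.fin σ)‖).bddAbove
    refine ⟨max (max C B) ‖T.E .start‖, le_max_of_le_right (norm_nonneg _), fun ω => ?_⟩
    cases ω with
    | start => exact le_max_right _ _
    | fin σ => exact (hB ⟨σ, rfl⟩).trans ((le_max_right _ _).trans (le_max_left _ _))
    | ext k => exact (hCe k).trans ((le_max_left _ _).trans (le_max_left _ _))
  obtain ⟨CE, hCE0, hCE⟩ := this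
  have hC0 : 0 ≤ C := (norm_nonneg _).trans (hCp 0)
  -- A bound for the penalty at every width: the products of the limit transformer at index
  -- differences up to Δ.
  set Z : ℝ := (∑ l : Fin T.depth, ∑ h : Fin T.heads, ∑ S₁ : T.Path, ∑ S₂ : T.Path,
    ((∑ k ∈ Finset.range (Δ + 1), T.prodAttn l h S₁ S₂ (.pos 0) (.pos k) ^ 2) +
      (∑ k ∈ Finset.range (Δ + 1), T.prodAttn l h S₁ S₂ (.pos k) (.pos 0) ^ 2) +
      (∑ k ∈ Finset.range (Δ + 1),
        T.prodAttn l h S₁ S₂ (.sym (.ext 0)) (.sym (.ext k)) ^ 2) +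
      ∑ k ∈ Finset.range (Δ + 1),
        T.prodAttn l h S₁ S₂ (.sym (.ext k)) (.sym (.ext 0)) ^ 2)) +
    ∑ S : T.Path,
    ((∑ k ∈ Finset.range (Δ + 1), T.prodUnembed S (.ext 0) (.sym (.ext k)) ^ 2) +
      ∑ k ∈ Finset.range (Δ + 1), T.prodUnembed S (.ext k) (.sym (.ext 0)) ^ 2) with hZ
  refine ⟨(T.depth + T.heads) + ((0 : ℕ) + T.roundPrec) +
    (⨆ lh : Fin T.depth × Fin T.heads, ‖T.Q lh.1 lh.2‖) +
    (⨆ lh : Fin T.depth × Fin T.heads, ‖T.V lh.1 lh.2‖) +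
    (⨆ l : Fin T.depth, √(∑ s, ‖T.Ain l s‖ ^ 2)) +
    (⨆ l : Fin T.depth, √(∑ s, ‖T.Bout l s‖ ^ 2)) +
    CU + C + CE + (⨆ l : Fin T.depth, √(∑ s, T.b l s ^ 2)) + Z, fun n => ?_⟩
  -- All images of available sources under partial paths, a finite set that the compression has to
  -- contain.
  set X : Set H := Set.range fun x : T.Path × Fin (T.depth + 1) × SmallSource A T.depth T.dff n =>
    T.pathProdTo x.1 x.2.1 (T.source x.2.2.1) with hX
  obtain ⟨d, J, g, hg, hJX⟩ := exists_isometry_of_finite hint.orthonormal (Set.finite_range _ :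
    X.Finite) (by rintro _ ⟨x, rfl⟩; exact hint.path _ _ _)
  have hJ : ∀ S, ∀ l ≤ T.depth, ∀ v : Source A T.depth T.dff, v.Valid n →
      ∃ y, J y = T.pathProdTo S l (T.source v) := fun S l hl v hv =>
    hJX _ ⟨(S, ⟨l, by omega⟩, ⟨v, hv⟩), rfl⟩
  have coord : ∀ x c, (adjoint J.toContinuousLinearMap x) c = ⟪e (g c), x⟫_ℝ := fun x c => by
    rw [← hg c]
    have := ContinuousLinearMap.adjoint_inner_right J.toContinuousLinearMap
      (EuclideanSpace.single c 1) x
    rw [EuclideanSpace.inner_single_left] at this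
    simpa using this
  have prec : ∀ x ∈ intSpan e, ∀ c, IsDyadic 0 ((adjoint J.toContinuousLinearMap x) c) :=
    fun x hx c => by
      obtain ⟨z, hz⟩ := inner_intSpan hint.orthonormal (g c) hx
      rw [coord, hz]
      exact IsDyadic.int 0 z
  let M : Hypothesis A n :=
    { d := d
      p := 0
      T := T.compress J
      pos_prec := fun t _ c => prec _ (hint.source (.pos t)) c
      E_prec := fun ω _ c => prec _ (hint.source (.sym ω)) c
      K_prec := fun l h c c' => by
        change IsDyadic 0 (EuclideanSpace.single c (1 : ℝ) c')
        rw [PiLp.single_apply]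
        split_ifs
        · exact IsDyadic.one 0
        · exact IsDyadic.zero 0
      Q_prec := fun l h c c' => by
        obtain ⟨z, hz⟩ := hint.Q l h (g c') (g c)
        change IsDyadic 0 ((adjoint J.toContinuousLinearMap
          (T.Q l h (J (EuclideanSpace.single c 1)))) c')
        rw [coord, hg, hz]
        exact IsDyadic.int 0 z
      V_prec := fun l h c c' => by
        change IsDyadic 0 ((adjoint J.toContinuousLinearMap
          (T.V l h (J (EuclideanSpace.single c 1)))) c')
        rw [hg]
        exact prec _ (hint.V l h _) c'
      A_prec := fun l s c => prec _ (hint.Ain l s) c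
      b_prec := fun l s => by
        obtain ⟨z, hz⟩ := hint.b l s
        change IsDyadic 0 (T.b l s)
        rw [hz]
        exact IsDyadic.int 0 z
      B_prec := fun l s c => prec _ (hint.source (.mlp l s)) c
      U_prec := fun ω _ c => prec _ (hint.U ω) c
      invariant := by
        refine ⟨fun l h S₁ S₂ a b v w hv hw hv' hw' => ?_, fun S a b ω w hω hw hω' hw' => ?_,
          fun S l s a b w hw hw' => ?_⟩
        · rw [compress_prodAttn hJ hint.K l h S₁ S₂ hv hw,
            compress_prodAttn hJ hint.K l h S₁ S₂ hv' hw']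
          exact hT.invariant.1 l h S₁ S₂ a b v w v.valid_top w.valid_top (Source.valid_top _)
            (Source.valid_top _)
        · rw [compress_prodUnembed hJ S _ hw, compress_prodUnembed hJ S _ hw']
          exact hT.invariant.2.1 S a b ω w ω.valid_top w.valid_top (Symb.valid_top _)
            (Source.valid_top _)
        · rw [compress_prodMlp hJ S _ _ hw, compress_prodMlp hJ S _ _ hw']
          exact hT.invariant.2.2 S l s a b w w.valid_top (Source.valid_top _) }
  refine ⟨M, ?_, ?_, ?_⟩
  · intro h t _
    change adjoint J.toContinuousLinearMap (T.pos t) = 0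
    rw [h t, map_zero]
  · intro w _ _ op oc hop hoc i hi ω hω
    have hlen := inputOf_length w
    have lt : ∀ {a b : ℕ}, a < b → (a : ℕ∞) < b := fun h => by exact_mod_cast h
    -- The limit transformer, at zero offsets, is regarded as a refilling of its compression at the
    -- given offsets. Thus every input that fits the window is matched, not only those of half
    -- length.
    refine output_eq_output_refill (T.compress J) (pos' := T.pos) (E' := T.E) (K' := T.K)
      (Q' := T.Q) (V' := T.V) (Ain' := T.Ain) (Bout' := T.Bout) (U' := T.U) ε (inputOf w) op oc
      {v | (v.shift op oc).Valid n} ?_ ?_ ?_ ?_ ?_ ω ?_ i (by omega)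
    · intro i hi
      exact lt (show i + op < n by omega)
    · exact fun i _ => valid_shift_getD_inputOf w hoc i
    · exact fun l s => trivial
    · intro l h S₁ S₂ v hv v' hv'
      rw [compress_prodAttn hJ hint.K l h S₁ S₂ hv hv']
      exact hT.invariant.1 l h S₁ S₂ op oc v v' v.valid_top v'.valid_top (Source.valid_top _)
        (Source.valid_top _)
    · intro S l s v hv
      rw [compress_prodMlp hJ S l s hv]
      exact hT.invariant.2.2 S l s op oc v v.valid_top (Source.valid_top _)
    · intro S v hv
      rw [compress_prodUnembed hJ S _ hv]
      exact hT.invariant.2.1 S op oc ω v ω.valid_top v.valid_top (Symb.valid_top _)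
        (Source.valid_top _)
  · have hn : ∀ {k : ℕ}, k < n → (k : ℕ∞) < n := fun h => by exact_mod_cast h
    have vp : ∀ {k : ℕ}, k < n → (Source.pos k : Source A T.depth T.dff).Valid n := fun h => hn h
    have vs : ∀ {k : ℕ}, k < n → (Source.sym (.ext k) : Source A T.depth T.dff).Valid n :=
      fun h => hn h
    have h1 : (⨆ lh : Fin T.depth × Fin T.heads,
        ‖(adjoint ((T.compress J).K lh.1 lh.2)).comp ((T.compress J).Q lh.1 lh.2)‖) ≤
        ⨆ lh : Fin T.depth × Fin T.heads, ‖T.Q lh.1 lh.2‖ := by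
      refine Real.iSup_le (fun lh => ?_) (Real.iSup_nonneg fun _ => norm_nonneg _)
      refine le_trans ?_ (Hypothesis.le_iSup_of_finite
        (fun lh : Fin T.depth × Fin T.heads => ‖T.Q lh.1 lh.2‖) lh)
      have : adjoint (ContinuousLinearMap.id ℝ (EuclideanSpace ℝ (Fin d))) =
        ContinuousLinearMap.id ℝ _ := ContinuousLinearMap.adjoint_id
      rw [this, ContinuousLinearMap.id_comp]
      exact norm_compress_le _
    have h2 : (⨆ lh : Fin T.depth × Fin T.heads, ‖(T.compress J).V lh.1 lh.2‖) ≤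
        ⨆ lh : Fin T.depth × Fin T.heads, ‖T.V lh.1 lh.2‖ := by
      refine Real.iSup_le (fun lh => ?_) (Real.iSup_nonneg fun _ => norm_nonneg _)
      exact (norm_compress_le _).trans (Hypothesis.le_iSup_of_finite
        (fun lh : Fin T.depth × Fin T.heads => ‖T.V lh.1 lh.2‖) lh)
    have sq : ∀ {N : ℕ} (a : Fin T.depth → Fin N → H),
        (⨆ l, √(∑ s, ‖adjoint J.toContinuousLinearMap (a l s)‖ ^ 2)) ≤
        ⨆ l, √(∑ s, ‖a l s‖ ^ 2) := fun a => by
      refine Real.iSup_le (fun l => ?_) (Real.iSup_nonneg fun _ => Real.sqrt_nonneg _)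
      refine le_trans (Real.sqrt_le_sqrt <| Finset.sum_le_sum fun s _ => pow_le_pow_left₀
        (norm_nonneg _) (norm_adjoint_isometry_le _) 2) (Hypothesis.le_iSup_of_finite
        (fun l => √(∑ s, ‖a l s‖ ^ 2)) l)
    have h3 : sInf {C : ℝ | (T.compress J).UnembedBound n C} ≤ CU := by
      refine csInf_le ⟨0, fun _ h => h.1⟩ ⟨hCU.1, fun v s _ => ?_⟩
      have := hCU.2 (J v) s fun ω _ => ω.valid_top
      rw [J.norm_map] at this
      refine le_trans (le_of_eq (Finset.sum_congr rfl fun ω _ => ?_)) this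
      rw [ContinuousLinearMap.adjoint_inner_left]
      rfl
    have h4 : (⨆ t : Fin n, ‖(T.compress J).pos t‖) ≤ C :=
      Real.iSup_le (fun t => (norm_adjoint_isometry_le _).trans (hCp t)) hC0
    have h5 : (⨆ ω : {ω : Symb A // ω.Valid n}, ‖(T.compress J).E ω.1‖) ≤ CE :=
      Real.iSup_le (fun ω => (norm_adjoint_isometry_le _).trans (hCE ω)) hCE0
    have h6 : M.zeta ≤ Z := by
      have hr : ∀ {k}, k ∈ Finset.range n → k < n := Finset.mem_range.1
      have hi : ∀ {k}, k ∈ Finset.Ico 1 n → k < n := fun h => (Finset.mem_Ico.1 h).2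
      refine add_le_add (Finset.sum_le_sum fun l _ => Finset.sum_le_sum fun h _ =>
        Finset.sum_le_sum fun S₁ _ => Finset.sum_le_sum fun S₂ _ => add_le_add (add_le_add
          (add_le_add ?_ ?_) ?_) ?_) (Finset.sum_le_sum fun S _ => add_le_add ?_ ?_)
      · exact sum_sq_le_of_eq_zero (fun k hk => compress_prodAttn hJ hint.K l h S₁ S₂
          (vp (Nat.zero_lt_of_lt (hr hk))) (vp (hr hk)))
          fun k hk => ((hΔ 0 k (.inl (by omega))).1 l h S₁ S₂).1
      · exact sum_sq_le_of_eq_zero (fun k hk => compress_prodAttn hJ hint.K l h S₁ S₂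
          (vp (hi hk)) (vp (Nat.zero_lt_of_lt (hi hk))))
          fun k hk => ((hΔ k 0 (.inr (by omega))).1 l h S₁ S₂).1
      · exact sum_sq_le_of_eq_zero (fun k hk => compress_prodAttn hJ hint.K l h S₁ S₂
          (vs (Nat.zero_lt_of_lt (hr hk))) (vs (hr hk)))
          fun k hk => ((hΔ 0 k (.inl (by omega))).1 l h S₁ S₂).2
      · exact sum_sq_le_of_eq_zero (fun k hk => compress_prodAttn hJ hint.K l h S₁ S₂
          (vs (hi hk)) (vs (Nat.zero_lt_of_lt (hi hk))))
          fun k hk => ((hΔ k 0 (.inr (by omega))).1 l h S₁ S₂).2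
      · exact sum_sq_le_of_eq_zero (fun k hk => compress_prodUnembed hJ S _ (vs (hr hk)))
          fun k hk => (hΔ 0 k (.inl (by omega))).2 S
      · exact sum_sq_le_of_eq_zero (fun k hk => compress_prodUnembed hJ S _
          (vs (Nat.zero_lt_of_lt (hi hk)))) fun k hk => (hΔ k 0 (.inr (by omega))).2 S
    exact add_le_add (add_le_add (add_le_add (add_le_add (add_le_add (add_le_add (add_le_add
      (add_le_add (add_le_add (add_le_add le_rfl le_rfl) h1) h2) (sq _)) (sq _)) h3) h4) h5)
      le_rfl) h6

end Transformer

/-! ## The residual space of the limit transformer -/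

/-- Names of coordinates of the residual stream: scalar slots, absolute positions, and registers
each of which can hold an extended symbol. -/
inductive Coord where
  | slot : ℕ → Coord
  | pos : ℕ → Coord
  | sym : ℕ → ℕ → Coord

/-- Which of the three kinds of coordinates. -/
def Coord.kind : Coord → ℕ
  | .slot _ => 0
  | .pos _ => 1
  | .sym _ _ => 2

namespace Residual

open Coord Classical

/-- The residual space of the limit transformer. -/
abbrev Space := lp (fun _ : Coord => ℝ) 2

/-- The unit vector of a coordinate. -/
noncomputable def e (a : Coord) : Space := lp.single 2 a (1 : ℝ)

theorem inner_e (a b : Coord) : ⟪e a, e b⟫_ℝ = if a = b then 1 else 0 := by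
  unfold e
  rw [lp.inner_single_left, lp.single_apply]
  simp [Pi.single_apply]

theorem orthonormal_e : Orthonormal ℝ e :=
  orthonormal_iff_ite.2 inner_e

/-- The isometry that carries the `k`-th unit vector to `e (φ k)`. -/
noncomputable def embed {φ : ℕ → Coord} (hφ : Function.Injective φ) :
    lp (fun _ : ℕ => ℝ) 2 →L[ℝ] Space :=
  (orthonormal_e.comp φ hφ).orthogonalFamily.linearIsometry.toContinuousLinearMap

theorem embed_single {φ : ℕ → Coord} (hφ : Function.Injective φ) (k : ℕ) :
    embed hφ (lp.single 2 k (1 : ℝ)) = e (φ k) := by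
  have := (orthonormal_e.comp φ hφ).orthogonalFamily.linearIsometry_apply_single
    (i := k) (1 : ℝ)
  unfold embed
  rw [LinearIsometry.coe_toContinuousLinearMap, this]
  simp

theorem adjoint_embed_apply {φ : ℕ → Coord} (hφ : Function.Injective φ) (y : Space) (k : ℕ) :
    (ContinuousLinearMap.adjoint (embed hφ) y) k = ⟪e (φ k), y⟫_ℝ := by
  rw [← embed_single hφ, ← ContinuousLinearMap.adjoint_inner_right, lp.inner_single_left]
  simp

/-- The partial isometry that carries `e (ψ k)` to `e (φ k)` and kills all other unit vectors. -/
noncomputable def transfer {φ ψ : ℕ → Coord} (hφ : Function.Injective φ)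
    (hψ : Function.Injective ψ) : Space →L[ℝ] Space :=
  (embed hφ).comp (ContinuousLinearMap.adjoint (embed hψ))

/-- Moving the isometry to the left argument turns the form into a sum over matching coordinates;
all values of forms are read off from this series. -/
theorem inner_transfer {φ ψ : ℕ → Coord} (hφ : Function.Injective φ)
    (hψ : Function.Injective ψ) (x y : Space) :
    ⟪x, transfer hφ hψ y⟫_ℝ = ∑' k, ⟪e (φ k), x⟫_ℝ * ⟪e (ψ k), y⟫_ℝ := by
  unfold transfer
  rw [ContinuousLinearMap.comp_apply, ← ContinuousLinearMap.adjoint_inner_left, lp.inner_eq_tsum]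
  refine tsum_congr fun k => ?_
  rw [adjoint_embed_apply, adjoint_embed_apply]
  simp [mul_comm]

theorem inner_e_transfer {φ ψ : ℕ → Coord} (hφ : Function.Injective φ)
    (hψ : Function.Injective ψ) (k : ℕ) (y : Space) :
    ⟪e (φ k), transfer hφ hψ y⟫_ℝ = ⟪e (ψ k), y⟫_ℝ := by
  rw [inner_transfer, tsum_eq_single k]
  · rw [inner_e, if_pos rfl, one_mul]
  · intro k' hk'
    rw [inner_e, if_neg fun h => hk' (hφ h), zero_mul]

theorem inner_e_transfer_of_notMem {φ ψ : ℕ → Coord} (hφ : Function.Injective φ)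
    (hψ : Function.Injective ψ) {a : Coord} (ha : a ∉ Set.range φ) (y : Space) :
    ⟪e a, transfer hφ hψ y⟫_ℝ = 0 := by
  rw [inner_transfer]
  convert tsum_zero with k
  rw [inner_e, if_neg fun h => ha ⟨k, h⟩, zero_mul]

theorem transfer_e {φ ψ : ℕ → Coord} (hφ : Function.Injective φ)
    (hψ : Function.Injective ψ) (k : ℕ) : transfer hφ hψ (e (ψ k)) = e (φ k) := by
  unfold transfer
  rw [ContinuousLinearMap.comp_apply, ← embed_single hφ]
  congr 1
  ext j
  rw [adjoint_embed_apply, inner_e, lp.single_apply, Pi.single_apply]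
  simp [hψ.eq_iff]

theorem transfer_e_of_notMem {φ ψ : ℕ → Coord} (hφ : Function.Injective φ)
    (hψ : Function.Injective ψ) {a : Coord} (ha : a ∉ Set.range ψ) :
    transfer hφ hψ (e a) = 0 := by
  unfold transfer
  rw [ContinuousLinearMap.comp_apply]
  have : ContinuousLinearMap.adjoint (embed hψ) (e a) = 0 := by
    ext j
    rw [adjoint_embed_apply, inner_e, if_neg fun h => ha ⟨j, h⟩]
    rfl
  rw [this, map_zero]

/-- The operator that carries slot `f` to slot `f'` and kills all other unit vectors. -/
noncomputable def slotOp (f f' : ℕ) : Space →L[ℝ] Space :=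
  (innerSL ℝ (e (slot f))).smulRight (e (slot f'))

theorem slotOp_apply (f f' : ℕ) (y : Space) :
    slotOp f f' y = ⟪e (slot f), y⟫_ℝ • e (slot f') := rfl

theorem pos_injective (s : ℕ) : Function.Injective fun t => pos (t + s) := fun a b h => by
  simpa using h

theorem sym_injective (g s : ℕ) : Function.Injective fun k => sym g (k + s) := fun a b h => by
  simpa using h

/-- The form that compares the position of the key with that of the query, `s` places back. -/
noncomputable def posOp (s : ℕ) : Space →L[ℝ] Space :=
  transfer (pos_injective 0) (pos_injective s)

/-- The form that compares register `g` of the key with register `g'` of the query, up to a shift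
by `τ`. -/
noncomputable def symOp (g g' : ℕ) (τ : ℤ) : Space →L[ℝ] Space :=
  transfer (sym_injective g τ.toNat) (sym_injective g' (-τ).toNat)

/-- The operator that carries register `g` to register `g'` and kills all other unit vectors. -/
noncomputable def regOp (g g' : ℕ) : Space →L[ℝ] Space :=
  transfer (sym_injective g' 0) (sym_injective g 0)

/-! ### Operators suitable as value operators -/

/-- A value operator that moves slots to slots and registers to registers. -/
def IsMove (V : Space →L[ℝ] Space) : Prop :=
  ∃ (vs vr : ℕ → Option ℕ) (vp : Bool),
    (∀ f, V (e (slot f)) = (vs f).elim 0 fun f' => e (slot f')) ∧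
    (∀ g k, V (e (sym g k)) = (vr g).elim 0 fun g' => e (sym g' k)) ∧
    ∀ t, V (e (pos t)) = if vp then e (pos t) else 0

theorem IsMove.zero : IsMove 0 :=
  ⟨fun _ => none, fun _ => none, false, fun _ => by simp, fun _ _ => by simp, fun _ => by simp⟩

theorem IsMove.id : IsMove (ContinuousLinearMap.id ℝ Space) :=
  ⟨some, some, true, fun _ => rfl, fun _ _ => rfl, fun _ => rfl⟩

theorem IsMove.comp {V W : Space →L[ℝ] Space} (hV : IsMove V) (hW : IsMove W) :
    IsMove (V.comp W) := by
  obtain ⟨vs, vr, vp, h1, h2, h3⟩ := hV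
  obtain ⟨ws, wr, wp, k1, k2, k3⟩ := hW
  refine ⟨fun f => (ws f).bind vs, fun g => (wr g).bind vr, vp && wp, fun f => ?_, fun g k => ?_,
    fun t => ?_⟩
  · rw [ContinuousLinearMap.comp_apply, k1]
    change _ = ((ws f).bind vs).elim 0 fun f' => e (slot f')
    cases ws f <;> simp [h1]
  · rw [ContinuousLinearMap.comp_apply, k2]
    change _ = ((wr g).bind vr).elim 0 fun g' => e (sym g' k)
    cases wr g <;> simp [h2]
  · rw [ContinuousLinearMap.comp_apply, k3]
    cases wp <;> simp [h3]

theorem IsMove.slotOp (f f' : ℕ) : IsMove (slotOp f f') := by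
  refine ⟨fun g => if g = f then some f' else none, fun _ => none, false, fun g => ?_,
    fun g k => ?_, fun t => ?_⟩
  · rw [slotOp_apply, inner_e]
    by_cases h : g = f
    · simp [h]
    · have : f ≠ g := fun h' => h h'.symm
      simp [h, this]
  · rw [slotOp_apply, inner_e]; simp
  · rw [slotOp_apply, inner_e]; simp

theorem IsMove.regOp (g g' : ℕ) : IsMove (regOp g g') := by
  refine ⟨fun _ => none, fun h => if h = g then some g' else none, false, fun f => ?_,
    fun h k => ?_, fun t => ?_⟩
  · exact transfer_e_of_notMem _ _ (by rintro ⟨k, hk⟩; simp at hk)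
  · by_cases hg : h = g
    · subst hg
      simpa [Residual.regOp] using transfer_e (sym_injective g' 0) (sym_injective h 0) k
    · change _ = (if h = g then some g' else none).elim 0 fun g' => e (sym g' k)
      rw [if_neg hg]
      exact transfer_e_of_notMem _ _ (by rintro ⟨k, hk⟩; simp at hk; exact hg hk.1.symm)
  · exact transfer_e_of_notMem _ _ (by rintro ⟨k, hk⟩; simp at hk)

/-- Integer combinations of slots. -/
noncomputable abbrev slotSpan : AddSubgroup Space := intSpan fun f => e (slot f)

theorem e_mem_slotSpan (f : ℕ) : e (slot f) ∈ slotSpan := AddSubgroup.subset_closure ⟨f, rfl⟩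

theorem slotSpan_le : slotSpan ≤ intSpan e :=
  AddSubgroup.closure_mono (by rintro _ ⟨f, rfl⟩; exact ⟨_, rfl⟩)

theorem e_mem_intSpan (a : Coord) : e a ∈ intSpan e := AddSubgroup.subset_closure ⟨a, rfl⟩

theorem IsMove.mem_intSpan {V : Space →L[ℝ] Space} (hV : IsMove V) (a : Coord) :
    V (e a) ∈ intSpan e := by
  obtain ⟨vs, vr, vp, h1, h2, h3⟩ := hV
  cases a with
  | slot f => rw [h1]; cases vs f; exacts [zero_mem _, e_mem_intSpan _]
  | sym g k => rw [h2]; cases vr g; exacts [zero_mem _, e_mem_intSpan _]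
  | pos t => rw [h3]; split_ifs; exacts [e_mem_intSpan _, zero_mem _]

theorem IsMove.slotSpan {V : Space →L[ℝ] Space} (hV : IsMove V) {x : Space}
    (hx : x ∈ slotSpan) : V x ∈ slotSpan := by
  obtain ⟨vs, vr, vp, h1, h2, h3⟩ := hV
  induction hx using AddSubgroup.closure_induction with
  | mem x hx =>
    obtain ⟨f, rfl⟩ := hx
    simp only [h1]
    cases vs f
    exacts [zero_mem _, e_mem_slotSpan _]
  | zero => simp
  | add x y _ _ hx hy => rw [map_add]; exact add_mem hx hy
  | neg x _ hx => rw [map_neg]; exact neg_mem hx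

/-! ### Operators suitable for attention logits -/

/-- An operator whose matrix entries are integers, vanish between coordinates of different kinds,
and depend only on the distance of positions or of extended symbols, up to some distance. -/
structure IsForm (Q : Space →L[ℝ] Space) : Prop where
  cross : ∀ a b : Coord, a.kind ≠ b.kind → ⟪e a, Q (e b)⟫_ℝ = 0
  slot : ∀ f f', ∃ z : ℤ, ⟪e (slot f), Q (e (slot f'))⟫_ℝ = z
  pos : ∃ (z : ℤ → ℤ) (Δ : ℕ), (∀ d, (Δ : ℤ) < |d| → z d = 0) ∧
    ∀ t t' : ℕ, ⟪e (pos t), Q (e (pos t'))⟫_ℝ = z (t - t')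
  sym : ∃ (z : ℕ → ℕ → ℤ → ℤ) (Δ : ℕ), (∀ g g' d, (Δ : ℤ) < |d| → z g g' d = 0) ∧
    ∀ g g' (k k' : ℕ), ⟪e (sym g k), Q (e (sym g' k'))⟫_ℝ = z g g' (k - k')

theorem IsForm.zero : IsForm 0 where
  cross _ _ _ := by simp
  slot _ _ := ⟨0, by simp⟩
  pos := ⟨0, 0, by simp, by simp⟩
  sym := ⟨0, 0, by simp, by simp⟩

theorem IsForm.add {Q Q' : Space →L[ℝ] Space} (h : IsForm Q) (h' : IsForm Q') :
    IsForm (Q + Q') where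
  cross a b hab := by
    rw [add_apply, inner_add_right, h.cross a b hab, h'.cross a b hab,
      add_zero]
  slot f f' := by
    obtain ⟨z, hz⟩ := h.slot f f'
    obtain ⟨z', hz'⟩ := h'.slot f f'
    exact ⟨z + z', by rw [add_apply, inner_add_right, hz, hz']; push_cast; rfl⟩
  pos := by
    obtain ⟨z, Δ, h1, h2⟩ := h.pos
    obtain ⟨z', Δ', h1', h2'⟩ := h'.pos
    refine ⟨fun d => z d + z' d, max Δ Δ', fun d hd => ?_, fun t t' => ?_⟩
    · simp only [h1 d (by omega), h1' d (by omega), add_zero]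
    · rw [add_apply, inner_add_right, h2, h2']; push_cast; rfl
  sym := by
    obtain ⟨z, Δ, h1, h2⟩ := h.sym
    obtain ⟨z', Δ', h1', h2'⟩ := h'.sym
    refine ⟨fun g g' d => z g g' d + z' g g' d, max Δ Δ', fun g g' d hd => ?_,
      fun g g' k k' => ?_⟩
    · simp only [h1 g g' d (by omega), h1' g g' d (by omega), add_zero]
    · rw [add_apply, inner_add_right, h2, h2']; push_cast; rfl

theorem IsForm.smul {Q : Space →L[ℝ] Space} (h : IsForm Q) (m : ℤ) : IsForm ((m : ℝ) • Q) where
  cross a b hab := by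
    rw [smul_apply, inner_smul_right, h.cross a b hab, mul_zero]
  slot f f' := by
    obtain ⟨z, hz⟩ := h.slot f f'
    exact ⟨m * z, by rw [smul_apply, inner_smul_right, hz]; push_cast; rfl⟩
  pos := by
    obtain ⟨z, Δ, h1, h2⟩ := h.pos
    refine ⟨fun d => m * z d, Δ, fun d hd => by simp only [h1 d hd, mul_zero], fun t t' => ?_⟩
    rw [smul_apply, inner_smul_right, h2]; push_cast; rfl
  sym := by
    obtain ⟨z, Δ, h1, h2⟩ := h.sym
    refine ⟨fun g g' d => m * z g g' d, Δ, fun g g' d hd => by simp only [h1 g g' d hd, mul_zero],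
      fun g g' k k' => ?_⟩
    rw [smul_apply, inner_smul_right, h2]; push_cast; rfl

theorem IsForm.slotOp (f f' : ℕ) : IsForm (slotOp f f') where
  cross a b hab := by
    rw [slotOp_apply, inner_smul_right, inner_e, inner_e]
    cases a <;> cases b <;> simp [Coord.kind] at hab ⊢
  slot g g' := by
    rw [slotOp_apply, inner_smul_right, inner_e, inner_e]
    split_ifs
    exacts [⟨1, by simp⟩, ⟨0, by simp⟩, ⟨0, by simp⟩, ⟨0, by simp⟩]
  pos := ⟨0, 0, by simp, fun t t' => by rw [slotOp_apply, inner_smul_right, inner_e]; simp⟩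
  sym := ⟨0, 0, by simp, fun g g' k k' => by rw [slotOp_apply, inner_smul_right, inner_e]; simp⟩

theorem inner_posOp (s t t' : ℕ) :
    ⟪e (pos t), posOp s (e (pos t'))⟫_ℝ = if t + s = t' then 1 else 0 := by
  have := inner_e_transfer (pos_injective 0) (pos_injective s) t (e (pos t'))
  simp only [add_zero] at this
  rw [posOp, this, inner_e]
  simp

theorem IsForm.posOp (s : ℕ) : IsForm (posOp s) where
  cross a b hab := by
    rw [Residual.posOp, inner_transfer]
    convert tsum_zero with k
    rw [inner_e, inner_e]
    cases a <;> cases b <;> simp [Coord.kind] at hab ⊢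
  slot f f' := ⟨0, by
    rw [Residual.posOp, transfer_e_of_notMem _ _ (by rintro ⟨k, hk⟩; simp at hk)]; simp⟩
  pos := by
    refine ⟨fun d => if d + s = 0 then 1 else 0, s, fun d hd => if_neg fun h => ?_, fun t t' => ?_⟩
    · rw [lt_abs] at hd; omega
    · rw [inner_posOp]
      have : (t + s = t') ↔ ((t : ℤ) - t' + s = 0) := by omega
      simp [this]
  sym := ⟨0, 0, by simp, fun g g' k k' => by
    rw [Residual.posOp, transfer_e_of_notMem _ _ (by rintro ⟨k, hk⟩; simp at hk)]; simp⟩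

/-- The numbers `τ.toNat` and `(-τ).toNat` differ by τ and one of them is 0. Hence the indices
shifted by them run exactly once through all pairs of natural numbers with difference τ. -/
theorem inner_symOp (g g' : ℕ) (τ : ℤ) (h h' k k' : ℕ) :
    ⟪e (sym h k), symOp g g' τ (e (sym h' k'))⟫_ℝ =
      if h = g ∧ h' = g' ∧ (k : ℤ) = k' + τ then 1 else 0 := by
  rw [symOp, inner_transfer]
  split_ifs with hc
  · obtain ⟨rfl, rfl, hk⟩ := hc
    rw [tsum_eq_single (k - τ.toNat)]
    · rw [inner_e, inner_e, if_pos, if_pos, mul_one]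
      · simp only [sym.injEq, true_and]; omega
      · simp only [sym.injEq, true_and]; omega
    · intro j hj
      rw [inner_e, if_neg, zero_mul]
      simp only [sym.injEq, true_and]; omega
  · convert tsum_zero with j
    rw [inner_e, inner_e]
    by_contra hne
    refine hc ?_
    by_cases h1 : sym g (j + τ.toNat) = sym h k
    · by_cases h2 : sym g' (j + (-τ).toNat) = sym h' k'
      · simp only [sym.injEq] at h1 h2
        exact ⟨h1.1.symm, h2.1.symm, by omega⟩
      · simp [h2] at hne
    · simp [h1] at hne

theorem IsForm.symOp (g g' : ℕ) (τ : ℤ) : IsForm (symOp g g' τ) where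
  cross a b hab := by
    rw [Residual.symOp, inner_transfer]
    convert tsum_zero with k
    rw [inner_e, inner_e]
    cases a <;> cases b <;> simp [Coord.kind] at hab ⊢
  slot f f' := ⟨0, by
    rw [Residual.symOp, transfer_e_of_notMem _ _ (by rintro ⟨k, hk⟩; simp at hk)]; simp⟩
  pos := ⟨0, 0, by simp, fun t t' => by
    rw [Residual.symOp, transfer_e_of_notMem _ _ (by rintro ⟨k, hk⟩; simp at hk)]; simp⟩
  sym := by
    refine ⟨fun h h' d => if h = g ∧ h' = g' ∧ d = τ then 1 else 0, τ.natAbs, fun h h' d hd =>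
      if_neg fun hc => ?_, fun h h' k k' => ?_⟩
    · rw [hc.2.2, Int.abs_eq_natAbs] at hd; omega
    · rw [inner_symOp]
      have : ((k : ℤ) = k' + τ) ↔ ((k : ℤ) - k' = τ) := by omega
      simp [this]

theorem IsForm.int {Q : Space →L[ℝ] Space} (h : IsForm Q) (a b : Coord) :
    ∃ z : ℤ, ⟪e a, Q (e b)⟫_ℝ = z := by
  by_cases hab : a.kind = b.kind
  · obtain ⟨z, Δ, h1, h2⟩ := h.pos
    obtain ⟨z', Δ', h1', h2'⟩ := h.sym
    cases a <;> cases b <;> simp [Coord.kind] at hab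
    exacts [h.slot _ _, ⟨_, h2 _ _⟩, ⟨_, h2' _ _ _ _⟩]
  · exact ⟨0, by rw [h.cross a b hab]; simp⟩

theorem inner_eq_zero_of_slotSpan {f : Space →+ ℝ} (hf : ∀ g, f (e (slot g)) = 0) {x : Space}
    (hx : x ∈ slotSpan) : f x = 0 := by
  have : slotSpan ≤ f.ker := (AddSubgroup.closure_le _).2 (by rintro _ ⟨g, rfl⟩; exact hf g)
  exact this hx

theorem inner_slotSpan {x : Space} (hx : x ∈ slotSpan) {a : Coord} (ha : a.kind ≠ 0) :
    ⟪x, e a⟫_ℝ = 0 := by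
  rw [real_inner_comm]
  refine inner_eq_zero_of_slotSpan (f := (innerSL ℝ (e a) : Space →+ ℝ)) (fun g => ?_) hx
  change ⟪e a, e (slot g)⟫_ℝ = 0
  rw [inner_e, if_neg]
  rintro rfl
  exact ha rfl

theorem IsForm.inner_slotSpan_right {Q : Space →L[ℝ] Space} (h : IsForm Q) {x : Space}
    (hx : x ∈ slotSpan) {a : Coord} (ha : a.kind ≠ 0) : ⟪e a, Q x⟫_ℝ = 0 := by
  refine inner_eq_zero_of_slotSpan (f := ((innerSL ℝ (e a)).comp Q : Space →+ ℝ)) (fun g => ?_) hx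
  exact h.cross a (Coord.slot g) ha

theorem IsForm.inner_slotSpan_left {Q : Space →L[ℝ] Space} (h : IsForm Q) {x : Space}
    (hx : x ∈ slotSpan) {a : Coord} (ha : a.kind ≠ 0) : ⟪x, Q (e a)⟫_ℝ = 0 := by
  rw [real_inner_comm]
  refine inner_eq_zero_of_slotSpan (f := (innerSL ℝ (Q (e a)) : Space →+ ℝ)) (fun g => ?_) hx
  change ⟪Q (e a), e (Coord.slot g)⟫_ℝ = 0
  rw [real_inner_comm]
  exact h.cross (Coord.slot g) a (Ne.symm ha)

end Residual

namespace Residual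

open Coord Classical

variable {A : Type*}

/-! ## Assembling layers -/

/-- A layer with one attention head, whose key operator is trivial, and four hidden units. -/
structure Layer where
  Q : Space →L[ℝ] Space
  V : Space →L[ℝ] Space
  Ain : Fin 4 → Space
  b : Fin 4 → ℝ
  Bout : Fin 4 → Space
  act : Fin 4 → Activation

/-- The parameters of the layer have the form required of a limit transformer. -/
structure Layer.Good (a : Layer) : Prop where
  Q : IsForm a.Q
  V : IsMove a.V
  Ain : ∀ s, a.Ain s ∈ slotSpan
  b : ∀ s, ∃ z : ℤ, a.b s = z
  Bout : ∀ s, a.Bout s ∈ slotSpan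

/-- How the input is embedded: with or without positional encodings, and a slot for each letter. -/
structure Encoding (A : Type*) where
  usePos : Prop
  letter : A → ℕ

/-- The positional encoding of `t`. -/
noncomputable def Encoding.pos (c : Encoding A) (t : ℕ) : Space := if c.usePos then e (Coord.pos t) else 0

/-- The embedding of a symbol. -/
noncomputable def Encoding.emb (c : Encoding A) : Symb A → Space
  | .start => e (slot 0)
  | .fin σ => e (slot (c.letter σ))
  | .ext k => e (sym 0 k)

/-- The transformer that runs the given layers and reads off the slot `out`. -/
noncomputable abbrev assemble (c : Encoding A) (ls : List Layer) (out : ℕ) :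
    Transformer A Space where
  depth := ls.length
  heads := 1
  dff := 4
  roundPrec := 0
  pos := c.pos
  E := c.emb
  K _ _ := ContinuousLinearMap.id ℝ Space
  Q l _ := (ls.get l).Q
  V l _ := (ls.get l).V
  Ain l := (ls.get l).Ain
  b l := (ls.get l).b
  Bout l := (ls.get l).Bout
  act l := (ls.get l).act
  U
    | .start => e (slot out)
    | _ => 0

section Limit

open Transformer

variable {c : Encoding A} {ls : List Layer} {out : ℕ} (hls : ∀ a ∈ ls, a.Good)

-- Moves are closed under composition, so a path never changes the index of a position or of an
-- extended symbol; it can only rename the register or erase the vector.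
include hls in
theorem assemble_path_isMove (S : (assemble c ls out).Path) (l : ℕ) :
    IsMove ((assemble c ls out).pathProdTo S l) := by
  induction l with
  | zero => exact IsMove.id
  | succ l ih =>
    by_cases hl : l < (assemble c ls out).depth
    · cases hS : S ⟨l, hl⟩ with
      | none => rwa [pathProdTo_succ_none _ _ _ fun _ => hS]
      | some h =>
        rw [pathProdTo_succ_some _ _ hl hS]
        exact (hls _ (List.get_mem _ _)).V.comp ih
    · rwa [pathProdTo_succ_none _ _ _ fun h => absurd h hl]

theorem assemble_U_slotSpan (ω : Symb A) : (assemble c ls out).U ω ∈ slotSpan := by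
  cases ω
  exacts [e_mem_slotSpan _, zero_mem _, zero_mem _]

include hls in
theorem assemble_isIntegral : (assemble c ls out).IsIntegral e where
  orthonormal := orthonormal_e
  K _ _ := rfl
  Q l _ i j := (hls _ (List.get_mem ls l)).Q.int i j
  V l _ i := (hls _ (List.get_mem ls l)).V.mem_intSpan i
  source v := by
    rcases v with t | (_ | σ | k) | ⟨l, s⟩
    · change c.pos t ∈ _
      unfold Encoding.pos
      split_ifs
      exacts [e_mem_intSpan _, zero_mem _]
    · exact e_mem_intSpan _
    · exact e_mem_intSpan _
    · exact e_mem_intSpan _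
    · exact slotSpan_le ((hls _ (List.get_mem ls l)).Bout s)
  Ain l s := slotSpan_le ((hls _ (List.get_mem ls l)).Ain s)
  b l s := (hls _ (List.get_mem ls l)).b s
  U ω := slotSpan_le (assemble_U_slotSpan ω)

include hls in
theorem assemble_inert {v : Source A ls.length 4} (hv : v.Inert) (S : (assemble c ls out).Path) :
    (assemble c ls out).pathProd S ((assemble c ls out).source v) ∈ slotSpan := by
  refine (assemble_path_isMove hls S _).slotSpan ?_
  rcases v with t | (_ | σ | k) | ⟨l, s⟩
  · have := hv.1 1 0
    simp [Source.shift] at this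
  · exact e_mem_slotSpan _
  · exact e_mem_slotSpan _
  · have := hv.1 0 1
    simp [Source.shift, Symb.shift] at this
  · exact (hls _ (List.get_mem ls l)).Bout s

-- The coefficient is the same for all t, which makes the products of two positions a function of
-- the difference alone.
include hls in
theorem assemble_pos (S : (assemble c ls out).Path) : ∃ z : ℤ, ∀ t,
    (assemble c ls out).pathProd S ((assemble c ls out).source (.pos t)) = (z : ℝ) • e (pos t) := by
  obtain ⟨-, -, vp, -, -, h⟩ := assemble_path_isMove (c := c) (out := out) hls S ls.length
  by_cases hu : c.usePos
  · refine ⟨if vp then 1 else 0, fun t => ?_⟩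
    change (assemble c ls out).pathProdTo S ls.length (c.pos t) = _
    rw [Encoding.pos, if_pos hu, h]
    cases vp <;> simp
  · refine ⟨0, fun t => ?_⟩
    change (assemble c ls out).pathProdTo S ls.length (c.pos t) = _
    rw [Encoding.pos, if_neg hu]
    simp

include hls in
theorem assemble_ext (S : (assemble c ls out).Path) : ∃ (z : ℤ) (g : ℕ), ∀ k,
    (assemble c ls out).pathProd S ((assemble c ls out).source (.sym (.ext k))) =
      (z : ℝ) • e (sym g k) := by
  obtain ⟨-, vr, -, -, h, -⟩ := assemble_path_isMove (c := c) (out := out) hls S ls.length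
  cases hg : vr 0 with
  | none => exact ⟨0, 0, fun k => (h 0 k).trans (by simp [hg])⟩
  | some g => exact ⟨1, g, fun k => (h 0 k).trans (by simp [hg])⟩

-- Every path image is a combination of slots, or a multiple of one position or register vector.
-- Forms vanish between different kinds of coordinates and depend on differences within one kind;
-- MLP and unembedding rows read slots only.
include hls in
theorem assemble_invariant : (assemble c ls out).TranslationInvariant ⊤ := by
  refine ⟨fun l h S₁ S₂ a b v w _ _ _ _ => ?_, fun S a b ω w _ _ _ _ => ?_,
    fun S l s a b w _ _ => ?_⟩
  all_goals
    have ep : ∀ t, (Source.pos t : Source A ls.length 4).shift a b = .pos (t + a) := fun _ => rfl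
    have es : ∀ k, (Source.sym (.ext k) : Source A ls.length 4).shift a b = .sym (.ext (k + b)) :=
      fun _ => rfl
  · have hQ : IsForm ((assemble c ls out).Q l h) := (hls _ (List.get_mem ls l)).Q
    obtain ⟨z₁, hp₁⟩ := assemble_pos (c := c) (out := out) hls S₁
    obtain ⟨z₂, hp₂⟩ := assemble_pos (c := c) (out := out) hls S₂
    obtain ⟨y₁, g₁, hs₁⟩ := assemble_ext (c := c) (out := out) hls S₁
    obtain ⟨y₂, g₂, hs₂⟩ := assemble_ext (c := c) (out := out) hls S₂
    obtain ⟨zp, Δ, -, hzp⟩ := hQ.pos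
    obtain ⟨zs, Δ', -, hzs⟩ := hQ.sym
    unfold prodAttn
    simp only [ContinuousLinearMap.id_apply]
    rcases v.cases_inert with hv | ⟨t, rfl⟩ | ⟨k, rfl⟩ <;>
      rcases w.cases_inert with hw | ⟨t', rfl⟩ | ⟨k', rfl⟩ <;>
      try simp only [ep, es]
    · rw [hv.1, hw.1]
    · have hv' := assemble_inert (c := c) (out := out) hls hv S₁
      rw [hv.1, hp₂, hp₂, map_smul, map_smul, inner_smul_right, inner_smul_right,
        hQ.inner_slotSpan_left hv' (by simp [kind]), hQ.inner_slotSpan_left hv' (by simp [kind])]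
    · have hv' := assemble_inert (c := c) (out := out) hls hv S₁
      rw [hv.1, hs₂, hs₂, map_smul, map_smul, inner_smul_right, inner_smul_right,
        hQ.inner_slotSpan_left hv' (by simp [kind]), hQ.inner_slotSpan_left hv' (by simp [kind])]
    · have hw' := assemble_inert (c := c) (out := out) hls hw S₂
      rw [hw.1, hp₁, hp₁, inner_smul_left, inner_smul_left,
        hQ.inner_slotSpan_right hw' (by simp [kind]), hQ.inner_slotSpan_right hw' (by simp [kind])]
    · rw [hp₁, hp₁, hp₂, hp₂, map_smul, map_smul, inner_smul_left, inner_smul_left,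
        inner_smul_right, inner_smul_right, hzp, hzp]
      push_cast
      rw [add_sub_add_right_eq_sub]
    · rw [hp₁, hp₁, hs₂, hs₂, map_smul, map_smul, inner_smul_left, inner_smul_left,
        inner_smul_right, inner_smul_right, hQ.cross _ _ (by simp [kind]),
        hQ.cross _ _ (by simp [kind])]
    · have hw' := assemble_inert (c := c) (out := out) hls hw S₂
      rw [hw.1, hs₁, hs₁, inner_smul_left, inner_smul_left,
        hQ.inner_slotSpan_right hw' (by simp [kind]), hQ.inner_slotSpan_right hw' (by simp [kind])]
    · rw [hs₁, hs₁, hp₂, hp₂, map_smul, map_smul, inner_smul_left, inner_smul_left,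
        inner_smul_right, inner_smul_right, hQ.cross _ _ (by simp [kind]),
        hQ.cross _ _ (by simp [kind])]
    · rw [hs₁, hs₁, hs₂, hs₂, map_smul, map_smul, inner_smul_left, inner_smul_left,
        inner_smul_right, inner_smul_right, hzs, hzs]
      push_cast
      rw [add_sub_add_right_eq_sub]
  · have hU : (assemble c ls out).U (ω.shift b) = (assemble c ls out).U ω := by cases ω <;> rfl
    obtain ⟨z, hp⟩ := assemble_pos (c := c) (out := out) hls S
    obtain ⟨y, g, hs⟩ := assemble_ext (c := c) (out := out) hls S
    have hm := assemble_U_slotSpan (c := c) (ls := ls) (out := out) ω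
    unfold prodUnembed
    rw [hU]
    rcases w.cases_inert with hw | ⟨t', rfl⟩ | ⟨k', rfl⟩ <;>
      try simp only [ep, es]
    · rw [hw.1]
    · rw [hp, hp, inner_smul_right, inner_smul_right, inner_slotSpan hm (by simp [kind]),
        inner_slotSpan hm (by simp [kind])]
    · rw [hs, hs, inner_smul_right, inner_smul_right, inner_slotSpan hm (by simp [kind]),
        inner_slotSpan hm (by simp [kind])]
  · obtain ⟨z, hp⟩ := assemble_pos (c := c) (out := out) hls S
    obtain ⟨y, g, hs⟩ := assemble_ext (c := c) (out := out) hls S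
    have hm : (assemble c ls out).Ain l s ∈ slotSpan := (hls _ (List.get_mem ls l)).Ain s
    unfold prodMlp
    rcases w.cases_inert with hw | ⟨t', rfl⟩ | ⟨k', rfl⟩ <;>
      try simp only [ep, es]
    · rw [hw.1]
    · rw [hp, hp, inner_smul_right, inner_smul_right, inner_slotSpan hm (by simp [kind]),
        inner_slotSpan hm (by simp [kind])]
    · rw [hs, hs, inner_smul_right, inner_smul_right, inner_slotSpan hm (by simp [kind]),
        inner_slotSpan hm (by simp [kind])]

theorem exists_int_inner {x y : Space} (hx : x ∈ intSpan e) (hy : y ∈ intSpan e) :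
    ∃ z : ℤ, ⟪x, y⟫_ℝ = z := by
  induction hx using AddSubgroup.closure_induction with
  | mem x hx =>
    obtain ⟨a, rfl⟩ := hx
    exact inner_intSpan orthonormal_e a hy
  | zero => exact ⟨0, by simp⟩
  | add x x' _ _ hx hx' =>
    obtain ⟨a, ha⟩ := hx
    obtain ⟨b, hb⟩ := hx'
    exact ⟨a + b, by rw [inner_add_left, ha, hb]; push_cast; rfl⟩
  | neg x _ hx =>
    obtain ⟨a, ha⟩ := hx
    exact ⟨-a, by rw [inner_neg_left, ha]; push_cast; rfl⟩

theorem exists_int_form {Q : Space →L[ℝ] Space} (hQ : IsForm Q) {x y : Space}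
    (hx : x ∈ intSpan e) (hy : y ∈ intSpan e) : ∃ z : ℤ, ⟪x, Q y⟫_ℝ = z := by
  induction hx using AddSubgroup.closure_induction with
  | mem x hx =>
    obtain ⟨a, rfl⟩ := hx
    induction hy using AddSubgroup.closure_induction with
    | mem y hy =>
      obtain ⟨b, rfl⟩ := hy
      exact hQ.int a b
    | zero => exact ⟨0, by simp⟩
    | add x x' _ _ hx hx' =>
      obtain ⟨a, ha⟩ := hx
      obtain ⟨b, hb⟩ := hx'
      exact ⟨a + b, by rw [map_add, inner_add_right, ha, hb]; push_cast; rfl⟩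
    | neg x _ hx =>
      obtain ⟨a, ha⟩ := hx
      exact ⟨-a, by rw [map_neg, inner_neg_right, ha]; push_cast; rfl⟩
  | zero => exact ⟨0, by simp⟩
  | add x x' _ _ hx hx' =>
    obtain ⟨a, ha⟩ := hx
    obtain ⟨b, hb⟩ := hx'
    exact ⟨a + b, by rw [inner_add_left, ha, hb]; push_cast; rfl⟩
  | neg x _ hx =>
    obtain ⟨a, ha⟩ := hx
    exact ⟨-a, by rw [inner_neg_left, ha]; push_cast; rfl⟩

include hls in
theorem assemble_isSymbolicLimit : (assemble c ls out).IsSymbolicLimit where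
  bounded := by
    refine ⟨1, fun t => ?_, fun k => (orthonormal_e.1 _).le⟩
    change ‖c.pos t‖ ≤ 1
    unfold Encoding.pos
    split_ifs
    · exact (orthonormal_e.1 _).le
    · simp
  unembed_bounded := by
    refine ⟨1, zero_le_one, fun v s _ => ?_⟩
    -- Only the row of the start symbol is nonzero, and it is a unit vector.
    have h1 : ∀ ω ∈ s, ω ≠ Symb.start → ⟪(assemble c ls out).U ω, v⟫_ℝ ^ 2 = 0 := by
      intro ω _ hω
      cases ω with
      | start => exact absurd rfl hω
      | _ => simp
    have h2 : ⟪(assemble c ls out).U .start, v⟫_ℝ ^ 2 ≤ (1 * ‖v‖) ^ 2 := by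
      rw [one_mul, ← sq_abs]
      refine pow_le_pow_left₀ (abs_nonneg _) ((abs_real_inner_le_norm _ _).trans ?_) 2
      change ‖e (slot out)‖ * ‖v‖ ≤ ‖v‖
      rw [orthonormal_e.1, one_mul]
    by_cases hs : Symb.start ∈ s
    · rw [Finset.sum_eq_single_of_mem _ hs fun ω hω hne => h1 ω hω hne]
      exact h2
    · rw [Finset.sum_eq_zero fun ω hω => h1 ω hω fun h => hs (h ▸ hω)]
      positivity
  precision := by
    have hI := assemble_isIntegral (c := c) (out := out) hls
    refine ⟨0, fun l h S₁ S₂ v w => ?_, fun S ω w => ?_, fun S l s w => ?_⟩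
    · obtain ⟨z, hz⟩ := exists_int_form (hls _ (List.get_mem ls l)).Q (hI.path S₁ _ v)
        (hI.path S₂ _ w)
      exact (show (assemble c ls out).prodAttn l h S₁ S₂ v w = z from hz) ▸ IsDyadic.int 0 z
    · obtain ⟨z, hz⟩ := exists_int_inner (hI.U ω) (hI.path S _ w)
      exact (show (assemble c ls out).prodUnembed S ω w = z from hz) ▸ IsDyadic.int 0 z
    · obtain ⟨z, hz⟩ := exists_int_inner (hI.Ain l s) (hI.path S _ w)
      exact (show (assemble c ls out).prodMlp S l s w = z from hz) ▸ IsDyadic.int 0 z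
  invariant := assemble_invariant hls
  isLocal := by
    have hQ : ∀ l : Fin ls.length, IsForm (ls.get l).Q := fun l => (hls _ (List.get_mem ls l)).Q
    choose zp Δ hp hp' using fun l => (hQ l).pos
    choose zs Δ' hs hs' using fun l => (hQ l).sym
    -- The sum of the radii of all layers serves as a common radius.
    refine ⟨∑ l, Δ l + ∑ l, Δ' l, fun k m hkm => ⟨fun l h S₁ S₂ => ?_, fun S => ?_⟩⟩
    · have b1 : Δ l ≤ ∑ l, Δ l := Finset.single_le_sum (fun _ _ => Nat.zero_le _) (Finset.mem_univ l)
      have b2 : Δ' l ≤ ∑ l, Δ' l :=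
        Finset.single_le_sum (fun _ _ => Nat.zero_le _) (Finset.mem_univ l)
      obtain ⟨z₁, hp₁⟩ := assemble_pos (c := c) (out := out) hls S₁
      obtain ⟨z₂, hp₂⟩ := assemble_pos (c := c) (out := out) hls S₂
      obtain ⟨y₁, g₁, hs₁⟩ := assemble_ext (c := c) (out := out) hls S₁
      obtain ⟨y₂, g₂, hs₂⟩ := assemble_ext (c := c) (out := out) hls S₂
      unfold prodAttn
      simp only [ContinuousLinearMap.id_apply]
      constructor
      · rw [hp₁, hp₂, map_smul, inner_smul_left, inner_smul_right, hp', hp l _ (by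
          rw [lt_abs]; omega)]
        simp
      · rw [hs₁, hs₂, map_smul, inner_smul_left, inner_smul_right, hs', hs l _ _ _ (by
          rw [lt_abs]; omega)]
        simp
    · exact inner_zero_left _

end Limit

/-! ## Running layers -/

/-- Unnormalised attention weight. -/
noncomputable def weight (Q : Space →L[ℝ] Space) (len : ℕ) (x y : Space) : ℝ :=
  roundBits 0 (Real.exp (Real.log len * roundBits 0 ⟪x, Q y⟫_ℝ))

/-- The attention block of a layer. -/
noncomputable def Layer.attn (a : Layer) (len : ℕ) (y : ℕ → Space) (i : ℕ) : Space :=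
  y i + (∑ j ∈ Finset.range (i + 1), weight a.Q len (y j) (y i))⁻¹ •
    ∑ j ∈ Finset.range (i + 1), weight a.Q len (y j) (y i) • a.V (y j)

/-- The effect of a layer. -/
noncomputable def Layer.step (a : Layer) (ε : ℝ) (len : ℕ) (y : ℕ → Space) (i : ℕ) : Space :=
  a.attn len y i + ∑ s, (a.act s).eval ε (⟪a.Ain s, a.attn len y i⟫_ℝ + a.b s) • a.Bout s

/-- The activations before the first layer. -/
noncomputable def Encoding.init (c : Encoding A) (w : Word A) (i : ℕ) : Space :=
  c.emb ((inputOf w).getD i Symb.start) + c.pos i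

/-- The activations after a list of layers. -/
noncomputable def run (c : Encoding A) (ε : ℝ) (w : Word A) (ls : List Layer) : ℕ → Space :=
  ls.foldl (fun y a => a.step ε (w.length + 1) y) (c.init w)

theorem run_append (c : Encoding A) (ε : ℝ) (w : Word A) (ls : List Layer) (a : Layer) :
    run c ε w (ls ++ [a]) = a.step ε (w.length + 1) (run c ε w ls) := by
  simp [run]

theorem state_assemble (c : Encoding A) (ε : ℝ) (w : Word A) (ls : List Layer) (out : ℕ)
    {l : ℕ} (hl : l ≤ ls.length) :
    (assemble c ls out).state ε (inputOf w) 0 0 l = run c ε w (ls.take l) := by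
  induction l with
  | zero =>
    funext i
    simp only [Transformer.state, Transformer.initState, Symb.shift_zero, List.take_zero, run,
      List.foldl_nil, Encoding.init, add_zero]
  | succ l ih =>
    have hl' : l < ls.length := hl
    rw [← List.take_concat_get' ls l hl', run_append, ← ih hl'.le]
    simp only [Transformer.state, hl', dif_pos]
    funext i
    have h1 : (assemble c ls out).attnBlock (inputOf w).length ⟨l, hl'⟩
        ((assemble c ls out).state ε (inputOf w) 0 0 l) i =
        ls[l].attn (w.length + 1) ((assemble c ls out).state ε (inputOf w) 0 0 l) i := by
      unfold Transformer.attnBlock Layer.attn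
      rw [Fintype.sum_unique, inputOf_length]
      rfl
    rw [h1]
    rfl

theorem accepts_assemble (c : Encoding A) (ε : ℝ) (w : Word A) (ls : List Layer) (out : ℕ) :
    (assemble c ls out).Accepts ε w ↔ 0 < ⟪e (slot out), run c ε w ls w.length⟫_ℝ := by
  unfold Transformer.Accepts Transformer.fn Transformer.output
  have := state_assemble c ε w ls out le_rfl
  rw [List.take_length] at this
  rw [← this]

end Residual

namespace Residual

open Coord Classical

/-! ## Attention weights for integer logits -/

theorem roundBits_int (z : ℤ) : roundBits 0 (z : ℝ) = z := by simp [roundBits]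

/-- The factor log len in the exponent turns an integer logit k into the integer len ^ k, so neither
rounding has any effect. -/
theorem weight_of_nat {Q : Space →L[ℝ] Space} {len : ℕ} {x y : Space} (hlen : 1 ≤ len) {k : ℕ}
    (h : ⟪x, Q y⟫_ℝ = k) : weight Q len x y = (len : ℝ) ^ k := by
  have h1 : roundBits 0 (k : ℝ) = k := by exact_mod_cast roundBits_int k
  have h2 : roundBits 0 ((len : ℝ) ^ k) = (len : ℝ) ^ k := by exact_mod_cast roundBits_int (len ^ k)
  rw [weight, h, h1, mul_comm, Real.exp_nat_mul, Real.exp_log (by exact_mod_cast hlen), h2]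

theorem weight_of_eq_zero {Q : Space →L[ℝ] Space} {len : ℕ} {x y : Space} (hlen : 1 ≤ len)
    (h : ⟪x, Q y⟫_ℝ = 0) : weight Q len x y = 1 := by
  rw [weight_of_nat hlen (k := 0) (by simpa using h), pow_zero]

/-- The weight is at most 1 / 4 and is rounded to 0. A logit of -1 would not do: at length 2 it
gives 1 / 2, which is rounded up. -/
theorem weight_of_le_neg_two {Q : Space →L[ℝ] Space} {len : ℕ} {x y : Space} (hlen : 2 ≤ len)
    {z : ℤ} (hz : z ≤ -2) (h : ⟪x, Q y⟫_ℝ = z) : weight Q len x y = 0 := by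
  have hl : (2 : ℝ) ≤ len := by exact_mod_cast hlen
  have hz' : (z : ℝ) ≤ -2 := by exact_mod_cast hz
  have h2 : Real.log 2 ≤ Real.log len := Real.log_le_log two_pos hl
  have h3 : 0 < Real.log 2 := Real.log_pos one_lt_two
  have h1 : Real.exp (Real.log len * z) ≤ 1 / 4 := by
    calc Real.exp (Real.log len * z) ≤ Real.exp (-(2 * Real.log 2)) := by
          apply Real.exp_le_exp.2; nlinarith
      _ = 1 / 4 := by
          rw [Real.exp_neg, show (2 : ℝ) * Real.log 2 = ((2 : ℕ) : ℝ) * Real.log 2 by norm_num,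
            Real.exp_nat_mul, Real.exp_log two_pos]
          norm_num
  have h0 := Real.exp_pos (Real.log len * z)
  have : round (Real.exp (Real.log len * z)) = 0 := by
    rw [round_eq_zero_iff]
    constructor <;> linarith
  rw [weight, h, roundBits_int]
  simp [roundBits, this]

/-! ## Two shapes of layers -/

/-- A layer without MLP. -/
noncomputable def attnLayer (Q V : Space →L[ℝ] Space) : Layer where
  Q := Q
  V := V
  Ain _ := 0
  b _ := 0
  Bout _ := 0
  act _ := .relu

theorem attnLayer_good {Q V : Space →L[ℝ] Space} (hQ : IsForm Q) (hV : IsMove V) :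
    (attnLayer Q V).Good where
  Q := hQ
  V := hV
  Ain _ := zero_mem _
  b _ := ⟨0, by simp [attnLayer]⟩
  Bout _ := zero_mem _

theorem inner_attnLayer_step (Q V : Space →L[ℝ] Space) (ε : ℝ) (len : ℕ) (y : ℕ → Space) (i : ℕ)
    (x : Space) : ⟪x, (attnLayer Q V).step ε len y i⟫_ℝ = ⟪x, y i⟫_ℝ +
      (∑ j ∈ Finset.range (i + 1), weight Q len (y j) (y i))⁻¹ *
        ∑ j ∈ Finset.range (i + 1), weight Q len (y j) (y i) * ⟪x, V (y j)⟫_ℝ := by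
  simp [Layer.step, Layer.attn, attnLayer, inner_add_right, inner_smul_right, inner_sum]

/-- An integer combination of slots. -/
noncomputable def row (r : List (ℤ × ℕ)) : Space := (r.map fun x => (x.1 : ℝ) • e (slot x.2)).sum

theorem row_mem (r : List (ℤ × ℕ)) : row r ∈ slotSpan := by
  refine list_sum_mem fun x hx => ?_
  obtain ⟨a, -, rfl⟩ := List.mem_map.1 hx
  rw [Int.cast_smul_eq_zsmul]
  exact zsmul_mem (e_mem_slotSpan _) _

theorem inner_row (r : List (ℤ × ℕ)) (y : Space) :
    ⟪row r, y⟫_ℝ = (r.map fun x => (x.1 : ℝ) * ⟪e (slot x.2), y⟫_ℝ).sum := by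
  induction r with
  | nil => simp [row]
  | cons x r ih =>
    have : row (x :: r) = (x.1 : ℝ) • e (slot x.2) + row r := by simp [row]
    rw [this, inner_add_left, ih, real_inner_smul_left]
    simp

/-- A hidden unit: the slots it reads, its bias, the sign with which it writes, its activation. -/
structure HiddenUnit where
  row : List (ℤ × ℕ)
  b : ℤ := 0
  sign : ℤ := 1
  act : Activation := .relu

/-- A layer without attention, that writes to slot `N`. -/
noncomputable def mlpLayer (u : Fin 4 → HiddenUnit) (N : ℕ) : Layer where
  Q := 0
  V := 0
  Ain s := row (u s).row
  b s := (u s).b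
  Bout s := row [((u s).sign, N)]
  act s := (u s).act

theorem mlpLayer_good (u : Fin 4 → HiddenUnit) (N : ℕ) : (mlpLayer u N).Good where
  Q := IsForm.zero
  V := IsMove.zero
  Ain _ := row_mem _
  b _ := ⟨_, rfl⟩
  Bout _ := row_mem _

/-- The value of a hidden unit when the slots have the values `v`. -/
noncomputable def HiddenUnit.eval (ε : ℝ) (u : HiddenUnit) (v : ℕ → ℝ) : ℝ :=
  u.sign * u.act.eval ε ((u.row.map fun x => (x.1 : ℝ) * v x.2).sum + u.b)

theorem inner_mlpLayer_step (u : Fin 4 → HiddenUnit) (N : ℕ) (ε : ℝ) (len : ℕ) (y : ℕ → Space)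
    (i : ℕ) (a : Coord) : ⟪e a, (mlpLayer u N).step ε len y i⟫_ℝ = ⟪e a, y i⟫_ℝ +
      if a = slot N then ∑ s, (u s).eval ε (fun f => ⟪e (slot f), y i⟫_ℝ) else 0 := by
  have h1 : (mlpLayer u N).attn len y i = y i := by simp [Layer.attn, mlpLayer]
  have h2 : ∀ s, ⟪e a, (mlpLayer u N).Bout s⟫_ℝ = if a = slot N then ((u s).sign : ℝ) else 0 := by
    intro s
    change ⟪e a, row [((u s).sign, N)]⟫_ℝ = _
    simp [row, inner_smul_right, inner_e]
  rw [Layer.step, h1, inner_add_right, inner_sum]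
  congr 1
  simp only [inner_smul_right, h2]
  split_ifs
  · refine Finset.sum_congr rfl fun s _ => ?_
    rw [HiddenUnit.eval, mul_comm, ← inner_row]
    rfl
  · simp

/-! ## Stages of the construction -/

variable {A : Type*}

/-- On all nonempty words, slot `f < N` has the given values. -/
def Has (c : Encoding A) (ε : ℝ) (ls : List Layer) (N f : ℕ) (φ : Word A → ℕ → ℝ) : Prop :=
  f < N ∧ ∀ w, w ≠ [] → ∀ i ≤ w.length, ⟪e (slot f), run c ε w ls i⟫_ℝ = φ w i

/-- The layers `ls` use the slots below `N` and the registers below `G`; the latter hold the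
preceding input symbols. -/
structure Stage (c : Encoding A) (ε : ℝ) (G : ℕ) (ls : List Layer) (N : ℕ) : Prop where
  good : ∀ a ∈ ls, a.Good
  start : Has c ε ls N 0 fun _ i => if i = 0 then 1 else 0
  letter : ∀ σ, Has c ε ls N (c.letter σ) fun w i =>
    if (inputOf w)[i]? = some (.fin σ) then 1 else 0
  fresh : ∀ w, w ≠ [] → ∀ i ≤ w.length, ∀ f, N ≤ f → ⟪e (slot f), run c ε w ls i⟫_ℝ = 0
  pos : c.usePos → ∀ w, w ≠ [] → ∀ i ≤ w.length, ∀ t,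
    ⟪e (pos t), run c ε w ls i⟫_ℝ = if t = i then 1 else 0
  freshReg : ∀ w, w ≠ [] → ∀ i ≤ w.length, ∀ g k, G ≤ g → ⟪e (sym g k), run c ε w ls i⟫_ℝ = 0
  reg : ∀ w, w ≠ [] → ∀ i ≤ w.length, ∀ g k, g < G → ⟪e (sym g k), run c ε w ls i⟫_ℝ =
    if g ≤ i ∧ (inputOf w)[i - g]? = some (.ext k) then 1 else 0
  one_le : 1 ≤ G

/-- All slots in use keep their values. -/
def Keeps (c : Encoding A) (ε : ℝ) (ls : List Layer) (N : ℕ) (ls' : List Layer) (N' : ℕ) : Prop :=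
  ∀ f φ, Has c ε ls N f φ → Has c ε ls' N' f φ

theorem Keeps.rfl {c : Encoding A} {ε : ℝ} {ls : List Layer} {N : ℕ} : Keeps c ε ls N ls N :=
  fun _ _ h => h

theorem Keeps.trans {c : Encoding A} {ε : ℝ} {ls ls' ls'' : List Layer} {N N' N'' : ℕ}
    (h : Keeps c ε ls N ls' N') (h' : Keeps c ε ls' N' ls'' N'') : Keeps c ε ls N ls'' N'' :=
  fun f φ hf => h' f φ (h f φ hf)

/-- Before the first layer. -/
theorem stage_nil (c : Encoding A) (ε : ℝ) {n : ℕ} (hinj : Function.Injective c.letter)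
    (hpos : ∀ σ, 1 ≤ c.letter σ) (hn : ∀ σ, c.letter σ ≤ n) : Stage c ε 1 [] (n + 1) := by
  have key : ∀ w i a, i ≤ w.length → ∃ s, (inputOf w)[i]? = some s ∧
      (s = .start ↔ i = 0) ∧
      ⟪e a, run c ε w [] i⟫_ℝ = ⟪e a, c.emb s⟫_ℝ + ⟪e a, c.pos i⟫_ℝ := by
    intro w i a hi
    have hlt : i < (inputOf w).length := by rw [inputOf_length]; omega
    refine ⟨(inputOf w)[i], List.getElem?_eq_getElem hlt, ?_, ?_⟩
    · cases i with
      | zero => simp [inputOf]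
      | succ i =>
        simp only [inputOf, List.getElem_cons_succ, List.getElem_map]
        cases w[i] <;> simp
    · simp only [run, List.foldl_nil, Encoding.init, inner_add_right]
      rw [List.getD_eq_getElem _ _ hlt]
  have hp : ∀ a i, a.kind ≠ 1 → ⟪e a, c.pos i⟫_ℝ = 0 := by
    intro a i ha
    unfold Encoding.pos
    split_ifs
    · rw [inner_e, if_neg]; rintro rfl; exact ha rfl
    · simp
  refine ⟨by simp, ⟨by omega, fun w _ i hi => ?_⟩, fun σ => ⟨by have := hn σ; omega,
    fun w _ i hi => ?_⟩, fun w _ i hi f hf => ?_, fun hu w _ i hi t => ?_,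
    fun w _ i hi g k hg => ?_, fun w _ i hi g k hg => ?_, le_rfl⟩
  · obtain ⟨s, h1, h2, h3⟩ := key w i (slot 0) hi
    rw [h3, hp _ _ (by simp [kind]), add_zero]
    simp only [← h2]
    cases s with
    | start => simp [Encoding.emb, orthonormal_e.1]
    | fin σ => have := hpos σ; simp [Encoding.emb, inner_e]; omega
    | ext k => simp [Encoding.emb, inner_e]
  · obtain ⟨s, h1, h2, h3⟩ := key w i (slot (c.letter σ)) hi
    rw [h3, hp _ _ (by simp [kind]), add_zero]
    simp only [h1]
    cases s with
    | start => have := hpos σ; simp [Encoding.emb, inner_e]; omega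
    | fin σ' => simp [Encoding.emb, inner_e, hinj.eq_iff, eq_comm]
    | ext k => simp [Encoding.emb, inner_e]
  · obtain ⟨s, h1, h2, h3⟩ := key w i (slot f) hi
    rw [h3, hp _ _ (by simp [kind]), add_zero]
    cases s with
    | start => simp [Encoding.emb, inner_e]; omega
    | fin σ' => have := hn σ'; simp [Encoding.emb, inner_e]; omega
    | ext k => simp [Encoding.emb, inner_e]
  · obtain ⟨s, h1, h2, h3⟩ := key w i (Coord.pos t) hi
    rw [h3, Encoding.pos, if_pos hu, inner_e]
    have : ⟪e (Coord.pos t), c.emb s⟫_ℝ = 0 := by cases s <;> simp [Encoding.emb, inner_e]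
    rw [this]
    simp
  · obtain ⟨s, h1, h2, h3⟩ := key w i (sym g k) hi
    rw [h3, hp _ _ (by simp [kind]), add_zero]
    cases s <;> simp [Encoding.emb, inner_e]
    omega
  · obtain ⟨s, h1, h2, h3⟩ := key w i (sym g k) hi
    obtain rfl : g = 0 := by omega
    rw [h3, hp _ _ (by simp [kind]), add_zero, Nat.sub_zero, h1]
    cases s <;> simp [Encoding.emb, inner_e, eq_comm]

/-- A layer that only writes to the fresh slot `N`. -/
theorem Stage.snoc {c : Encoding A} {ε : ℝ} {G N : ℕ} {ls : List Layer} (h : Stage c ε G ls N)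
    {a : Layer} (ha : a.Good) {φ : Word A → ℕ → ℝ}
    (hφ : ∀ w, w ≠ [] → ∀ i ≤ w.length, ∀ b,
      ⟪e b, a.step ε (w.length + 1) (run c ε w ls) i⟫_ℝ =
        ⟪e b, run c ε w ls i⟫_ℝ + if b = slot N then φ w i else 0) :
    Stage c ε G (ls ++ [a]) (N + 1) ∧ Keeps c ε ls N (ls ++ [a]) (N + 1) ∧
      Has c ε (ls ++ [a]) (N + 1) N φ := by
  have hk : Keeps c ε ls N (ls ++ [a]) (N + 1) := by
    rintro f ψ ⟨hf, hψ⟩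
    refine ⟨by omega, fun w hw i hi => ?_⟩
    rw [run_append, hφ w hw i hi, hψ w hw i hi, if_neg (by simp; omega), add_zero]
  refine ⟨⟨?_, hk _ _ h.start, fun σ => hk _ _ (h.letter σ), fun w hw i hi f hf => ?_,
    fun hu w hw i hi t => ?_, fun w hw i hi g k hg => ?_, fun w hw i hi g k hg => ?_, h.one_le⟩, hk,
    by omega, fun w hw i hi => ?_⟩
  · intro b hb
    rcases List.mem_append.1 hb with hb | hb
    · exact h.good b hb
    · rw [List.mem_singleton.1 hb]; exact ha
  · rw [run_append, hφ w hw i hi, h.fresh w hw i hi f (by omega), if_neg (by simp; omega), add_zero]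
  · rw [run_append, hφ w hw i hi, h.pos hu w hw i hi,
      if_neg (show ¬ Coord.pos t = slot N by simp), add_zero]
  · rw [run_append, hφ w hw i hi, h.freshReg w hw i hi g k hg, if_neg (by simp), add_zero]
  · rw [run_append, hφ w hw i hi, h.reg w hw i hi g k hg,
      if_neg (show ¬ sym g k = slot N by simp), add_zero]
  · rw [run_append, hφ w hw i hi, h.fresh w hw i hi N le_rfl, if_pos rfl, zero_add]

/-- A slot computed by hidden units. -/
theorem Stage.mlp {c : Encoding A} {ε : ℝ} {G N : ℕ} {ls : List Layer} (h : Stage c ε G ls N)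
    (u : Fin 4 → HiddenUnit) {φ : Word A → ℕ → ℝ}
    (hφ : ∀ w, w ≠ [] → ∀ i ≤ w.length, ∀ v : ℕ → ℝ,
      (∀ f ψ, Has c ε ls N f ψ → v f = ψ w i) → ∑ s, (u s).eval ε v = φ w i) :
    ∃ ls', Stage c ε G ls' (N + 1) ∧ Keeps c ε ls N ls' (N + 1) ∧ Has c ε ls' (N + 1) N φ :=
  ⟨_, h.snoc (mlpLayer_good u N) fun w hw i hi b => by
    rw [inner_mlpLayer_step, hφ w hw i hi _ fun f ψ hf => hf.2 w hw i hi]⟩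

/-- A slot computed by a head that averages the slot `s`. -/
theorem Stage.attn {c : Encoding A} {ε : ℝ} {G N : ℕ} {ls : List Layer} (h : Stage c ε G ls N)
    {Q : Space →L[ℝ] Space} (hQ : IsForm Q) {s : ℕ} {ψ : Word A → ℕ → ℝ} (hs : Has c ε ls N s ψ)
    {φ : Word A → ℕ → ℝ}
    (hφ : ∀ w, w ≠ [] → ∀ i ≤ w.length,
      (∑ j ∈ Finset.range (i + 1), weight Q (w.length + 1) (run c ε w ls j) (run c ε w ls i))⁻¹ *
        ∑ j ∈ Finset.range (i + 1), weight Q (w.length + 1) (run c ε w ls j) (run c ε w ls i) *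
          ψ w j = φ w i) :
    ∃ ls', Stage c ε G ls' (N + 1) ∧ Keeps c ε ls N ls' (N + 1) ∧ Has c ε ls' (N + 1) N φ := by
  refine ⟨_, h.snoc (attnLayer_good hQ (IsMove.slotOp s N)) fun w hw i hi b => ?_⟩
  rw [inner_attnLayer_step, ← hφ w hw i hi]
  congr 1
  simp only [slotOp_apply, inner_smul_right, inner_e]
  split_ifs with hb
  · congr 1
    refine Finset.sum_congr rfl fun j hj => ?_
    rw [hs.2 w hw j (by have := Finset.mem_range.1 hj; omega), mul_one]
  · simp

/-! ### Values of the forms -/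

section Forms

variable {c : Encoding A} {ε : ℝ} {G N : ℕ} {ls : List Layer} {w : Word A} {i j : ℕ}

theorem Has.slotOp {f f' : ℕ} {φ φ' : Word A → ℕ → ℝ} (h : Has c ε ls N f φ)
    (h' : Has c ε ls N f' φ') (hw : w ≠ []) (hi : i ≤ w.length) (hj : j ≤ w.length) :
    ⟪run c ε w ls j, slotOp f f' (run c ε w ls i)⟫_ℝ = φ w i * φ' w j := by
  rw [slotOp_apply, inner_smul_right, h.2 w hw i hi, real_inner_comm, h'.2 w hw j hj]

theorem Stage.posOp (h : Stage c ε G ls N) (hu : c.usePos) (hw : w ≠ []) (hi : i ≤ w.length)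
    (hj : j ≤ w.length) (d : ℕ) :
    ⟪run c ε w ls j, posOp d (run c ε w ls i)⟫_ℝ = if j + d = i then 1 else 0 := by
  rw [Residual.posOp, inner_transfer, tsum_eq_single j]
  · rw [h.pos hu w hw j hj, h.pos hu w hw i hi]
    simp
  · intro t ht
    rw [h.pos hu w hw j hj, if_neg (by simpa using ht), zero_mul]

/-- Each register holds at most one symbol, so the series over k has at most one nonzero term,
namely the k that witnesses the match. -/
theorem Stage.symOp (h : Stage c ε G ls N) (hw : w ≠ []) (hi : i ≤ w.length)
    (hj : j ≤ w.length) (m : MatchClause) (hδ : m.δ < G) (hγ : m.γ < G) :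
    ⟪run c ε w ls j, symOp m.δ m.γ m.τ (run c ε w ls i)⟫_ℝ = if m.Holds w i j then 1 else 0 := by
  rw [Residual.symOp, inner_transfer]
  have hval : ∀ k, ⟪e (sym m.δ (k + m.τ.toNat)), run c ε w ls j⟫_ℝ *
      ⟪e (sym m.γ (k + (-m.τ).toNat)), run c ε w ls i⟫_ℝ =
      if (m.δ ≤ j ∧ (inputOf w)[j - m.δ]? = some (.ext (k + m.τ.toNat))) ∧
        m.γ ≤ i ∧ (inputOf w)[i - m.γ]? = some (.ext (k + (-m.τ).toNat)) then 1 else 0 := by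
    intro k
    rw [h.reg w hw j hj _ _ hδ, h.reg w hw i hi _ _ hγ, ite_zero_mul_ite_zero, one_mul]
  simp only [hval]
  split_ifs with hm
  · obtain ⟨h1, h2, a, b, ha, hb, hab⟩ := hm
    rw [tsum_eq_single (a - m.τ.toNat), if_pos]
    · refine ⟨⟨h1, ?_⟩, h2, ?_⟩
      · rw [ha]; congr 2; omega
      · rw [hb]; congr 2; omega
    · intro k hk
      rw [if_neg]
      rintro ⟨⟨-, h3⟩, -⟩
      rw [ha] at h3
      simp only [Option.some.injEq, Symb.ext.injEq] at h3
      omega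
  · convert tsum_zero with k
    rw [if_neg]
    rintro ⟨⟨h1, h3⟩, h2, h4⟩
    exact hm ⟨h1, h2, _, _, h3, h4, by push_cast; omega⟩

end Forms

end Residual

namespace Residual

open Coord Classical

/-! ## Slots that hold the values of operations -/

variable {A : Type*}

/-- Slot `f` holds the truth value of `β`, and `0` at the start symbol. -/
def BoolAt (c : Encoding A) (ε : ℝ) (ls : List Layer) (N f : ℕ) (β : Word A → ℕ → Prop) : Prop :=
  Has c ε ls N f fun w i => if 1 ≤ i ∧ β w i then 1 else 0

/-- Slot `f` is bounded by `M` and approximates the count `κ` divided by the `k`-th power of the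
input length. -/
def CountAt (c : Encoding A) (ε : ℝ) (k M : ℕ) (ls : List Layer) (N f : ℕ)
    (κ : Word A → ℕ → ℤ) : Prop :=
  ∃ φ, Has c ε ls N f φ ∧ ∀ w, w ≠ [] → ∀ i ≤ w.length, |φ w i| ≤ M ∧ (1 ≤ i →
    |φ w i - κ w i / ((w.length + 1 : ℕ) : ℝ) ^ k| ≤
      M * (((w.length + 1 : ℕ) : ℝ) ^ 2 / (((w.length + 1 : ℕ) : ℝ) ^ k) ^ 2))

section

variable {c : Encoding A} {ε : ℝ} {G N N' k M : ℕ} {ls ls' : List Layer}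

theorem Keeps.bool (h : Keeps c ε ls N ls' N') {f : ℕ} {β : Word A → ℕ → Prop}
    (hf : BoolAt c ε ls N f β) : BoolAt c ε ls' N' f β := h _ _ hf

theorem Keeps.count (h : Keeps c ε ls N ls' N') {f : ℕ} {κ : Word A → ℕ → ℤ}
    (hf : CountAt c ε k M ls N f κ) : CountAt c ε k M ls' N' f κ := by
  obtain ⟨φ, h1, h2⟩ := hf
  exact ⟨φ, h _ _ h1, h2⟩

theorem Has.congr {f : ℕ} {φ φ' : Word A → ℕ → ℝ} (h : Has c ε ls N f φ)
    (hφ : ∀ w, w ≠ [] → ∀ i ≤ w.length, φ w i = φ' w i) : Has c ε ls N f φ' :=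
  ⟨h.1, fun w hw i hi => (h.2 w hw i hi).trans (hφ w hw i hi)⟩

theorem CountAt.congr {f : ℕ} {κ κ' : Word A → ℕ → ℤ} (h : CountAt c ε k M ls N f κ)
    (hκ : ∀ w, w ≠ [] → ∀ i ≤ w.length, 1 ≤ i → κ w i = κ' w i) : CountAt c ε k M ls N f κ' := by
  obtain ⟨φ, h1, h2⟩ := h
  exact ⟨φ, h1, fun w hw i hi => ⟨(h2 w hw i hi).1, fun hi1 =>
    hκ w hw i hi hi1 ▸ (h2 w hw i hi).2 hi1⟩⟩

theorem CountAt.mono {f M' : ℕ} {κ : Word A → ℕ → ℤ} (h : CountAt c ε k M ls N f κ)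
    (hM : M ≤ M') : CountAt c ε k M' ls N f κ := by
  obtain ⟨φ, h1, h2⟩ := h
  have hM' : (M : ℝ) ≤ M' := by exact_mod_cast hM
  refine ⟨φ, h1, fun w hw i hi => ⟨(h2 w hw i hi).1.trans hM', fun hi1 =>
    ((h2 w hw i hi).2 hi1).trans ?_⟩⟩
  gcongr

/-! ### Gadgets made of hidden units -/

/-- A hidden unit that does not write. -/
def HiddenUnit.off : HiddenUnit where
  row := []
  sign := 0

@[simp] theorem HiddenUnit.off_eval (v : ℕ → ℝ) : HiddenUnit.off.eval ε v = 0 := by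
  simp [HiddenUnit.eval, HiddenUnit.off]

theorem Stage.zero (h : Stage c ε G ls N) : ∃ ls', Stage c ε G ls' (N + 1) ∧
    Keeps c ε ls N ls' (N + 1) ∧ CountAt c ε k 0 ls' (N + 1) N fun _ _ => 0 := by
  obtain ⟨ls', h1, h2, h3⟩ := h.mlp (fun _ => .off) (φ := fun _ _ => 0) fun w hw i hi v hv => by
    simp
  exact ⟨ls', h1, h2, _, h3, by simp⟩

theorem Stage.one (h : Stage c ε G ls N) : ∃ ls', Stage c ε G ls' (N + 1) ∧
    Keeps c ε ls N ls' (N + 1) ∧ Has c ε ls' (N + 1) N fun _ _ => 1 :=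
  h.mlp ![{ row := [], act := .heaviside }, .off, .off, .off] fun w hw i hi v hv => by
    simp [Fin.sum_univ_four, HiddenUnit.eval, Activation.eval, HiddenUnit.off]

theorem Stage.top (h : Stage c ε G ls N) : ∃ ls', Stage c ε G ls' (N + 1) ∧
    Keeps c ε ls N ls' (N + 1) ∧ BoolAt c ε ls' (N + 1) N fun _ _ => True :=
  h.mlp ![{ row := [(-1, 0)], b := 1 }, .off, .off, .off] fun w hw i hi v hv => by
    have h0 := hv _ _ h.start
    rcases i.eq_zero_or_pos with rfl | hi1
    · simp [Fin.sum_univ_four, HiddenUnit.eval, Activation.eval, HiddenUnit.off, h0]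
    · simp [Fin.sum_univ_four, HiddenUnit.eval, Activation.eval, HiddenUnit.off, h0, hi1.ne', Nat.succ_le_of_lt hi1]

/-- The unit computes max(1 - f - start, 0); subtracting the start indicator keeps the slot at 0 on
the start symbol. -/
theorem Stage.neg (h : Stage c ε G ls N) {f : ℕ} {β : Word A → ℕ → Prop}
    (hf : BoolAt c ε ls N f β) : ∃ ls', Stage c ε G ls' (N + 1) ∧
    Keeps c ε ls N ls' (N + 1) ∧ BoolAt c ε ls' (N + 1) N fun w i => ¬ β w i :=
  h.mlp ![{ row := [(-1, f), (-1, 0)], b := 1 }, .off, .off, .off] fun w hw i hi v hv => by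
    have h0 := hv _ _ h.start
    have h1 := hv _ _ hf
    rcases i.eq_zero_or_pos with rfl | hi1
    · simp [Fin.sum_univ_four, HiddenUnit.eval, Activation.eval, HiddenUnit.off, h0, h1]
    · by_cases hb : β w i <;>
      simp [Fin.sum_univ_four, HiddenUnit.eval, Activation.eval, HiddenUnit.off, h0, h1, hi1.ne',
        Nat.succ_le_of_lt hi1, hb]

theorem Stage.and (h : Stage c ε G ls N) {f g : ℕ} {β γ : Word A → ℕ → Prop}
    (hf : BoolAt c ε ls N f β) (hg : BoolAt c ε ls N g γ) : ∃ ls', Stage c ε G ls' (N + 1) ∧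
    Keeps c ε ls N ls' (N + 1) ∧ BoolAt c ε ls' (N + 1) N fun w i => β w i ∧ γ w i :=
  h.mlp ![{ row := [(1, f), (1, g)], b := -1 }, .off, .off, .off] fun w hw i hi v hv => by
    have h1 := hv _ _ hf
    have h2 := hv _ _ hg
    rcases i.eq_zero_or_pos with rfl | hi1
    · simp [Fin.sum_univ_four, HiddenUnit.eval, Activation.eval, HiddenUnit.off, h1, h2]
    · by_cases hb : β w i <;> by_cases hc : γ w i <;>
      simp [Fin.sum_univ_four, HiddenUnit.eval, Activation.eval, HiddenUnit.off, h1, h2,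
        Nat.succ_le_of_lt hi1, hb, hc]

/-- In units of 1 / L ^ k the exact value 2n - 2m + 1 is an odd integer, so it is at distance at
least 1 from 0. The total error is at most (4M + 1) L ^ 2 / L ^ (2k), which stays below 1 / L ^ k
because 4M + 1 < 2 ^ (k - 2) ≤ L ^ (k - 2). -/
theorem le_iff_of_approx {L : ℝ} (hL : 2 ≤ L) (hk : 2 ≤ k) (hM : 4 * M + 1 < 2 ^ (k - 2))
    {x y o : ℝ} {m n : ℤ} (hx : |x - m / L ^ k| ≤ M * (L ^ 2 / (L ^ k) ^ 2))
    (hy : |y - n / L ^ k| ≤ M * (L ^ 2 / (L ^ k) ^ 2))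
    (ho : |o - 1 / L ^ k| ≤ L ^ 2 / (L ^ k) ^ 2) : 0 ≤ 2 * y - 2 * x + o ↔ m ≤ n := by
  have hP : (0 : ℝ) < L ^ k := by positivity
  have hML : (4 * M + 1 : ℝ) * L ^ 2 < L ^ k := by
    have h1 : (4 * M + 1 : ℝ) < 2 ^ (k - 2) := by exact_mod_cast hM
    have h2 : (2 : ℝ) ^ (k - 2) ≤ L ^ (k - 2) := pow_le_pow_left₀ (by norm_num) hL _
    have h3 : L ^ k = L ^ (k - 2) * L ^ 2 := by rw [← pow_add]; congr 1; omega
    rw [h3]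
    exact mul_lt_mul_of_pos_right (h1.trans_le h2) (by positivity)
  have hδ : (4 * M + 1 : ℝ) * (L ^ 2 / (L ^ k) ^ 2) < 1 / L ^ k := by
    rw [← mul_div_assoc, div_lt_div_iff₀ (by positivity) hP]
    nlinarith
  set q := 1 / L ^ k with hq
  have hq0 : 0 < q := by positivity
  rw [div_eq_mul_one_div, ← hq] at hx hy
  generalize L ^ 2 / (L ^ k) ^ 2 = δ at hx hy ho hδ
  rw [abs_le] at hx hy ho
  constructor
  · intro h
    by_contra! hlt
    have : ((n : ℝ) + 1) ≤ m := by exact_mod_cast hlt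
    have := mul_le_mul_of_nonneg_right this hq0.le
    linarith
  · intro h
    have : (m : ℝ) ≤ n := by exact_mod_cast h
    have := mul_le_mul_of_nonneg_right this hq0.le
    linarith

theorem Stage.le (h : Stage c ε G ls N) {f g o : ℕ} {κ μ : Word A → ℕ → ℤ} (hk : 2 ≤ k)
    (hM : 4 * M + 1 < 2 ^ (k - 2)) (hf : CountAt c ε k M ls N f κ)
    (hg : CountAt c ε k M ls N g μ) (ho : CountAt c ε k 1 ls N o fun _ _ => 1) :
    ∃ ls', Stage c ε G ls' (N + 1) ∧
    Keeps c ε ls N ls' (N + 1) ∧ BoolAt c ε ls' (N + 1) N fun w i => κ w i ≤ μ w i := by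
  obtain ⟨φ, hf, hφ⟩ := hf
  obtain ⟨χ, hg, hχ⟩ := hg
  obtain ⟨ω, ho, hω⟩ := ho
  -- The first three terms are at most 4M + 1 in absolute value, so the coefficient of the start
  -- slot forces the unit to be off at the start symbol.
  refine h.mlp ![{ row := [(2, g), (-2, f), (1, o), (-(4 * M + 2), 0)], act := .heaviside },
    .off, .off, .off] fun w hw i hi v hv => ?_
  have h0 := hv _ _ h.start
  have h1 := hv _ _ hf
  have h2 := hv _ _ hg
  have h3 := hv _ _ ho
  obtain ⟨a1, b1⟩ := hφ w hw i hi
  obtain ⟨a2, b2⟩ := hχ w hw i hi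
  obtain ⟨a3, b3⟩ := hω w hw i hi
  simp only [Fin.sum_univ_four, HiddenUnit.eval, Activation.eval, Matrix.cons_val_zero,
    Matrix.cons_val_one, Matrix.cons_val, HiddenUnit.off, h0, h1, h2, h3, List.map_cons,
    List.map_nil, List.sum_cons, List.sum_nil]
  rcases i.eq_zero_or_pos with rfl | hi1
  · rw [abs_le] at a1 a2 a3
    push_cast at a1 a2 a3 ⊢
    rw [if_neg (by simp; linarith)]
    simp
  · have hL : (2 : ℝ) ≤ ((w.length + 1 : ℕ) : ℝ) := by
      have := List.length_pos_of_ne_nil hw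
      exact_mod_cast (by omega : 2 ≤ w.length + 1)
    have key := le_iff_of_approx hL hk hM (b1 hi1) (b2 hi1) (by simpa using b3 hi1)
    have e1 : 0 ≤ ((2 : ℤ) : ℝ) * χ w i + (((-2 : ℤ) : ℝ) * φ w i + (((1 : ℤ) : ℝ) * ω w i +
        (((-(4 * M + 2) : ℤ) : ℝ) * (if i = 0 then 1 else 0) + 0))) + ((0 : ℤ) : ℝ) ↔
        κ w i ≤ μ w i := by
      rw [← key, if_neg hi1.ne']
      push_cast
      ring_nf
    simp only [e1]
    simp [Nat.succ_le_of_lt hi1]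

/-- A linear map through ReLU: x is the positive part of x minus the positive part of -x. Error
constants add up, independently of k. -/
theorem Stage.addSub (h : Stage c ε G ls N) {f g M' : ℕ} {κ μ : Word A → ℕ → ℤ} {s : ℤ}
    (hs : |s| = 1) (hf : CountAt c ε k M ls N f κ) (hg : CountAt c ε k M' ls N g μ) :
    ∃ ls', Stage c ε G ls' (N + 1) ∧ Keeps c ε ls N ls' (N + 1) ∧
      CountAt c ε k (M + M') ls' (N + 1) N fun w i => κ w i + s * μ w i := by
  obtain ⟨φ, hf, hφ⟩ := hf
  obtain ⟨χ, hg, hχ⟩ := hg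
  obtain ⟨ls', h1, h2, h3⟩ := h.mlp (φ := fun w i => φ w i + s * χ w i)
    ![{ row := [(1, f), (s, g)] }, { row := [(-1, f), (-s, g)], sign := -1 }, .off, .off]
    fun w hw i hi v hv => by
      have h1 := hv _ _ hf
      have h2 := hv _ _ hg
      simp only [Fin.sum_univ_four, HiddenUnit.eval, Activation.eval, Matrix.cons_val_zero,
        Matrix.cons_val_one, Matrix.cons_val, HiddenUnit.off, h1, h2, List.map_cons,
        List.map_nil, List.sum_cons, List.sum_nil]
      have := max_zero_sub_max_neg_zero_eq_self (φ w i + s * χ w i)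
      push_cast
      rw [show (-1 * φ w i + (-(s : ℝ) * χ w i + 0) + 0) = -(φ w i + s * χ w i) by ring,
        show (1 * φ w i + ((s : ℝ) * χ w i + 0) + 0) = (φ w i + s * χ w i) by ring]
      linarith
  have hs' : |(s : ℝ)| = 1 := by exact_mod_cast hs
  refine ⟨ls', h1, h2, _, h3, fun w hw i hi => ?_⟩
  obtain ⟨a1, b1⟩ := hφ w hw i hi
  obtain ⟨a2, b2⟩ := hχ w hw i hi
  constructor
  · refine (abs_add_le _ _).trans ?_
    rw [abs_mul, hs', one_mul]
    push_cast
    linarith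
  · intro hi1
    rw [show φ w i + s * χ w i - ((κ w i + s * μ w i : ℤ) : ℝ) / ((w.length + 1 : ℕ) : ℝ) ^ k =
      (φ w i - κ w i / ((w.length + 1 : ℕ) : ℝ) ^ k) +
        s * (χ w i - μ w i / ((w.length + 1 : ℕ) : ℝ) ^ k) by push_cast; ring]
    refine (abs_add_le _ _).trans ?_
    rw [abs_mul, hs', one_mul, Nat.cast_add M M', add_mul]
    exact add_le_add (b1 hi1) (b2 hi1)

/-- Gating by ReLU: both branches are bounded by M in absolute value, so lowering the preactivations
of the unselected branch by M switches its two units off, while the selected branch passes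
unchanged. -/
theorem Stage.cond (h : Stage c ε G ls N) {p f g : ℕ} {β : Word A → ℕ → Prop}
    {κ μ : Word A → ℕ → ℤ} (hp : BoolAt c ε ls N p β)
    (hf : CountAt c ε k M ls N f κ) (hg : CountAt c ε k M ls N g μ) :
    ∃ ls', Stage c ε G ls' (N + 1) ∧ Keeps c ε ls N ls' (N + 1) ∧
      CountAt c ε k M ls' (N + 1) N fun w i => if β w i then κ w i else μ w i := by
  obtain ⟨φ, hf, hφ⟩ := hf
  obtain ⟨χ, hg, hχ⟩ := hg
  obtain ⟨ls', h1, h2, h3⟩ := h.mlp (φ := fun w i => if 1 ≤ i ∧ β w i then φ w i else χ w i)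
    ![{ row := [(1, f), (M, p)], b := -M }, { row := [(-1, f), (M, p)], b := -M, sign := -1 },
      { row := [(1, g), (-M, p)] }, { row := [(-1, g), (-M, p)], sign := -1 }]
    fun w hw i hi v hv => by
      have h1 := hv _ _ hf
      have h2 := hv _ _ hg
      have h3 := hv _ _ hp
      have a1 := abs_le.1 (hφ w hw i hi).1
      have a2 := abs_le.1 (hχ w hw i hi).1
      simp only [Fin.sum_univ_four, HiddenUnit.eval, Activation.eval, Matrix.cons_val_zero,
        Matrix.cons_val_one, Matrix.cons_val, h1, h2, h3, List.map_cons,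
        List.map_nil, List.sum_cons, List.sum_nil]
      push_cast
      split_ifs
      · have := max_zero_sub_max_neg_zero_eq_self (φ w i)
        rw [max_eq_right (show (1 * χ w i + (-(M : ℝ) * 1 + 0) + 0) ≤ 0 by linarith),
          max_eq_right (show (-1 * χ w i + (-(M : ℝ) * 1 + 0) + 0) ≤ 0 by linarith),
          show (-1 * φ w i + ((M : ℝ) * 1 + 0) + -(M : ℝ)) = -φ w i by ring,
          show (1 * φ w i + ((M : ℝ) * 1 + 0) + -(M : ℝ)) = φ w i by ring]
        linarith
      · have := max_zero_sub_max_neg_zero_eq_self (χ w i)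
        rw [max_eq_right (show (1 * φ w i + ((M : ℝ) * 0 + 0) + -(M : ℝ)) ≤ 0 by linarith),
          max_eq_right (show (-1 * φ w i + ((M : ℝ) * 0 + 0) + -(M : ℝ)) ≤ 0 by linarith),
          show (-1 * χ w i + (-(M : ℝ) * 0 + 0) + 0) = -χ w i by ring,
          show (1 * χ w i + (-(M : ℝ) * 0 + 0) + 0) = χ w i by ring]
        linarith
  refine ⟨ls', h1, h2, _, h3, fun w hw i hi => ?_⟩
  obtain ⟨a1, b1⟩ := hφ w hw i hi
  obtain ⟨a2, b2⟩ := hχ w hw i hi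
  constructor
  · split_ifs <;> assumption
  · intro hi1
    simp only [hi1, true_and]
    split_ifs
    exacts [b1 hi1, b2 hi1]

end

end Residual

namespace Residual

open Coord Classical

/-! ### Gadgets made of attention heads -/

variable {A : Type*} {c : Encoding A} {ε : ℝ} {G N N' k M : ℕ} {ls ls' : List Layer}

theorem IsForm.intSmul {Q : Space →L[ℝ] Space} (h : IsForm Q) {x : ℝ} {m : ℤ} (hx : x = m) :
    IsForm (x • Q) := hx ▸ h.smul m

theorem sum_range_succ_eq_Icc (F : ℕ → ℝ) (i : ℕ) :
    ∑ j ∈ Finset.range (i + 1), F j = F 0 + ∑ j ∈ Finset.Icc 1 i, F j := by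
  rw [Finset.sum_range_succ', add_comm, Finset.range_eq_Ico, Finset.sum_Ico_add' F 0 i 1]
  rfl

/-- A head that attends to the start symbol with weight `len ^ k`, and otherwise evenly to the
positions with `χ`. -/
theorem Stage.count (h : Stage c ε G ls N) {Q : Space →L[ℝ] Space} (hQ : IsForm Q) {s : ℕ}
    {β : Word A → ℕ → Prop} (hs : BoolAt c ε ls N s β) {χ : Word A → ℕ → ℕ → Prop}
    (h0 : ∀ w, w ≠ [] → ∀ i ≤ w.length, 1 ≤ i →
      ⟪run c ε w ls 0, Q (run c ε w ls i)⟫_ℝ = k)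
    (h1 : ∀ w, w ≠ [] → ∀ i ≤ w.length, ∀ j, 1 ≤ j → j ≤ i →
      weight Q (w.length + 1) (run c ε w ls j) (run c ε w ls i) = if χ w i j then 1 else 0) :
    ∃ ls', Stage c ε G ls' (N + 1) ∧ Keeps c ε ls N ls' (N + 1) ∧
      CountAt c ε k 1 ls' (N + 1) N fun w i =>
        (((Finset.Icc 1 i).filter fun j => χ w i j ∧ β w j).card : ℤ) := by
  obtain ⟨ls', e1, e2, e3⟩ := h.attn hQ hs fun w hw i hi => rfl
  refine ⟨ls', e1, e2, _, e3, fun w hw i hi => ?_⟩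
  dsimp only
  rcases i.eq_zero_or_pos with rfl | hi1
  · simp
  have hL : (1 : ℝ) ≤ ((w.length + 1 : ℕ) : ℝ) := by exact_mod_cast Nat.succ_pos _
  have hiL : (i : ℝ) ≤ ((w.length + 1 : ℕ) : ℝ) := by exact_mod_cast (by omega : i ≤ w.length + 1)
  set L : ℝ := ((w.length + 1 : ℕ) : ℝ) with hLdef
  set m : ℕ := ((Finset.Icc 1 i).filter fun j => χ w i j ∧ β w j).card with hm
  set m' : ℕ := ((Finset.Icc 1 i).filter fun j => χ w i j).card with hm'
  have hmm : m ≤ m' := Finset.card_le_card (Finset.monotone_filter_right _ fun _ _ h => h.1)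
  have hmi : m' ≤ i := (Finset.card_filter_le _ _).trans (by simp)
  have hmm' : (m : ℝ) ≤ m' := by exact_mod_cast hmm
  have hmi' : (m' : ℝ) ≤ i := by exact_mod_cast hmi
  have s1 : ∑ j ∈ Finset.range (i + 1),
      weight Q (w.length + 1) (run c ε w ls j) (run c ε w ls i) = L ^ k + m' := by
    rw [sum_range_succ_eq_Icc, weight_of_nat (Nat.succ_pos _) (h0 w hw i hi hi1), hm',
      Finset.card_filter, Nat.cast_sum]
    congr 1
    refine Finset.sum_congr rfl fun j hj => ?_
    rw [Finset.mem_Icc] at hj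
    rw [h1 w hw i hi j hj.1 hj.2, Nat.cast_ite, Nat.cast_one, Nat.cast_zero]
  have s2 : ∑ j ∈ Finset.range (i + 1),
      weight Q (w.length + 1) (run c ε w ls j) (run c ε w ls i) *
        (if 1 ≤ j ∧ β w j then (1 : ℝ) else 0) = (m : ℝ) := by
    rw [sum_range_succ_eq_Icc, hm, Finset.card_filter]
    push_cast
    rw [if_neg (by simp), mul_zero, zero_add]
    refine Finset.sum_congr rfl fun j hj => ?_
    rw [Finset.mem_Icc] at hj
    rw [h1 w hw i hi j hj.1 hj.2, ite_zero_mul_ite_zero, one_mul]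
    simp [hj.1]
  -- The head outputs m / (L ^ k + m'), where m' positions are attended to and m of them are marked.
  -- It differs from m / L ^ k by m m' / (L ^ k (L ^ k + m')), and m, m' are at most L.
  rw [s1, s2]
  have hP : 0 < L ^ k := by positivity
  generalize L ^ k = P at hP ⊢
  have hm0 : (0 : ℝ) ≤ m := Nat.cast_nonneg _
  have hPm : 0 < P + m' := by linarith
  constructor
  · rw [abs_of_nonneg (by positivity), inv_mul_eq_div, div_le_iff₀ hPm]
    push_cast
    linarith
  · intro _
    have : (P + (m' : ℝ))⁻¹ * m - ((m : ℕ) : ℤ) / P = -(m * m' / (P * (P + m'))) := by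
      push_cast
      field_simp
      ring
    rw [this, abs_neg, abs_of_nonneg (by positivity), Nat.cast_one, one_mul, sq, sq]
    apply div_le_div₀ <;> nlinarith

/-- The query contributes the constant 1 and the key its start indicator, so the logit is k at the
start symbol and 0 elsewhere. -/
theorem Stage.countAll (h : Stage c ε G ls N) {s o : ℕ} {β : Word A → ℕ → Prop}
    (hs : BoolAt c ε ls N s β) (ho : Has c ε ls N o fun _ _ => 1) :
    ∃ ls', Stage c ε G ls' (N + 1) ∧ Keeps c ε ls N ls' (N + 1) ∧
      CountAt c ε k 1 ls' (N + 1) N fun w i =>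
        (((Finset.Icc 1 i).filter fun j => β w j).card : ℤ) := by
  have hv : ∀ w, w ≠ [] → ∀ i ≤ w.length, ∀ j ≤ w.length,
      ⟪run c ε w ls j, ((k : ℝ) • Residual.slotOp o 0) (run c ε w ls i)⟫_ℝ =
        k * if j = 0 then 1 else 0 := by
    intro w hw i hi j hj
    rw [smul_apply, inner_smul_right, ho.slotOp h.start hw hi hj, one_mul]
  obtain ⟨ls', h1, h2, h3⟩ := h.count (k := k)
    ((IsForm.slotOp o 0).intSmul (x := k) (m := k) (by simp)) hs
    (χ := fun _ _ _ => True)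
    (fun w hw i hi _ => by rw [hv w hw i hi 0 (Nat.zero_le _), if_pos rfl, mul_one])
    (fun w hw i hi j hj1 hj => by
      rw [if_pos trivial]
      refine weight_of_eq_zero (Nat.succ_pos _) ?_
      rw [hv w hw i hi j (hj.trans hi), if_neg (by omega), mul_zero])
  exact ⟨ls', h1, h2, by simpa using h3⟩

/-- The form that counts the clauses that hold. -/
noncomputable def matchForm (χ : List MatchClause) : Space →L[ℝ] Space :=
  (χ.map fun m => symOp m.δ m.γ m.τ).sum

theorem isForm_matchForm (χ : List MatchClause) : IsForm (matchForm χ) := by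
  induction χ with
  | nil => exact IsForm.zero
  | cons m χ ih => simpa [matchForm] using (IsForm.symOp m.δ m.γ m.τ).add ih

theorem Stage.inner_matchForm (h : Stage c ε G ls N) {w : Word A} {i j : ℕ} (hw : w ≠ [])
    (hi : i ≤ w.length) (hj : j ≤ w.length) (χ : List MatchClause)
    (hχ : ∀ m ∈ χ, m.δ < G ∧ m.γ < G) :
    ⟪run c ε w ls j, matchForm χ (run c ε w ls i)⟫_ℝ =
      (χ.countP fun m => m.Holds w i j : ℕ) := by
  induction χ with
  | nil => simp [matchForm]
  | cons m χ ih =>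
    have : matchForm (m :: χ) = Residual.symOp m.δ m.γ m.τ + matchForm χ := by simp [matchForm]
    rw [this, add_apply, inner_add_right,
      ih fun m' hm' => hχ m' (List.mem_cons_of_mem _ hm'),
      h.symOp hw hi hj m (hχ m List.mem_cons_self).1 (hχ m List.mem_cons_self).2,
      List.countP_cons, add_comm]
    by_cases hm : m.Holds w i j <;> simp [hm]

/-- At ordinary keys the logit is twice the number of clauses that hold minus twice the number of
all clauses: 0 if the conjunction holds and at most -2 otherwise, so rounding makes the conjunction
exact. -/
theorem Stage.countMatch (h : Stage c ε G ls N) {t o : ℕ}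
    (ht : BoolAt c ε ls N t fun _ _ => True) (ho : Has c ε ls N o fun _ _ => 1)
    (χ : List MatchClause) (hχ : ∀ m ∈ χ, m.δ < G ∧ m.γ < G) :
    ∃ ls', Stage c ε G ls' (N + 1) ∧ Keeps c ε ls N ls' (N + 1) ∧
      CountAt c ε k 1 ls' (N + 1) N fun w i =>
        (((Finset.Icc 1 i).filter fun j => ∀ m ∈ χ, m.Holds w i j).card : ℤ) := by
  have hv : ∀ w, w ≠ [] → ∀ i ≤ w.length, ∀ j ≤ w.length,
      ⟪run c ε w ls j, ((2 : ℝ) • matchForm χ + ((-2 * χ.length : ℝ) • Residual.slotOp o o +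
        (k + 2 * χ.length : ℝ) • Residual.slotOp o 0)) (run c ε w ls i)⟫_ℝ =
        ((2 * (χ.countP fun m => m.Holds w i j : ℕ) + (-2 * χ.length +
          (k + 2 * χ.length) * if j = 0 then 1 else 0) : ℤ) : ℝ) := by
    intro w hw i hi j hj
    simp only [add_apply, smul_apply, inner_smul_right, inner_add_right, ho.slotOp h.start hw hi hj,
      ho.slotOp ho hw hi hj, one_mul, h.inner_matchForm hw hi hj χ hχ]
    push_cast
    ring
  have hQ : IsForm ((2 : ℝ) • matchForm χ + ((-2 * χ.length : ℝ) • Residual.slotOp o o +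
      (k + 2 * χ.length : ℝ) • Residual.slotOp o 0)) :=
    ((isForm_matchForm χ).intSmul (m := 2) (by simp)).add
      (((IsForm.slotOp o o).intSmul (m := -2 * χ.length) (by push_cast; rfl)).add
        ((IsForm.slotOp o 0).intSmul (m := k + 2 * χ.length) (by push_cast; rfl)))
  obtain ⟨ls', h1, h2, h3⟩ := h.count (k := k) hQ ht
    (χ := fun w i j => ∀ m ∈ χ, m.Holds w i j)
    (fun w hw i hi _ => by
      rw [hv w hw i hi 0 (Nat.zero_le _), if_pos rfl]
      -- No clause holds at the start key: it would need δ = 0 and an extended symbol at index 0.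
      -- Hence the correction k + 2|χ| leaves the logit exactly k there.
      have : (χ.countP fun m => m.Holds w i 0) = 0 := by
        rw [List.countP_eq_zero]
        rintro m - hm
        obtain ⟨h1, -, a, b, ha, -⟩ := of_decide_eq_true hm
        obtain hδ : m.δ = 0 := by omega
        simp [hδ, inputOf] at ha
      rw [this]
      push_cast
      ring)
    (fun w hw i hi j hj1 hj => by
      have hc := hv w hw i hi j (hj.trans hi)
      rw [if_neg (by omega), mul_zero, add_zero] at hc
      split_ifs with hm
      · refine weight_of_eq_zero (Nat.succ_pos _) ?_
        have : (χ.countP fun m => m.Holds w i j) = χ.length := by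
          rw [List.countP_eq_length]
          exact fun m hmem => decide_eq_true (hm m hmem)
        rw [hc, this]
        push_cast
        ring
      · refine weight_of_le_neg_two ?_ ?_ hc
        · have := List.length_pos_of_ne_nil hw
          omega
        · have h1 : (χ.countP fun m => m.Holds w i j) ≤ χ.length := List.countP_le_length
          have h2 : (χ.countP fun m => m.Holds w i j) ≠ χ.length := by
            rw [Ne, List.countP_eq_length]
            exact fun hall => hm fun m hmem => of_decide_eq_true (hall m hmem)
          omega)
  exact ⟨ls', h1, h2, by simpa using h3⟩

/-- The form by which a query selects the key `d` places back. -/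
noncomputable def backForm (o d : ℕ) : Space →L[ℝ] Space :=
  (2 : ℝ) • Residual.posOp d + (-2 : ℝ) • Residual.slotOp o o

theorem isForm_backForm (o d : ℕ) : IsForm (backForm o d) :=
  ((IsForm.posOp d).intSmul (m := 2) (by simp)).add
    ((IsForm.slotOp o o).intSmul (m := -2) (by simp))

theorem Stage.weight_backForm (h : Stage c ε G ls N) (hu : c.usePos) {o : ℕ}
    (ho : Has c ε ls N o fun _ _ => 1) {w : Word A} {i j : ℕ} (hw : w ≠ []) (hi : i ≤ w.length)
    (hj : j ≤ i) (d : ℕ) :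
    weight (backForm o d) (w.length + 1) (run c ε w ls j) (run c ε w ls i) =
      if j + d = i then 1 else 0 := by
  have hv : ⟪run c ε w ls j, backForm o d (run c ε w ls i)⟫_ℝ =
      2 * (if j + d = i then 1 else 0) - 2 := by
    rw [backForm, add_apply, smul_apply, smul_apply, inner_add_right, inner_smul_right,
      inner_smul_right, h.posOp hu hw hi (hj.trans hi), ho.slotOp ho hw hi (hj.trans hi)]
    ring
  split_ifs with hd
  · exact weight_of_eq_zero (Nat.succ_pos _) (by rw [hv, if_pos hd]; ring)
  · refine weight_of_le_neg_two ?_ le_rfl (by rw [hv, if_neg hd]; push_cast; ring)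
    have := List.length_pos_of_ne_nil hw
    omega

/-- Averaging with these weights. -/
theorem average_back (i d : ℕ) {ω : ℕ → ℝ}
    (hω : ∀ j ∈ Finset.range (i + 1), ω j = if j + d = i then 1 else 0) (F : ℕ → ℝ) :
    (∑ j ∈ Finset.range (i + 1), ω j)⁻¹ * ∑ j ∈ Finset.range (i + 1), ω j * F j =
        if d ≤ i then F (i - d) else 0 := by
  have hF : ∀ j ∈ Finset.range (i + 1), ω j * F j = (if j + d = i then 1 else 0) * F j :=
    fun j hj => by rw [hω j hj]
  rw [Finset.sum_congr rfl hω, Finset.sum_congr rfl hF]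
  split_ifs with hd
  · have key : ∀ j, j + d = i ↔ j = i - d := by omega
    simp only [key, ite_mul, one_mul, zero_mul, Finset.sum_ite_eq', Finset.mem_range]
    rw [if_pos (by omega), if_pos (by omega)]
    simp
  · rw [Finset.sum_eq_zero fun j _ => if_neg (by omega)]
    simp

theorem Stage.back (h : Stage c ε G ls N) (hu : c.usePos) {o s : ℕ}
    (ho : Has c ε ls N o fun _ _ => 1) {β : Word A → ℕ → Prop} (hs : BoolAt c ε ls N s β) (d : ℕ) :
    ∃ ls', Stage c ε G ls' (N + 1) ∧ Keeps c ε ls N ls' (N + 1) ∧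
      BoolAt c ε ls' (N + 1) N fun w i => d < i ∧ β w (i - d) := by
  refine h.attn (isForm_backForm o d) hs fun w hw i hi => ?_
  have : ∀ j ∈ Finset.range (i + 1), weight (backForm o d) (w.length + 1) (run c ε w ls j)
      (run c ε w ls i) = if j + d = i then 1 else 0 := fun j hj =>
    h.weight_backForm hu ho hw hi (by have := Finset.mem_range.1 hj; omega) d
  rw [average_back i d this]
  by_cases hd : d ≤ i
  · rw [if_pos hd]
    congr 1
    simp only [eq_iff_iff]
    constructor
    · rintro ⟨h1, h2⟩; exact ⟨by omega, by omega, h2⟩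
    · rintro ⟨h1, h2, h3⟩; exact ⟨by omega, h3⟩
  · rw [if_neg hd, if_neg]
    rintro ⟨h1, h2, h3⟩
    omega

theorem inner_e_regOp (g g' : ℕ) (a : Coord) (y : Space) :
    ⟪e a, regOp g g' y⟫_ℝ = match a with
      | sym h k => if h = g' then ⟪e (sym g k), y⟫_ℝ else 0
      | _ => 0 := by
  cases a with
  | slot f => exact inner_e_transfer_of_notMem _ _ (by rintro ⟨k, hk⟩; simp at hk) _
  | pos f => exact inner_e_transfer_of_notMem _ _ (by rintro ⟨k, hk⟩; simp at hk) _
  | sym h k =>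
    dsimp only
    split_ifs with hh
    · subst hh
      simpa [regOp] using inner_e_transfer (sym_injective h 0) (sym_injective g 0) k y
    · exact inner_e_transfer_of_notMem _ _ (by rintro ⟨k, hk⟩; simp at hk; exact hh hk.1.symm) _

/-- One more register. -/
theorem Stage.addReg (h : Stage c ε G ls N) (hu : c.usePos) {o : ℕ}
    (ho : Has c ε ls N o fun _ _ => 1) :
    ∃ ls', Stage c ε (G + 1) ls' N ∧ Keeps c ε ls N ls' N := by
  have hG := h.one_le
  -- The head copies the current symbol of the position G places back into the fresh register G.
  set a := attnLayer (backForm o G) (regOp 0 G) with ha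
  have hstep : ∀ w, w ≠ [] → ∀ i ≤ w.length, ∀ b, ⟪e b, run c ε w (ls ++ [a]) i⟫_ℝ =
      ⟪e b, run c ε w ls i⟫_ℝ +
        if G ≤ i then ⟪e b, regOp 0 G (run c ε w ls (i - G))⟫_ℝ else 0 := by
    intro w hw i hi b
    have : ∀ j ∈ Finset.range (i + 1), weight (backForm o G) (w.length + 1) (run c ε w ls j)
        (run c ε w ls i) = if j + G = i then 1 else 0 := fun j hj =>
      h.weight_backForm hu ho hw hi (by have := Finset.mem_range.1 hj; omega) G
    rw [run_append, ha, inner_attnLayer_step, average_back i G this]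
  have hkeep : ∀ w, w ≠ [] → ∀ i ≤ w.length, ∀ b, (∀ k, b ≠ sym G k) →
      ⟪e b, run c ε w (ls ++ [a]) i⟫_ℝ = ⟪e b, run c ε w ls i⟫_ℝ := by
    intro w hw i hi b hb
    rw [hstep w hw i hi, inner_e_regOp]
    cases b with
    | slot f => simp
    | pos f => simp
    | sym g k =>
      have : g ≠ G := fun hg => hb k (by rw [hg])
      simp [this]
  have hk : Keeps c ε ls N (ls ++ [a]) N := fun f φ hf =>
    ⟨hf.1, fun w hw i hi => by rw [hkeep w hw i hi _ (by simp), hf.2 w hw i hi]⟩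
  refine ⟨_, ⟨?_, hk _ _ h.start, fun σ => hk _ _ (h.letter σ), fun w hw i hi f hf => ?_,
    fun hu w hw i hi t => ?_, fun w hw i hi g k hg => ?_, fun w hw i hi g k hg => ?_, by omega⟩, hk⟩
  · intro b hb
    rcases List.mem_append.1 hb with hb | hb
    · exact h.good b hb
    · rw [List.mem_singleton.1 hb]
      exact attnLayer_good (isForm_backForm o G) (IsMove.regOp 0 G)
  · rw [hkeep w hw i hi _ (by simp), h.fresh w hw i hi f hf]
  · rw [hkeep w hw i hi _ (by simp), h.pos hu w hw i hi]
  · rw [hkeep w hw i hi _ (by simp; omega), h.freshReg w hw i hi g k (by omega)]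
  · rcases (Nat.lt_succ_iff.1 hg).lt_or_eq with hg | rfl
    · rw [hkeep w hw i hi _ (by simp; omega), h.reg w hw i hi g k hg]
    · rw [hstep w hw i hi, h.freshReg w hw i hi g k le_rfl, inner_e_regOp, zero_add]
      dsimp only
      by_cases hgi : g ≤ i
      · rw [if_pos hgi, if_pos rfl, h.reg w hw (i - g) (by omega) 0 k hG]
        simp [hgi]
      · simp [hgi]

theorem Stage.addRegs (h : Stage c ε G ls N) (hu : c.usePos) {o : ℕ}
    (ho : Has c ε ls N o fun _ _ => 1) {G' : ℕ} (hG : G ≤ G') :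
    ∃ ls', Stage c ε G' ls' N ∧ Keeps c ε ls N ls' N := by
  induction G', hG using Nat.le_induction with
  | base => exact ⟨ls, h, Keeps.rfl⟩
  | succ G' hG ih =>
    obtain ⟨ls', h1, h2⟩ := ih
    obtain ⟨ls'', h3, h4⟩ := h1.addReg hu (h2 _ _ ho)
    exact ⟨ls'', h3, h2.trans h4⟩

end Residual

namespace Residual

open Coord Classical

/-! ## Compiling programs -/

variable {A : Type*} {c : Encoding A} {ε : ℝ} {k M N N' : ℕ} {ls ls' : List Layer} {o t u : ℕ}

/-- A stage with the constant `1`, the constant `⊤` and the count `1` in slots `o`, `t`, `u`. -/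
structure Ready (c : Encoding A) (ε : ℝ) (k : ℕ) (ls : List Layer) (N o t u : ℕ) : Prop where
  stage : ∃ G, Stage c ε G ls N
  one : Has c ε ls N o fun _ _ => 1
  top : BoolAt c ε ls N t fun _ _ => True
  unit : CountAt c ε k 1 ls N u fun _ _ => 1

theorem Ready.keeps {G : ℕ} (h : Ready c ε k ls N o t u) (h' : Stage c ε G ls' N')
    (hk : Keeps c ε ls N ls' N') : Ready c ε k ls' N' o t u :=
  ⟨⟨G, h'⟩, hk _ _ h.one, hk.bool h.top, hk.count h.unit⟩

/-- Uniform attention to the start indicator gives 1 / (i + 1). The threshold 2 / (i + 1) ≥ 1 is met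
only for i ≤ 1, and i = 0 is excluded by subtracting the start slot twice. -/
theorem Stage.isFirst {G : ℕ} (h : Stage c ε G ls N) : ∃ ls', Stage c ε G ls' (N + 2) ∧
    Keeps c ε ls N ls' (N + 2) ∧ BoolAt c ε ls' (N + 2) (N + 1) fun _ i => i = 1 := by
  obtain ⟨ls₁, h1, k1, f1⟩ := h.attn IsForm.zero h.start (φ := fun _ i => ((i : ℝ) + 1)⁻¹)
    fun w hw i hi => by
      have : ∀ j, weight 0 (w.length + 1) (run c ε w ls j) (run c ε w ls i) = 1 := fun j =>
        weight_of_eq_zero (Nat.succ_pos _) (by simp)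
      simp [this]
  obtain ⟨ls₂, h2, k2, f2⟩ := h1.mlp (φ := fun _ i => if 1 ≤ i ∧ i = 1 then 1 else 0)
    ![{ row := [(2, N), (-2, 0)], b := -1, act := .heaviside }, .off, .off, .off]
    fun w hw i hi v hv => by
      have e1 := hv _ _ f1
      have e2 := hv _ _ h1.start
      simp only [Fin.sum_univ_four, HiddenUnit.eval, Activation.eval, Matrix.cons_val_zero,
        Matrix.cons_val_one, Matrix.cons_val, HiddenUnit.off, e1, e2, List.map_cons,
        List.map_nil, List.sum_cons, List.sum_nil]
      rcases i with _ | _ | i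
      · norm_num
      · norm_num
      · have hi0 : (0 : ℝ) ≤ i := Nat.cast_nonneg _
        rw [if_neg]
        · simp
        · rw [not_le]
          have : ((i + 1 + 1 : ℕ) + 1 : ℝ)⁻¹ < 1 / 2 := by
            rw [inv_lt_comm₀ (by positivity) (by norm_num)]
            push_cast
            norm_num
            linarith
          push_cast at this ⊢
          linarith
  exact ⟨ls₂, h2, k1.trans k2, Has.congr f2 fun _ _ _ _ => by congr⟩

/-- The count 1, scaled like all other counts, is obtained by counting the first position. -/
theorem exists_ready (c : Encoding A) (ε : ℝ) {n : ℕ} (hinj : Function.Injective c.letter)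
    (hpos : ∀ σ, 1 ≤ c.letter σ) (hn : ∀ σ, c.letter σ ≤ n) (k : ℕ) :
    ∃ ls N o t u, Ready c ε k ls N o t u := by
  obtain ⟨ls₁, h1, k1, f1⟩ := (stage_nil c ε hinj hpos hn).one
  obtain ⟨ls₂, h2, k2, f2⟩ := h1.top
  obtain ⟨ls₃, h3, k3, f3⟩ := h2.isFirst
  obtain ⟨ls₄, h4, k4, f4⟩ := h3.countAll (k := k) f3 (k3 _ _ (k2 _ _ f1))
  refine ⟨_, _, _, _, _, ⟨_, h4⟩, k4 _ _ (k3 _ _ (k2 _ _ f1)), k4.bool (k3.bool f2),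
    f4.congr fun w hw i hi hi1 => ?_⟩
  rw [Nat.cast_eq_one, Finset.card_eq_one]
  refine ⟨1, ?_⟩
  ext j
  simp only [Finset.mem_filter, Finset.mem_Icc, Finset.mem_singleton]
  omega

theorem Ready.boolOp (h : Ready c ε k ls N o t u) (hk : 4 * M + 3 ≤ k) {nb nc : ℕ}
    (op : BoolOp A nb nc) {β : Fin nb → Word A → ℕ → Prop} {κ : Fin nc → Word A → ℕ → ℤ}
    (hβ : ∀ p, ∃ f, BoolAt c ε ls N f (β p)) (hκ : ∀ q, ∃ f, CountAt c ε k M ls N f (κ q)) :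
    ∃ ls' N', Ready c ε k ls' N' o t u ∧ Keeps c ε ls N ls' N' ∧
      ∃ f, BoolAt c ε ls' N' f fun w => op.eval w (fun p => β p w) fun q => κ q w := by
  obtain ⟨G, hG⟩ := h.stage
  cases op with
  | query σ =>
    refine ⟨ls, N, h, Keeps.rfl, _, (hG.letter σ).congr fun w hw i hi => ?_⟩
    rcases i.eq_zero_or_pos with rfl | hi1
    · simp [inputOf]
    · simp [BoolOp.eval, Nat.succ_le_of_lt hi1]
  | neg p =>
    obtain ⟨f, hf⟩ := hβ p
    obtain ⟨ls', h1, h2, h3⟩ := hG.neg hf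
    exact ⟨ls', _, h.keeps h1 h2, h2, _, h3⟩
  | and p q =>
    obtain ⟨f, hf⟩ := hβ p
    obtain ⟨g, hg⟩ := hβ q
    obtain ⟨ls', h1, h2, h3⟩ := hG.and hf hg
    exact ⟨ls', _, h.keeps h1 h2, h2, _, h3⟩
  | top => exact ⟨ls, N, h, Keeps.rfl, _, h.top⟩
  | le p q =>
    obtain ⟨f, hf⟩ := hκ p
    obtain ⟨g, hg⟩ := hκ q
    -- The condition on k is linear in M, which is more than enough here.
    have h2k : 4 * M + 1 < 2 ^ (k - 2) :=
      (by omega : 4 * M + 1 ≤ k - 2).trans_lt Nat.lt_two_pow_self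
    obtain ⟨ls', h1, h2, h3⟩ := hG.le (by omega) h2k hf hg h.unit
    exact ⟨ls', _, h.keeps h1 h2, h2, _, h3⟩

/-- A fixed finite set of displacements is handled one by one: a head looks d places back, and
`cond` turns the truth value into the scaled count 1 or 0. -/
theorem Ready.countBack (h : Ready c ε k ls N o t u) (hu : c.usePos) {s : ℕ}
    {β : Word A → ℕ → Prop} (hs : BoolAt c ε ls N s β) (S : Finset ℕ) :
    ∃ ls' N', Ready c ε k ls' N' o t u ∧ Keeps c ε ls N ls' N' ∧
      ∃ f, CountAt c ε k S.card ls' N' f fun w i => ((S.filter fun d => d < i ∧ β w (i - d)).card : ℤ) := by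
  induction S using Finset.induction_on with
  | empty =>
    obtain ⟨G, hG⟩ := h.stage
    obtain ⟨ls', h1, h2, h3⟩ := hG.zero (k := k)
    exact ⟨ls', _, h.keeps h1 h2, h2, _, by simpa using h3⟩
  | insert d S hd ih =>
    obtain ⟨ls₁, N₁, r1, k1, f, hf⟩ := ih
    obtain ⟨G, hG⟩ := r1.stage
    obtain ⟨ls₂, h2, k2, f2⟩ := hG.back hu r1.one (k1.bool hs) d
    obtain ⟨ls₃, h3, k3, f3⟩ := h2.zero (k := k)
    obtain ⟨ls₄, h4, k4, f4⟩ := h3.cond (k3.bool f2) (k3.count (k2.count r1.unit))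
      (f3.mono zero_le_one)
    have k5 := (k2.trans k3).trans k4
    obtain ⟨ls₆, h6, k6, f6⟩ := h4.addSub (s := 1) (by simp) f4 (k5.count hf)
    refine ⟨ls₆, _, r1.keeps h6 (k5.trans k6), k1.trans (k5.trans k6),
      N₁ + 1 + 1 + 1, ?_⟩
    rw [Finset.card_insert_of_notMem hd, add_comm]
    refine f6.congr fun w hw i hi hi1 => ?_
    rw [Finset.filter_insert]
    split_ifs
    · rw [Finset.card_insert_of_notMem (by simp [hd])]
      push_cast
      ring
    · ring

/-- By translation invariance ψ depends only on the displacement i - j, read off at j = 1, and by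
locality only displacements up to r matter. -/
theorem card_filter_rel {ψ : ℕ → ℕ → Prop} {r : ℕ}
    (h1 : ∀ i j t : ℕ, 1 ≤ j → j ≤ i → (ψ (i + t) (j + t) ↔ ψ i j))
    (h2 : ∀ i j : ℕ, 1 ≤ j → j + r < i → ¬ ψ i j) (β : ℕ → Prop) (i : ℕ) :
    ((Finset.Icc 1 i).filter fun j => ψ i j ∧ β j).card =
      (((Finset.range (r + 1)).filter fun d => ψ (1 + d) 1).filter
        fun d => d < i ∧ β (i - d)).card := by
  have key : ∀ j, 1 ≤ j → j ≤ i → (ψ i j ↔ ψ (1 + (i - j)) 1) := by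
    intro j hj hji
    rw [← h1 (1 + (i - j)) 1 (j - 1) le_rfl (by omega)]
    rw [show 1 + (i - j) + (j - 1) = i by omega, show 1 + (j - 1) = j by omega]
  refine Finset.card_nbij' (fun j => i - j) (fun d => i - d) ?_ ?_ ?_ ?_
  · intro j hj
    simp only [Finset.coe_filter, Finset.mem_Icc, Set.mem_ofPred_eq, Finset.mem_filter,
      Finset.mem_range] at hj ⊢
    obtain ⟨⟨hj1, hji⟩, hψ, hβ⟩ := hj
    have hr : ¬ j + r < i := fun hlt => h2 i j hj1 hlt hψ
    refine ⟨⟨by omega, (key j hj1 hji).1 hψ⟩, by omega, ?_⟩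
    rwa [show i - (i - j) = j by omega]
  · intro d hd
    simp only [Finset.coe_filter, Finset.mem_Icc, Set.mem_ofPred_eq, Finset.mem_filter,
      Finset.mem_range] at hd ⊢
    obtain ⟨⟨hdr, hψ⟩, hdi, hβ⟩ := hd
    refine ⟨⟨by omega, by omega⟩, (key _ (by omega) (by omega)).2 ?_, hβ⟩
    rwa [show i - (i - d) = d by omega]
  · intro j hj
    simp only [Finset.coe_filter, Finset.mem_Icc, Set.mem_ofPred_eq] at hj
    dsimp only
    omega
  · intro d hd
    simp only [Finset.coe_filter, Finset.mem_filter, Set.mem_ofPred_eq] at hd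
    dsimp only
    omega

/-- The new constant `M'` is fixed before k and before the layers, so that k can later be taken
large compared with all constants of the program. -/
theorem exists_countOp {Ψ : Set (ℕ → ℕ → Prop)} (hΨ : ∀ ψ ∈ Ψ, IsLocalRel ψ) {nb nc : ℕ}
    (op : CountOp Ψ nb nc) (hop : c.usePos ∨ op.PositionFree) (ε : ℝ) (M : ℕ) :
    ∃ M', M ≤ M' ∧ ∀ {k ls N o t u}, Ready c ε k ls N o t u →
      ∀ {β : Fin nb → Word A → ℕ → Prop} {κ : Fin nc → Word A → ℕ → ℤ},
      (∀ p, ∃ f, BoolAt c ε ls N f (β p)) → (∀ q, ∃ f, CountAt c ε k M ls N f (κ q)) →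
      ∃ ls' N', Ready c ε k ls' N' o t u ∧ Keeps c ε ls N ls' N' ∧
        ∃ f, CountAt c ε k M' ls' N' f fun w => op.eval w (fun p => β p w) fun q => κ q w := by
  cases op with
  | count p =>
    refine ⟨M + 1, by omega, fun {k ls N o t u} h β κ hβ hκ => ?_⟩
    obtain ⟨G, hG⟩ := h.stage
    obtain ⟨f, hf⟩ := hβ p
    obtain ⟨ls', h1, h2, h3⟩ := hG.countAll (k := k) hf h.one
    exact ⟨ls', _, h.keeps h1 h2, h2, _, h3.mono (by omega)⟩
  | countRel ψ hψ p =>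
    obtain ⟨hinv, r, hr⟩ := hΨ ψ hψ
    have hu : c.usePos := hop.resolve_right id
    refine ⟨M + ((Finset.range (r + 1)).filter fun d => ψ (1 + d) 1).card, by omega,
      fun {k ls N o t u} h β κ hβ hκ => ?_⟩
    obtain ⟨f, hf⟩ := hβ p
    obtain ⟨ls', N', h1, h2, g, h3⟩ := h.countBack hu hf
      ((Finset.range (r + 1)).filter fun d => ψ (1 + d) 1)
    refine ⟨ls', N', h1, h2, g, (h3.mono (by omega)).congr fun w hw i hi hi1 => ?_⟩
    rw [← card_filter_rel hinv hr]
    rfl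
  | countMatch χ =>
    refine ⟨M + 1, by omega, fun {k ls N o t u} h β κ hβ hκ => ?_⟩
    obtain ⟨G, hG⟩ := h.stage
    -- With positional encodings, registers are added until all displacements in the clauses are
    -- covered. Otherwise all displacements are 0, and register 0 is present from the start.
    have : ∃ G' ls₁, Stage c ε G' ls₁ N ∧ Keeps c ε ls N ls₁ N ∧ ∀ m ∈ χ, m.δ < G' ∧ m.γ < G' := by
      rcases hop with hu | hfree
      · obtain ⟨ls₁, h1, h2⟩ := hG.addRegs hu h.one
          (G' := G + (χ.map fun m => m.δ + m.γ + 1).sum) (by omega)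
        refine ⟨_, ls₁, h1, h2, fun m hm => ?_⟩
        have := List.single_le_sum (l := χ.map fun m => m.δ + m.γ + 1) (fun _ _ => Nat.zero_le _) _
          (List.mem_map_of_mem hm)
        omega
      · refine ⟨G, ls, hG, Keeps.rfl, fun m hm => ?_⟩
        have := hfree m hm
        have := hG.one_le
        omega
    obtain ⟨G', ls₁, h1, h2, h3⟩ := this
    obtain ⟨ls', h4, h5, h6⟩ := h1.countMatch (k := k) (h2.bool h.top) (h2 _ _ h.one) χ h3
    exact ⟨ls', _, h.keeps h4 (h2.trans h5), h2.trans h5, _, h6.mono (by omega)⟩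
  | cond p q q' =>
    refine ⟨M, le_rfl, fun {k ls N o t u} h β κ hβ hκ => ?_⟩
    obtain ⟨G, hG⟩ := h.stage
    obtain ⟨f, hf⟩ := hβ p
    obtain ⟨g, hg⟩ := hκ q
    obtain ⟨g', hg'⟩ := hκ q'
    obtain ⟨ls', h1, h2, h3⟩ := hG.cond hf hg hg'
    exact ⟨ls', _, h.keeps h1 h2, h2, _, h3⟩
  | add q q' =>
    refine ⟨M + M, by omega, fun {k ls N o t u} h β κ hβ hκ => ?_⟩
    obtain ⟨G, hG⟩ := h.stage
    obtain ⟨g, hg⟩ := hκ q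
    obtain ⟨g', hg'⟩ := hκ q'
    obtain ⟨ls', h1, h2, h3⟩ := hG.addSub (s := 1) (by simp) hg hg'
    exact ⟨ls', _, h.keeps h1 h2, h2, _, h3.congr fun w _ i _ _ => by
      rw [one_mul]; rfl⟩
  | sub q q' =>
    refine ⟨M + M, by omega, fun {k ls N o t u} h β κ hβ hκ => ?_⟩
    obtain ⟨G, hG⟩ := h.stage
    obtain ⟨g, hg⟩ := hκ q
    obtain ⟨g', hg'⟩ := hκ q'
    obtain ⟨ls', h1, h2, h3⟩ := hG.addSub (s := -1) (by simp) hg hg'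
    exact ⟨ls', _, h.keeps h1 h2, h2, _, h3.congr fun w _ i _ _ => by
      rw [neg_one_mul, ← sub_eq_add_neg]; rfl⟩
  | one => exact ⟨M + 1, by omega, fun {k ls N o t u} h β κ hβ hκ =>
      ⟨ls, N, h, Keeps.rfl, u, h.unit.mono (by omega)⟩⟩

/-- Induction over the program. A Boolean operation raises the threshold for k and a count operation
may raise the error constant; since k remains free throughout, a sufficiently large value serves the
whole program. -/
theorem exists_compile {Ψ : Set (ℕ → ℕ → Prop)} (hΨ : ∀ ψ ∈ Ψ, IsLocalRel ψ) (c : Encoding A)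
    (ε : ℝ) {n : ℕ} (hinj : Function.Injective c.letter) (hpos : ∀ σ, 1 ≤ c.letter σ)
    (hn : ∀ σ, c.letter σ ≤ n) {nb nc : ℕ} (s : Ops A Ψ nb nc)
    (hs : c.usePos ∨ s.PositionFree) :
    ∃ M k₀, ∀ k ≥ k₀, ∃ ls N o t u, Ready c ε k ls N o t u ∧
      (∀ p, ∃ f, BoolAt c ε ls N f fun w => (s.eval w).1 p) ∧
      ∀ q, ∃ f, CountAt c ε k M ls N f fun w => (s.eval w).2 q := by
  induction s with
  | nil =>
    refine ⟨0, 0, fun k _ => ?_⟩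
    obtain ⟨ls, N, o, t, u, h⟩ := exists_ready c ε hinj hpos hn k
    exact ⟨ls, N, o, t, u, h, fun p => p.elim0, fun q => q.elim0⟩
  | snocBool s op ih =>
    obtain ⟨M, k₀, H⟩ := ih hs
    refine ⟨M, max k₀ (4 * M + 3), fun k hk => ?_⟩
    obtain ⟨ls, N, o, t, u, h, hβ, hκ⟩ := H k (le_of_max_le_left hk)
    obtain ⟨ls', N', h', hk', f, hf⟩ := h.boolOp (le_of_max_le_right hk) op hβ hκ
    refine ⟨ls', N', o, t, u, h', fun p => ?_, fun q => ?_⟩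
    · induction p using Fin.lastCases with
      | last => exact ⟨f, by simpa [Ops.eval] using hf⟩
      | cast p =>
        obtain ⟨g, hg⟩ := hβ p
        exact ⟨g, by simpa [Ops.eval] using hk'.bool hg⟩
    · obtain ⟨g, hg⟩ := hκ q
      exact ⟨g, hk'.count hg⟩
  | snocCount s op ih =>
    obtain ⟨M, k₀, H⟩ := ih (hs.imp_right And.left)
    obtain ⟨M', hM, H'⟩ := exists_countOp hΨ op (hs.imp_right And.right) ε M
    refine ⟨M', k₀, fun k hk => ?_⟩
    obtain ⟨ls, N, o, t, u, h, hβ, hκ⟩ := H k hk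
    obtain ⟨ls', N', h', hk', f, hf⟩ := H' h hβ hκ
    refine ⟨ls', N', o, t, u, h', fun p => ?_, fun q => ?_⟩
    · obtain ⟨g, hg⟩ := hβ p
      exact ⟨g, hk'.bool hg⟩
    · induction q using Fin.lastCases with
      | last => exact ⟨f, by simpa [Ops.eval] using hf⟩
      | cast q =>
        obtain ⟨g, hg⟩ := hκ q
        exact ⟨g, by simpa [Ops.eval] using (hk'.count hg).mono hM⟩

end Residual

/-! ### The main theorem -/

theorem theoremC {A : Type*} [Finite A] (ε : ℝ) (hε : 0 < ε)
    (Ψ : Set (ℕ → ℕ → Prop)) (hΨ : ∀ ψ ∈ Ψ, IsLocalRel ψ) (P : Program A Ψ) :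
    ∃ (H : Type) (_ : NormedAddCommGroup H) (_ : InnerProductSpace ℝ H) (_ : CompleteSpace H)
      (T : Transformer A H),
      T.IsSymbolicLimit ∧
      (∀ w : Word A, w ≠ [] → (P.Accepts w ↔ T.Accepts ε w)) ∧
      (P.PositionFree →
        (∀ t, T.pos t = 0) ∧
        LengthGeneralizes ε (fun _ M => M.NoPE) (T.fn ε)) ∧
      (¬ P.PositionFree →
        (∃ t, T.pos t ≠ 0) ∧
        LengthGeneralizes ε (fun _ _ => True) (T.fn ε)) := by
  -- Positions are encoded exactly when the program needs them. Letters occupy the slots from 1 on,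
  -- as slot 0 belongs to the start symbol.
  let c : Residual.Encoding A := ⟨¬ P.PositionFree, fun σ => Finite.equivFin A σ + 1⟩
  have hinj : Function.Injective c.letter := fun σ τ h => by
    have h' : (Finite.equivFin A σ : ℕ) + 1 = Finite.equivFin A τ + 1 := h
    exact (Finite.equivFin A).injective (Fin.ext (by omega))
  obtain ⟨M, k₀, hk⟩ := Residual.exists_compile hΨ c ε (n := Nat.card A) hinj (fun _ => Nat.le_add_left _ _)
    (fun σ => (Finite.equivFin A σ).2) P.ops (em' P.PositionFree)
  -- The final operation may itself be a comparison, which requires k to be at least 4M + 3 as well.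
  obtain ⟨ls, N, o, t, u, hr, hβ, hκ⟩ := hk (max k₀ (4 * M + 3)) (le_max_left _ _)
  obtain ⟨ls', N', ⟨⟨G, hG⟩, -, -, -⟩, -, out, hout⟩ := hr.boolOp (le_max_right _ _) P.final hβ hκ
  obtain ⟨R₀, hR⟩ := Transformer.exists_hypothesis
    (Residual.assemble_isSymbolicLimit (c := c) (out := out) hG.good) (Residual.assemble_isIntegral hG.good) ε
  refine ⟨Residual.Space, inferInstance, inferInstance, inferInstance, Residual.assemble c ls' out,
    Residual.assemble_isSymbolicLimit hG.good, fun w hw => ?_, fun hP => ?_, fun hP => ?_⟩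
  · rw [Residual.accepts_assemble, hout.2 w hw _ le_rfl]
    dsimp only
    split_ifs with hc
    · exact iff_of_true hc.2 one_pos
    · exact iff_of_false (fun h => hc ⟨List.length_pos_of_ne_nil hw, h⟩) (lt_irrefl _)
  · have hpos : ∀ t, c.pos t = 0 := fun t => if_neg (not_not.2 hP)
    refine ⟨hpos, Hypothesis.lengthGeneralizes_of_bounded (R₀ := R₀) (fun hmn M h t ht => ?_)
      -- The compression of a limit without positional encodings has none either, so it is
      -- admissible for the restricted procedure.
      fun n _ => ?_⟩
    · exact h t (ht.trans_le hmn)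
    · obtain ⟨M, h1, h2, h3⟩ := hR n
      exact ⟨M, h1 hpos, h2, h3⟩
  · have hpos : c.pos 0 = Residual.e (Coord.pos 0) := if_pos hP
    refine ⟨⟨0, fun h => ?_⟩, Hypothesis.lengthGeneralizes_of_bounded (R₀ := R₀)
      (fun _ _ _ => trivial) fun n _ => ?_⟩
    · exact Residual.orthonormal_e.ne_zero (Coord.pos 0) (hpos.symm.trans h)
    · obtain ⟨M, -, h2, h3⟩ := hR n
      exact ⟨M, trivial, h2, h3⟩
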